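/- Let $d\ge 1$, $m\ge 0$, and let $A:\mathbb R^d\to\mathbb R^d$ be a vector potential. Let $n(y)$ be the density of the Lévy measure of $\sqrt{\xi^2+m^2}-m$, i.e. $$n(y)=2\Big(\frac m{2\pi}\Big)^{\frac{d+1}2}\frac{K_{(d+1)/2}(m|y|)}{|y|^{(d+1)/2}}\ \ (m>0),\qquad n(y)=\frac{\Gamma(\frac{d+1}2)}{\pi^{(d+1)/2}}\frac1{|y|^{d+1}}\ \ (m=0),$$ where $K_\nu$ is the modified Bessel function of the third kind. Put $$P^{(1)}(x,y)=A\big(\tfrac{x+y}2\big),\qquad P^{(2)}(x,y)=\int_0^1A((1-\theta)x+\theta y)\,d\theta .$$ An operator $H$ in $L^2(\mathbb R^d)$ is said to satisfy $H\ge m$ if $(u,Hu)$ is real and $(u,Hu)\ge m\|u\|^2$ for all $u\in D(H)$. The three magnetic relativistic kinetic operators satisfy $H^{(j)}_A\ge m$, $j=1,2,3$, in the following sense. (a) If $A\in L^{2+\delta}_{\rm loc}$ for some $\delta>0$ and $j=1,2$, then for every $f\in C_0^\infty(\mathbb R^d)$ the limit in $$(H_A^{(j)}f)(x)=mf(x)-\lim_{r\to0+}\int_{|y|\ge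 r}\big[e^{-iy\cdot P^{(j)}(x,x+y)}f(x+y)-f(x)\big]n(y)\,dy$$ exists in $L^2(\mathbb R^d)$, and the closure $H^{(j)}_A$ of the integral operator so defined on $C_0^\infty(\mathbb R^d)$ satisfies $H^{(j)}_A\ge m$. (b) If $A\in L^{1+\delta}_{\rm loc}$ for some $\delta>0$ and $j=1,2$, then there is a selfadjoint operator $H^{(j)}_A$ associated with the quadratic form $$h_A^{(j)}[u]=m\|u\|^2+\frac12\iint\big|e^{-i(x-y)\cdot P^{(j)}(x,y)}u(x)-u(y)\big|^2n(x-y)\,dx\,dy$$ with form domain $Q^{(j)}=\{u\in L^2:\ h_A^{(j)}[u]<\infty\}$, i.e. $u\in D(H^{(j)}_A)$ and $H_A^{(j)}u=w$ if and only if $u\in Q^{(j)}$ and $h^{(j)}_A[u,v]=(w,v)$ for all $v\in Q^{(j)}$; and $H_A^{(j)}\ge m$. (c) Let $(-i\nabla-A)^2$ be the operator associated with the form $\|(-i\nabla-A)u\|^2$ with form domain $\{u\in L^2:\ Au\in L^1_{\rm loc},\ (-i\nabla-A)u\in L^2\}$. If $A\in L^2_{\rm loc}$, then $(-i\nabla-A)^2+m^2$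 has a square root $H_A^{(3)}=\sqrt{(-i\nabla-A)^2+m^2}$, i.e. there is a nonnegative selfadjoint operator whose square is $(-i\nabla-A)^2+m^2$. If $A\in L^{1+\delta}_{\rm loc}$ for some $\delta>0$, then every such square root satisfies $H^{(3)}_A\ge m$. -/

import Mathlib

open MeasureTheory Filter Topology
open scoped ContDiff InnerProductSpace

namespace MagneticRelativistic

noncomputable section

/-- The Euclidean space `ℝ^d`. -/
abbrev Space (d : ℕ) : Type := EuclideanSpace ℝ (Fin d)

/-- The Hilbert space `L²(ℝ^d; ℂ)`; its inner product is antilinear in the first entry. -/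
abbrev L2 (d : ℕ) : Type := Lp ℂ 2 (volume : Measure (Space d))

/-- `A ∈ L^p_loc(ℝ^d; ℝ^d)`. -/
def LocLp {d : ℕ} (A : Space d → Space d) (p : ℝ) : Prop :=
  ∀ K : Set (Space d), IsCompact K → MemLp A (ENNReal.ofReal p) (volume.restrict K)

/-- `f ∈ C_0^∞(ℝ^d; ℂ)`. -/
def IsTest {d : ℕ} (f : Space d → ℂ) : Prop :=
  ContDiff ℝ ∞ f ∧ HasCompactSupport f

/-! ### Lower bounds -/

/-- An operator in `L²`, given by its graph `G`, is `≥ c`: for `w = H u` the number `(u, H u)` is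
real and at least `c ‖u‖²`. -/
def BoundedBelow {d : ℕ} (G : Set (L2 d × L2 d)) (c : ℝ) : Prop :=
  ∀ u w : L2 d, (u, w) ∈ G →
    (⟪u, w⟫_ℂ).im = 0 ∧ c * ‖u‖ ^ 2 ≤ (⟪u, w⟫_ℂ).re

/-! ### The Lévy measure of `√(ξ² + m²) - m` -/

/-- The modified Bessel function of the third kind `K_ν(τ)`, `τ > 0`. -/
def besselK (ν τ : ℝ) : ℝ :=
  ∫ t in Set.Ioi (0 : ℝ), Real.exp (-τ * Real.cosh t) * Real.cosh (ν * t)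

/-- The density `n(y)` of the Lévy measure, for `y ≠ 0`
(the divisions make it `0` at `y = 0`, so integrals extend over `y ≠ 0` only). -/
def levyDensity (d : ℕ) (m : ℝ) (y : Space d) : ℝ :=
  if m = 0 then
    Real.Gamma (((d : ℝ) + 1) / 2) / Real.pi ^ (((d : ℝ) + 1) / 2) / ‖y‖ ^ (d + 1)
  else
    2 * (m / (2 * Real.pi)) ^ (((d : ℝ) + 1) / 2) *
      (besselK (((d : ℝ) + 1) / 2) (m * ‖y‖) / ‖y‖ ^ (((d : ℝ) + 1) / 2))

/-! ### The two effective potentials between `x` and `y` -/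

/-- Mid-point prescription: `A((x + y)/2)`, used for `H_A^{(1)}`. -/
def midPotential {d : ℕ} (A : Space d → Space d) (x y : Space d) : Space d :=
  A ((1 / 2 : ℝ) • (x + y))

/-- Average over the segment: `∫₀¹ A((1-θ)x + θy) dθ`, used for `H_A^{(2)}`. -/
def avgPotential {d : ℕ} (A : Space d → Space d) (x y : Space d) : Space d :=
  ∫ θ in (0 : ℝ)..1, A ((1 - θ) • x + θ • y)

/-! ### `H_A^{(1)}` and `H_A^{(2)}` as singular integral operators

In this and the next section `P` is one of the effective potentials `midPotential A`,
`avgPotential A`. -/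

/-- `∫_{|y| ≥ r} [e^{-i y·P(x, x+y)} f(x+y) - f(x)] n(y) dy`. -/
def truncatedIntegral {d : ℕ} (P : Space d → Space d → Space d) (m r : ℝ)
    (f : Space d → ℂ) (x : Space d) : ℂ :=
  ∫ y in {y : Space d | r ≤ ‖y‖},
    (Complex.exp (-Complex.I * ((⟪y, P x (x + y)⟫_ℝ : ℝ) : ℂ)) * f (x + y) - f x) *
      ((levyDensity d m y : ℝ) : ℂ)

/-- The graph of the integral operator `f ↦ m f - p.v. ∫ [e^{-i y·P(x, x+y)} f(x+y) - f(x)] n(dy)`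
on `C_0^∞`: the pairs `(u, w)` with `u` (the class of) a test function `f` and `w - m f` the
limit in `L²`, as `r → 0+`, of minus the truncated integrals (the principal value in `L²`). -/
def integralOperator {d : ℕ} (P : Space d → Space d → Space d) (m : ℝ) : Set (L2 d × L2 d) :=
  {q | ∃ f : Space d → ℂ, IsTest f ∧ q.1 =ᵐ[volume] f ∧
    Tendsto
      (fun r : ℝ => eLpNorm
        (fun x => -truncatedIntegral P m r f x - (q.2 x - (m : ℂ) * f x)) 2 volume)
      (𝓝[>] 0) (𝓝 0)}

/-- The domain of the operator with graph `G` contains `C_0^∞`. -/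
def DefinedOnTests {d : ℕ} (G : Set (L2 d × L2 d)) : Prop :=
  ∀ f : Space d → ℂ, IsTest f → ∃ u w : L2 d, u =ᵐ[volume] f ∧ (u, w) ∈ G

/-! ### `H_A^{(1)}` and `H_A^{(2)}` as operators associated with quadratic forms -/

/-- `e^{-i (x-y)·P(x,y)} u(x) - u(y)`. -/
def magneticDifference {d : ℕ} (P : Space d → Space d → Space d) (u : L2 d)
    (p : Space d × Space d) : ℂ :=
  Complex.exp (-Complex.I * ((⟪p.1 - p.2, P p.1 p.2⟫_ℝ : ℝ) : ℂ)) * u p.1 - u p.2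

/-- The form domain: all `u ∈ L²` with
`∫∫ |e^{-i (x-y)·P(x,y)} u(x) - u(y)|² n(x-y) dx dy < ∞`. -/
def formDomain {d : ℕ} (P : Space d → Space d → Space d) (m : ℝ) : Set (L2 d) :=
  {u | ∫⁻ p : Space d × Space d,
    ENNReal.ofReal (‖magneticDifference P u p‖ ^ 2 * levyDensity d m (p.1 - p.2)) < ⊤}

/-- The sesquilinear form `h[u, v]`, antilinear in `u`, with
`h[u, u] = m ‖u‖² + ½ ∫∫ |e^{-i (x-y)·P(x,y)} u(x) - u(y)|² n(x-y) dx dy`. -/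
def form {d : ℕ} (P : Space d → Space d → Space d) (m : ℝ) (u v : L2 d) : ℂ :=
  (m : ℂ) * ⟪u, v⟫_ℂ + (1 / 2 : ℂ) * ∫ p : Space d × Space d,
    (starRingEnd ℂ) (magneticDifference P u p) * magneticDifference P v p *
      ((levyDensity d m (p.1 - p.2) : ℝ) : ℂ)

/-- The graph of the operator `H` associated with the form `h`: `u ∈ D(H)` and `H u = w` iff
`u` is in the form domain and `h[u, v] = (w, v)` for all `v` in the form domain. -/
def formOperator {d : ℕ} (P : Space d → Space d → Space d) (m : ℝ) : Set (L2 d × L2 d) :=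
  {q | q.1 ∈ formDomain P m ∧ ∀ v ∈ formDomain P m, form P m q.1 v = ⟪q.2, v⟫_ℂ}

/-- `H` is the selfadjoint operator associated with the form `h`. -/
def IsFormOperator {d : ℕ} (P : Space d → Space d → Space d) (m : ℝ)
    (H : L2 d →ₗ.[ℂ] L2 d) : Prop :=
  IsSelfAdjoint H ∧ (H.graph : Set (L2 d × L2 d)) = formOperator P m

/-! ### `H_A^{(3)}` as a square root -/

/-- `(-i∇ - A) u = g` in the sense of distributions, with `g ∈ L²(ℝ^d; ℂ^d)`. -/
def IsMagneticGradient {d : ℕ} (A : Space d → Space d) (u : L2 d) (g : Fin d → L2 d) : Prop :=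
  ∀ k : Fin d,
    LocallyIntegrable (fun x => ((A x k : ℝ) : ℂ) * u x) volume ∧
    ∀ φ : Space d → ℂ, IsTest φ →
      (∫ x, (Complex.I * (u x * fderiv ℝ φ x (EuclideanSpace.single k 1)) -
        ((A x k : ℝ) : ℂ) * u x * φ x)) = ∫ x, g k x * φ x

/-- The graph of `(-i∇ - A)²`, the operator associated with the form
`∑ₖ ((-i∂ₖ - Aₖ)u, (-i∂ₖ - Aₖ)v)` on the form domain `{u ∈ L² | (-i∇ - A)u ∈ L²}`. -/
def magneticLaplacian {d : ℕ} (A : Space d → Space d) : Set (L2 d × L2 d) :=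
  {q | ∃ g : Fin d → L2 d, IsMagneticGradient A q.1 g ∧
    ∀ (v : L2 d) (h : Fin d → L2 d), IsMagneticGradient A v h →
      ∑ k, ⟪g k, h k⟫_ℂ = ⟪q.2, v⟫_ℂ}

/-- `H` is the square root `√((-i∇ - A)² + m²)`: a nonnegative selfadjoint operator whose square,
with its natural domain, is `(-i∇ - A)² + m²`. -/
def IsMagneticSqrt {d : ℕ} (A : Space d → Space d) (m : ℝ) (H : L2 d →ₗ.[ℂ] L2 d) : Prop :=
  IsSelfAdjoint H ∧ BoundedBelow (H.graph : Set (L2 d × L2 d)) 0 ∧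
  ∀ u w : L2 d, (∃ v : L2 d, (u, v) ∈ H.graph ∧ (v, w) ∈ H.graph) ↔
    (u, w - ((m ^ 2 : ℝ) : ℂ) • u) ∈ magneticLaplacian A

end

end MagneticRelativistic

/-! Both effective potentials are averages of `A` over the segment from `x` to `y` against a
probability weight on `[0, 1]` symmetric under `θ ↦ 1 - θ` (`IsSegmentWeight`): the point mass at
`1/2`, or Lebesgue measure. One argument serves both.

Form operators. The form is `m ‖u‖² + ‖T u‖²`, where `T u` is the magnetic difference times `√(n(x -
y)/2)`. On its maximal domain `T` is closed, so von Neumann's theorem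
(`exists_isSelfAdjoint_associated`) makes `T* T + m` selfadjoint as soon as the domain is dense, and
the lower bound is visible. Density comes from test functions (`test_mem_formDomain`): the bound
`|e^{-it} - 1|² ≤ 4 |t|^{1+δ}` gains `|y|^{1+δ}` against `n(y) ≤ C |y|^{-d-1}`.

Square root. For `T u = ((-i∇ - A) u, m u)` and `R = (1 + T* T)⁻¹`, the operator `√(1 - R) (√R)⁻¹`
is a root of `T* T` (`exists_sqrt_associated`). Conversely, `H ≥ 0` and `H² ≥ m²` force `H ≥ m`: for
`m > 0`, evaluate the form of `H` at `H⁻¹ u - u/m` (`lower_bound_of_sq`).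

Integral operators, lower bound. After truncation the kernel is integrable and Hermitian under
exchange of the endpoints, so its form is real and nonnegative (`truncated_form_nonneg`). This
passes to the `L²` limit and to the closure.

Integral operators, existence of the limit. Expand the integrand in `y`. The gradient term is odd
and drops out. The first-order phase term, with `n` replaced by its leading part `c |y|^{-d-1}` and
`f` moved to the segment point at which `A` is taken, becomes a sum of truncated singular integrals
of the functions `A_j f`. These are Fourier multipliers, bounded uniformly in the truncation because
`∫ sin(aρ) dρ/ρ` is, and they converge in `L²` by Plancherel and dominated convergence
(`exists_tendsto_riesz`). What remains near the diagonal is at most `|y|^{s-d}` times averages of `1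
+ |A|^{1+s}` over the segment, so Minkowski's inequality gives absolute convergence in `L²` when `A`
is locally in `L^{2+2s}`. -/

namespace MagneticRelativistic

noncomputable section

/-! ### Operators `T* T` given by closed graphs: resolvent, selfadjointness, square roots. -/

section Abstract

variable {E K : Type*} [NormedAddCommGroup E] [InnerProductSpace ℂ E]
  [NormedAddCommGroup K] [InnerProductSpace ℂ K]

/-- The relation `T* T` associated with the form `⟪T u, T v⟫`, where `T` is given by its graph. -/
def associated (Γ : Submodule ℂ (WithLp 2 (E × K))) : Set (E × E) :=
  {q | ∃ g : K, WithLp.toLp 2 (q.1, g) ∈ Γ ∧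
    ∀ v h, WithLp.toLp 2 (v, h) ∈ Γ → ⟪g, h⟫_ℂ = ⟪q.2, v⟫_ℂ}

theorem associated_nonneg {Γ : Submodule ℂ (WithLp 2 (E × K))} {u w : E}
    (h : (u, w) ∈ associated Γ) : (⟪u, w⟫_ℂ).im = 0 ∧ 0 ≤ (⟪u, w⟫_ℂ).re := by
  obtain ⟨g, hg, hv⟩ := h
  have h1 := hv u g hg
  have h2 : ⟪u, w⟫_ℂ = ((‖g‖ ^ 2 : ℝ) : ℂ) := by
    rw [← inner_conj_symm, ← h1, inner_conj_symm, inner_self_eq_norm_sq_to_K]; norm_cast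
  rw [h2]
  exact ⟨Complex.ofReal_im _, by rw [Complex.ofReal_re]; positivity⟩

variable [CompleteSpace E] [CompleteSpace K]

/-- A subspace of `E × E` that equals its own adjoint relation and has dense first projection is
the graph of a selfadjoint operator. -/
theorem exists_isSelfAdjoint_of_graph (G : Submodule ℂ (E × E))
    (hd : Dense {u : E | ∃ w, (u, w) ∈ G})
    (hG : ∀ u w : E, (u, w) ∈ G ↔ ∀ a b : E, (a, b) ∈ G → ⟪b, u⟫_ℂ = ⟪a, w⟫_ℂ) :
    ∃ H : E →ₗ.[ℂ] E, IsSelfAdjoint H ∧ H.graph = G := by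
  -- A symmetric relation with dense first projection is single valued: if `(0, w)` belongs to it,
  -- then `w` is orthogonal to every first component.
  have hs : ∀ x : E × E, x ∈ G → x.1 = 0 → x.2 = 0 := by
    rintro ⟨u, w⟩ hx (rfl : u = 0)
    refine hd.eq_zero_of_inner_right ℂ ?_
    rintro a ⟨b, hab⟩
    rw [← (hG 0 w).1 hx a b hab, inner_zero_right]
  have hgr := Submodule.toLinearPMap_graph_eq G hs
  refine ⟨G.toLinearPMap, ?_, hgr⟩
  have hdom : Dense (G.toLinearPMap.domain : Set E) := by
    refine hd.mono ?_
    rintro u ⟨w, hw⟩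
    exact Submodule.mem_map.2 ⟨(u, w), hw, rfl⟩
  rw [LinearPMap.isSelfAdjoint_def]
  apply LinearPMap.eq_of_eq_graph
  rw [LinearPMap.adjoint_graph_eq_graph_adjoint hdom, hgr]
  ext ⟨u, w⟩
  rw [Submodule.mem_adjoint_iff, hG]
  simp only [sub_eq_zero]

/-- Conversely, the graph of a selfadjoint operator equals its adjoint relation. -/
theorem mem_graph_iff_of_isSelfAdjoint {H : E →ₗ.[ℂ] E} (hH : IsSelfAdjoint H) (u w : E) :
    (u, w) ∈ H.graph ↔ ∀ a b : E, (a, b) ∈ H.graph → ⟪b, u⟫_ℂ = ⟪a, w⟫_ℂ := by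
  conv_lhs => rw [← LinearPMap.isSelfAdjoint_def.1 hH]
  rw [LinearPMap.adjoint_graph_eq_graph_adjoint hH.dense_domain, Submodule.mem_adjoint_iff]
  simp only [sub_eq_zero]

/-- The resolvent `(1 + T* T)⁻¹`. -/
theorem exists_resolvent (Γ : Submodule ℂ (WithLp 2 (E × K)))
    (hc : IsClosed (Γ : Set (WithLp 2 (E × K)))) :
    ∃ R : E →L[ℂ] E, IsSelfAdjoint R ∧ 0 ≤ R ∧ R ≤ 1 ∧
      (∀ u w, (u, w) ∈ associated Γ ↔ u = R (u + w)) ∧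
      (Dense {u : E | ∃ g, WithLp.toLp 2 (u, g) ∈ Γ} → Function.Injective R) := by
  have : CompleteSpace Γ := hc.completeSpace_coe
  let ι : E →L[ℂ] WithLp 2 (E × K) :=
    (WithLp.prodContinuousLinearEquiv 2 ℂ E K).symm.toContinuousLinearMap.comp
      (ContinuousLinearMap.inl ℂ E K)
  let π : WithLp 2 (E × K) →L[ℂ] E :=
    (ContinuousLinearMap.fst ℂ E K).comp
      (WithLp.prodContinuousLinearEquiv 2 ℂ E K).toContinuousLinearMap
  let p := Γ.starProjection
  -- If `Γ` is the graph of `T`, the orthogonal projection of `(h, 0)` to `Γ` is the pair `(u, T u)`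
  -- with `(h - u, -T u)` orthogonal to `Γ`, which says `u + T* T u = h`. Its first component is
  -- therefore `(1 + T* T)⁻¹ h`.
  let R : E →L[ℂ] E := π.comp (p.comp ι)
  have hι : ∀ h, ι h = WithLp.toLp 2 (h, 0) := fun h => rfl
  have hπ : ∀ z : WithLp 2 (E × K), ∀ h : E, ⟪π z, h⟫_ℂ = ⟪z, ι h⟫_ℂ := by
    intro z h
    rw [WithLp.prod_inner_apply]
    simp [hι, π]
  have hR : ∀ h k, ⟪R h, k⟫_ℂ = ⟪p (ι h), p (ι k)⟫_ℂ := by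
    intro h k
    rw [show R h = π (p (ι h)) from rfl, hπ]
    have h1 : p (p (ι h)) = p (ι h) :=
      Submodule.starProjection_eq_self_iff.2 (Submodule.starProjection_apply_mem Γ _)
    rw [← Submodule.inner_starProjection_left_eq_right Γ (p (ι h)) (ι k)]
    exact congrArg (fun z => ⟪z, ι k⟫_ℂ) h1.symm
  have hsym : (R : E →ₗ[ℂ] E).IsSymmetric := by
    intro h k
    have := hR k h
    rw [← inner_conj_symm] at this
    change ⟪R h, k⟫_ℂ = ⟪h, R k⟫_ℂ
    rw [hR, ← inner_conj_symm, ← hR, inner_conj_symm]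
  have hsa : IsSelfAdjoint R := ContinuousLinearMap.isSelfAdjoint_iff_isSymmetric.2 hsym
  have hnι : ∀ h, ‖ι h‖ = ‖h‖ := by
    intro h
    rw [hι]
    simp
  have hchar : ∀ u w, (u, w) ∈ associated Γ ↔ u = R (u + w) := by
    intro u w
    constructor
    · rintro ⟨g, hg, hv⟩
      have : p (ι (u + w)) = WithLp.toLp 2 (u, g) := by
        refine Submodule.eq_starProjection_of_mem_of_inner_eq_zero hg ?_
        intro z hz
        have := hv z.fst z.snd hz
        rw [WithLp.prod_inner_apply]
        simp [hι, inner_neg_left, this]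
      change u = π (p (ι (u + w)))
      rw [this]
      rfl
    · intro hu
      refine ⟨(p (ι (u + w))).snd, ?_, ?_⟩
      · have h2 : (p (ι (u + w))).fst = u := hu.symm
        have : WithLp.toLp 2 (u, (p (ι (u + w))).snd) = p (ι (u + w)) := by
          exact congrArg (fun z => WithLp.toLp 2 (z, (p (ι (u + w))).snd)) h2.symm
        dsimp only
        rw [this]
        exact Submodule.starProjection_apply_mem Γ _
      · intro v h hvh
        have h1 := Submodule.starProjection_inner_eq_zero (K := Γ) (ι (u + w)) _ hvh
        rw [WithLp.prod_inner_apply] at h1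
        have h2 : (p (ι (u + w))).fst = u := hu.symm
        change ⟪(ι (u + w)).fst - (p (ι (u + w))).fst, v⟫_ℂ +
          ⟪(ι (u + w)).snd - (p (ι (u + w))).snd, h⟫_ℂ = 0 at h1
        rw [h2, hι] at h1
        simp [inner_neg_left, ← sub_eq_add_neg] at h1
        exact (sub_eq_zero.1 h1).symm
  refine ⟨R, hsa, ?_, ?_, hchar, ?_⟩
  · rw [ContinuousLinearMap.nonneg_iff_isPositive, ContinuousLinearMap.isPositive_def']
    refine ⟨hsa, fun h => ?_⟩
    rw [ContinuousLinearMap.reApplyInnerSelf_apply, hR]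
    exact inner_self_nonneg
  · rw [ContinuousLinearMap.le_def, ContinuousLinearMap.isPositive_def']
    refine ⟨(IsSelfAdjoint.one _).sub hsa, fun h => ?_⟩
    rw [ContinuousLinearMap.reApplyInnerSelf_apply]
    simp only [sub_apply, one_apply_eq_self, inner_sub_left, map_sub]
    rw [hR, inner_self_eq_norm_sq, inner_self_eq_norm_sq, sub_nonneg, ← hnι h]
    gcongr
    exact Submodule.norm_starProjection_apply_le Γ _
  · intro hd
    rw [injective_iff_map_eq_zero]
    intro h h0
    -- From `R h = 0` it follows that `h` is a value of `T* T` at `0`. Testing with `(0, g)` itself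
    -- gives `g = 0`, and then `h` is orthogonal to the dense domain.
    have hm : ((0 : E), h) ∈ associated Γ := (hchar 0 h).2 (by rw [zero_add, h0])
    obtain ⟨g, hg, hv⟩ := hm
    have hg0 : g = 0 := by
      have := hv 0 g hg
      rw [inner_zero_right] at this
      exact inner_self_eq_zero.1 this
    refine hd.eq_zero_of_inner_left ℂ ?_
    rintro v ⟨k, hk⟩
    have := hv v k hk
    rw [hg0, inner_zero_left] at this
    exact this.symm

/-- The operator `T* T + c` is selfadjoint. -/
theorem exists_isSelfAdjoint_associated (Γ : Submodule ℂ (WithLp 2 (E × K)))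
    (hc : IsClosed (Γ : Set (WithLp 2 (E × K))))
    (hd : Dense {u : E | ∃ g, WithLp.toLp 2 (u, g) ∈ Γ}) (c : ℝ) :
    ∃ H : E →ₗ.[ℂ] E, IsSelfAdjoint H ∧
      ∀ u w, (u, w) ∈ H.graph ↔ (u, w - (c : ℂ) • u) ∈ associated Γ := by
  obtain ⟨R, hsa, -, -, hchar, hinj⟩ := exists_resolvent Γ hc
  have hsym : ∀ x y, ⟪R x, y⟫_ℂ = ⟪x, R y⟫_ℂ :=
    ContinuousLinearMap.isSelfAdjoint_iff_isSymmetric.1 hsa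
  -- The graph of `T* T + c` is the kernel of a bounded map, namely the set where `u = R (u + w - c
  -- u)`. Selfadjointness then reduces to the symmetry of `R`, and density of the domain to its
  -- injectivity.
  let L : E × E →ₗ[ℂ] E := LinearMap.fst ℂ E E -
    (R : E →ₗ[ℂ] E).comp (LinearMap.fst ℂ E E + LinearMap.snd ℂ E E -
      (c : ℂ) • LinearMap.fst ℂ E E)
  have hL : ∀ u w, (u, w) ∈ LinearMap.ker L ↔ u = R (u + (w - (c : ℂ) • u)) := by
    intro u w
    rw [LinearMap.mem_ker, ← sub_eq_zero (b := R _), ← add_sub_assoc]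
    rfl
  suffices h : ∃ H : E →ₗ.[ℂ] E, IsSelfAdjoint H ∧ H.graph = LinearMap.ker L by
    obtain ⟨H, hH, hg⟩ := h
    refine ⟨H, hH, fun u w => ?_⟩
    rw [hg, hchar, hL]
  refine exists_isSelfAdjoint_of_graph (LinearMap.ker L) ?_ ?_
  · have hr : DenseRange R := by
      have h0 : (LinearMap.range (R : E →ₗ[ℂ] E))ᗮ = ⊥ := by
        rw [Submodule.eq_bot_iff]
        intro x hx
        apply hinj hd
        rw [map_zero]
        refine ext_inner_left ℂ fun y => ?_
        rw [← hsym, inner_zero_right]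
        exact (Submodule.mem_orthogonal _ _).1 hx _ ⟨y, rfl⟩
      exact Submodule.dense_iff_topologicalClosure_eq_top.2
        ((Submodule.topologicalClosure_eq_top_iff).2 h0)
    refine hr.mono ?_
    rintro _ ⟨h, rfl⟩
    refine ⟨h - R h + (c : ℂ) • R h, (hL _ _).2 ?_⟩
    congr 1
    abel
  · intro u w
    rw [hL]
    constructor
    · intro hu a b hab
      rw [hL] at hab
      have e1 : ⟪a, u⟫_ℂ = ⟪R a, u + (w - (c : ℂ) • u)⟫_ℂ := by
        rw [hsym, ← hu]
      have e2 : ⟪a, u⟫_ℂ = ⟪a + (b - (c : ℂ) • a), R u⟫_ℂ := by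
        rw [← hsym, ← hab]
      have e4 : ⟪b, u⟫_ℂ = ⟪R b, u + (w - (c : ℂ) • u)⟫_ℂ := by rw [hsym, ← hu]
      have e5 : ⟪a, w⟫_ℂ = ⟪a + (b - (c : ℂ) • a), R w⟫_ℂ := by rw [← hsym, ← hab]
      rw [e4, e5]
      simp only [inner_add_left, inner_add_right, inner_sub_left, inner_sub_right,
        inner_smul_left, inner_smul_right, hsym, map_add, map_sub, map_smul,
        Complex.conj_ofReal] at e1 e2 ⊢
      linear_combination (1 - (c : ℂ)) * e1 - (1 - (c : ℂ)) * e2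
    · intro h
      refine ext_inner_left ℂ fun x => ?_
      have := h (R x) (x - R x + (c : ℂ) • R x) ((hL _ _).2 (by congr 1; abel))
      simp only [inner_add_left, inner_add_right, inner_sub_left, inner_sub_right,
        inner_smul_left, inner_smul_right, hsym, map_add, map_sub, map_smul,
        Complex.conj_ofReal] at this ⊢
      linear_combination this

/-- A bounded operator `0 ≤ R ≤ 1` has commuting selfadjoint roots `B = √R`, `C = √(1 - R)` with
`B C ≥ 0`. -/
theorem exists_sqrt_pair (R : E →L[ℂ] E) (h0 : 0 ≤ R) (h1 : R ≤ 1) :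
    ∃ B C : E →L[ℂ] E, IsSelfAdjoint B ∧ IsSelfAdjoint C ∧ B * B = R ∧ C * C = 1 - R ∧
      B * C = C * B ∧ 0 ≤ B * C := by
  have hsa : IsSelfAdjoint R := IsSelfAdjoint.of_nonneg h0
  have hs0 : ∀ x ∈ spectrum ℝ R, 0 ≤ x := fun x hx => spectrum_nonneg_of_nonneg h0 hx
  have hs1 : ∀ x ∈ spectrum ℝ R, x ≤ 1 := by
    have := (le_algebraMap_iff_spectrum_le (r := (1 : ℝ)) hsa).1 (by simpa using h1)
    simpa using this
  have hcB : ContinuousOn (fun x : ℝ => √x) (spectrum ℝ R) := by fun_prop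
  have hcC : ContinuousOn (fun x : ℝ => √(1 - x)) (spectrum ℝ R) := by fun_prop
  refine ⟨cfc (fun x : ℝ => √x) R, cfc (fun x : ℝ => √(1 - x)) R, cfc_predicate _ _,
    cfc_predicate _ _, ?_, ?_, (cfc_commute_cfc _ _ R), ?_⟩
  · rw [← cfc_mul _ _ R hcB hcB]
    conv_rhs => rw [← cfc_id ℝ R]
    exact cfc_congr fun x hx => Real.mul_self_sqrt (hs0 x hx)
  · rw [← cfc_mul _ _ R hcC hcC]
    have : (1 : E →L[ℂ] E) - R = cfc (fun x : ℝ => 1 - x) R := by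
      rw [cfc_sub _ _ R, cfc_const_one ℝ R]
      conv_lhs => rw [← cfc_id ℝ R]
      rfl
    rw [this]
    exact cfc_congr fun x hx => Real.mul_self_sqrt (sub_nonneg.2 (hs1 x hx))
  · rw [← cfc_mul _ _ R hcB hcC]
    exact cfc_nonneg fun x hx => mul_nonneg (Real.sqrt_nonneg _) (Real.sqrt_nonneg _)

/-- The operator `T* T` has a nonnegative selfadjoint square root. -/
theorem exists_sqrt_associated (Γ : Submodule ℂ (WithLp 2 (E × K)))
    (hc : IsClosed (Γ : Set (WithLp 2 (E × K))))
    (hd : Dense {u : E | ∃ g, WithLp.toLp 2 (u, g) ∈ Γ}) :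
    ∃ H : E →ₗ.[ℂ] E, IsSelfAdjoint H ∧
      (∀ u w, (u, w) ∈ H.graph → (⟪u, w⟫_ℂ).im = 0 ∧ 0 ≤ (⟪u, w⟫_ℂ).re) ∧
      ∀ u w, (∃ v, (u, v) ∈ H.graph ∧ (v, w) ∈ H.graph) ↔ (u, w) ∈ associated Γ := by
  obtain ⟨R, hsa, h0, h1, hchar, hinj⟩ := exists_resolvent Γ hc
  replace hinj := hinj hd
  obtain ⟨B, C, hB, hC, hBB, hCC, hBC, hpos⟩ := exists_sqrt_pair R h0 h1
  have sB : ∀ x y, ⟪B x, y⟫_ℂ = ⟪x, B y⟫_ℂ :=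
    ContinuousLinearMap.isSelfAdjoint_iff_isSymmetric.1 hB
  have sC : ∀ x y, ⟪C x, y⟫_ℂ = ⟪x, C y⟫_ℂ :=
    ContinuousLinearMap.isSelfAdjoint_iff_isSymmetric.1 hC
  have aBB : ∀ x, B (B x) = R x := fun x => congrArg (fun T : E →L[ℂ] E => T x) hBB
  have aCC : ∀ x, C (C x) = x - R x := fun x => congrArg (fun T : E →L[ℂ] E => T x) hCC
  have aBC : ∀ x, B (C x) = C (B x) := fun x => congrArg (fun T : E →L[ℂ] E => T x) hBC
  -- Since `B² + C² = 1`, the relation `B w = C u` is solved by `(u, w) = (B f, C f)` with `f = B u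
  -- + C w`.
  have key : ∀ u w, B w = C u → B (B u + C w) = u ∧ C (B u + C w) = w := by
    intro u w h
    constructor
    · rw [map_add, aBC, h, aBB, aCC]; abel
    · rw [map_add, ← aBC, ← h, aBB, aCC]; abel
  have hBinj : Function.Injective B := by
    intro x y hxy
    apply hinj
    rw [← aBB, ← aBB, hxy]
  -- Formally `T* T = R⁻¹ - 1 = C² B⁻²`, so the root is `C B⁻¹`. Its graph `{(B f, C f)}` needs no
  -- unbounded inverse.
  let G : Submodule ℂ (E × E) := LinearMap.range ((B : E →ₗ[ℂ] E).prod (C : E →ₗ[ℂ] E))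
  have hG : ∀ u w, (u, w) ∈ G ↔ B w = C u := by
    intro u w
    constructor
    · rintro ⟨f, hf⟩
      obtain ⟨rfl, rfl⟩ := Prod.ext_iff.1 hf
      exact aBC f
    · intro h
      exact ⟨B u + C w, Prod.ext (key u w h).1 (key u w h).2⟩
  have hGm : ∀ f, (B f, C f) ∈ G := fun f => ⟨f, rfl⟩
  have hdense : Dense {u : E | ∃ w, (u, w) ∈ G} := by
    have hr : DenseRange B := by
      have h0 : (LinearMap.range (B : E →ₗ[ℂ] E))ᗮ = ⊥ := by
        rw [Submodule.eq_bot_iff]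
        intro x hx
        apply hBinj
        rw [map_zero]
        refine ext_inner_left ℂ fun y => ?_
        rw [← sB, inner_zero_right]
        exact (Submodule.mem_orthogonal _ _).1 hx _ ⟨y, rfl⟩
      exact Submodule.dense_iff_topologicalClosure_eq_top.2
        ((Submodule.topologicalClosure_eq_top_iff).2 h0)
    refine hr.mono ?_
    rintro _ ⟨h, rfl⟩
    exact ⟨C h, hGm h⟩
  obtain ⟨H, hH, hg⟩ := exists_isSelfAdjoint_of_graph G hdense (fun u w => by
    rw [hG]
    constructor
    · rintro h _ _ ⟨f, hf⟩
      obtain ⟨rfl, rfl⟩ := Prod.ext_iff.1 hf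
      change ⟪C f, u⟫_ℂ = ⟪B f, w⟫_ℂ
      rw [sB, sC, h]
    · intro h
      refine ext_inner_left ℂ fun f => ?_
      rw [← sB, ← sC]
      exact (h _ _ (hGm f)).symm)
  refine ⟨H, hH, ?_, ?_⟩
  · intro u w huw
    rw [hg] at huw
    obtain ⟨f, hf⟩ := huw
    obtain ⟨rfl, rfl⟩ := Prod.ext_iff.1 hf
    change (⟪B f, C f⟫_ℂ).im = 0 ∧ 0 ≤ (⟪B f, C f⟫_ℂ).re
    rw [sB]
    have := ((ContinuousLinearMap.nonneg_iff_isPositive _).1 hpos).inner_nonneg_right f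
    rw [Complex.le_def] at this
    exact ⟨this.2.symm, this.1⟩
  · intro u w
    rw [hg, hchar]
    constructor
    · rintro ⟨v, ⟨f, hf⟩, ⟨g, hg'⟩⟩
      obtain ⟨rfl, rfl⟩ := Prod.ext_iff.1 hf
      obtain ⟨h2, rfl⟩ := Prod.ext_iff.1 hg'
      change B g = C f at h2
      obtain ⟨k1, k2⟩ := key f g h2
      change B f = R (B f + C g)
      rw [← aBB, k1]
    · intro hu
      -- With `h = u + w` one has `u = B² h` and `w = C² h`; the intermediate vector is `C B h`.
      have hw : w = C (C (u + w)) := by rw [aCC, ← hu]; abel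
      refine ⟨C (B (u + w)), ?_, ?_⟩
      · have := hGm (B (u + w))
        rwa [aBB, ← hu] at this
      · have := hGm (C (u + w))
        rwa [← hw, aBC] at this

/-- If the square of a nonnegative selfadjoint operator is bounded below by `m²`, then the operator
is bounded below by `m`. -/
theorem lower_bound_of_sq {H : E →ₗ.[ℂ] E} (hH : IsSelfAdjoint H) {m : ℝ} (hm : 0 ≤ m)
    (hpos : ∀ u w, (u, w) ∈ H.graph → (⟪u, w⟫_ℂ).im = 0 ∧ 0 ≤ (⟪u, w⟫_ℂ).re)
    (hsq : ∀ u v w, (u, v) ∈ H.graph → (v, w) ∈ H.graph → m ^ 2 * ‖u‖ ^ 2 ≤ (⟪u, w⟫_ℂ).re)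
    {u w : E} (huw : (u, w) ∈ H.graph) : m * ‖u‖ ^ 2 ≤ (⟪u, w⟫_ℂ).re := by
  -- For `m > 0` the plan is to construct `x = H⁻¹ u` with `m ‖x‖ ≤ ‖u‖` and to use positivity of
  -- the form at `x - u/m`. The inverse is needed only at the given vector `u`.
  rcases hm.eq_or_lt with rfl | hm
  · simpa using (hpos u w huw).2
  have hsym : ∀ {a b u w}, (a, b) ∈ H.graph → (u, w) ∈ H.graph → ⟪b, u⟫_ℂ = ⟪a, w⟫_ℂ :=
    fun hab huw => (mem_graph_iff_of_isSelfAdjoint hH _ _).1 huw _ _ hab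
  let e := WithLp.linearEquiv 2 ℂ (E × E)
  let Γ : Submodule ℂ (WithLp 2 (E × E)) := H.graph.comap e.toLinearMap
  have hΓ : ∀ a b, WithLp.toLp 2 (a, b) ∈ Γ ↔ (a, b) ∈ H.graph := fun a b => Iff.rfl
  have hc : IsClosed (Γ : Set (WithLp 2 (E × E))) :=
    hH.isClosed.preimage (WithLp.prod_continuous_ofLp 2 E E)
  -- Selfadjointness identifies `H* H` with `H²`, so `R` below is `(1 + H²)⁻¹`.
  have hass : ∀ a c, (a, c) ∈ associated Γ ↔ ∃ b, (a, b) ∈ H.graph ∧ (b, c) ∈ H.graph := by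
    intro a c
    constructor
    · rintro ⟨b, hb, h⟩
      refine ⟨b, hb, (mem_graph_iff_of_isSelfAdjoint hH _ _).2 fun x y hxy => ?_⟩
      rw [← inner_conj_symm, h x y hxy, inner_conj_symm]
    · rintro ⟨b, hb, hbc⟩
      refine ⟨b, hb, fun x y hxy => ?_⟩
      rw [← inner_conj_symm, hsym ((hΓ _ _).1 hxy) hbc, inner_conj_symm]
  obtain ⟨R, -, -, -, hchar, -⟩ := exists_resolvent Γ hc
  have hRm : ∀ h, (R h, h - R h) ∈ associated Γ := fun h => (hchar _ _).2 (by congr 1; abel)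
  -- The bound `H² ≥ m²` gives `‖R‖ ≤ 1 / (1 + m²)`. Hence `1 - R` is invertible by a Neumann
  -- series, and `y = R z` with `z - R z = u` solves `H² y = u`.
  have hRn : ‖R‖ < 1 := by
    have : ‖R‖ ≤ 1 / (1 + m ^ 2) := by
      refine R.opNorm_le_bound (by positivity) fun h => ?_
      obtain ⟨b, hb1, hb2⟩ := (hass _ _).1 (hRm h)
      have h1 := hsq _ _ _ hb1 hb2
      rw [inner_sub_right, Complex.sub_re] at h1
      have h2 : (⟪R h, h⟫_ℂ).re ≤ ‖R h‖ * ‖h‖ := re_inner_le_norm (𝕜 := ℂ) _ _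
      have h3 : (⟪R h, R h⟫_ℂ).re = ‖R h‖ ^ 2 := inner_self_eq_norm_sq (𝕜 := ℂ) _
      rw [div_mul_eq_mul_div, one_mul, le_div_iff₀ (by positivity)]
      rcases (norm_nonneg (R h)).eq_or_lt with h0 | h0
      · rw [← h0, zero_mul]; positivity
      · refine le_of_mul_le_mul_left ?_ h0
        nlinarith
    refine this.trans_lt ?_
    rw [div_lt_one (by positivity)]
    nlinarith
  obtain ⟨z, hz⟩ : ∃ z, z - R z = u := by
    obtain ⟨S, hS⟩ := isUnit_one_sub_of_norm_lt_one hRn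
    refine ⟨(↑S⁻¹ : E →L[ℂ] E) u, ?_⟩
    have := congrArg (fun T : E →L[ℂ] E => T u) S.mul_inv
    rw [hS] at this
    exact this
  have hy := hRm z
  rw [hz] at hy
  -- Here `H y = x` and `H x = u`, so `y` and `x` stand for `H⁻² u` and `H⁻¹ u`.
  obtain ⟨x, hx1, hx2⟩ := (hass _ _).1 hy
  set y := R z with hydef
  have hny : m ^ 2 * ‖y‖ ≤ ‖u‖ := by
    have h1 := hsq _ _ _ hx1 hx2
    have h2 : (⟪y, u⟫_ℂ).re ≤ ‖y‖ * ‖u‖ := re_inner_le_norm (𝕜 := ℂ) _ _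
    rcases (norm_nonneg y).eq_or_lt with h0 | h0
    · rw [← h0, mul_zero]; positivity
    · refine le_of_mul_le_mul_left ?_ h0
      nlinarith
  have hnx : m * ‖x‖ ≤ ‖u‖ := by
    have h1 : ⟪x, x⟫_ℂ = ⟪y, u⟫_ℂ := hsym hx1 hx2
    have h2 : (⟪y, u⟫_ℂ).re ≤ ‖y‖ * ‖u‖ := re_inner_le_norm (𝕜 := ℂ) _ _
    have h3 : (⟪x, x⟫_ℂ).re = ‖x‖ ^ 2 := inner_self_eq_norm_sq (𝕜 := ℂ) _
    rw [h1] at h3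
    refine le_of_sq_le_sq ?_ (norm_nonneg _)
    have := mul_le_mul_of_nonneg_right hny (norm_nonneg u)
    nlinarith [sq_nonneg m]
  -- positivity of the form on `x - t u`
  have hq : ∀ t : ℝ, 0 ≤ (⟪x, u⟫_ℂ).re - 2 * t * ‖u‖ ^ 2 + t ^ 2 * (⟪u, w⟫_ℂ).re := by
    intro t
    have hmem : (x - (t : ℂ) • u, u - (t : ℂ) • w) ∈ H.graph :=
      H.graph.sub_mem hx2 (H.graph.smul_mem (t : ℂ) huw)
    have h1 := (hpos _ _ hmem).2
    have h2 : ⟪x, w⟫_ℂ = ⟪u, u⟫_ℂ := (hsym hx2 huw).symm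
    have h3 : ⟪u, u⟫_ℂ = ((‖u‖ ^ 2 : ℝ) : ℂ) := by
      rw [inner_self_eq_norm_sq_to_K]; norm_cast
    simp only [inner_sub_left, inner_sub_right, inner_smul_left, inner_smul_right,
      Complex.conj_ofReal, h2, h3, Complex.sub_re, Complex.re_ofReal_mul, Complex.ofReal_re] at h1
    nlinarith
  have hxu : m * (⟪x, u⟫_ℂ).re ≤ ‖u‖ ^ 2 := by
    have h2 : (⟪x, u⟫_ℂ).re ≤ ‖x‖ * ‖u‖ := re_inner_le_norm (𝕜 := ℂ) _ _
    have := mul_le_mul_of_nonneg_right hnx (norm_nonneg u)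
    nlinarith
  -- At `t = 1/m`, after multiplication by `m²`, the bound `m ⟪x, u⟫ ≤ ‖u‖²` turns positivity into
  -- `⟪u, w⟫ ≥ 2 m ‖u‖² - m ‖u‖²`.
  have h1 := hq (1 / m)
  have h2 : 0 ≤ m ^ 2 * ((⟪x, u⟫_ℂ).re - 2 * (1 / m) * ‖u‖ ^ 2 +
    (1 / m) ^ 2 * (⟪u, w⟫_ℂ).re) := by positivity
  have h3 : m ^ 2 * ((⟪x, u⟫_ℂ).re - 2 * (1 / m) * ‖u‖ ^ 2 + (1 / m) ^ 2 * (⟪u, w⟫_ℂ).re) =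
      m * (m * (⟪x, u⟫_ℂ).re) - 2 * m * ‖u‖ ^ 2 + (⟪u, w⟫_ℂ).re := by
    field_simp
  rw [h3] at h2
  nlinarith

end Abstract

/-! ### The Bessel function compared with its leading power. -/

section Bessel

/-- The substitution `s = exp t` produces the Gamma integral on the half-line. -/
theorem integrable_exp_mul_exp_neg_exp {a b : ℝ} (ha : 0 < a) (hb : 0 < b) :
    Integrable (fun t : ℝ => Real.exp (a * t) * Real.exp (-(b * Real.exp t))) := by
  have h := integrableOn_image_iff_integrableOn_abs_deriv_smul (s := Set.univ) MeasurableSet.univ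
    (fun x _ => (Real.hasDerivAt_exp x).hasDerivWithinAt) (Real.exp_injective.injOn)
    (fun s : ℝ => s ^ (a - 1) * Real.exp (-b * s ^ (1 : ℝ)))
  rw [Set.image_univ, Real.range_exp] at h
  have h1 := h.1 (integrableOn_rpow_mul_exp_neg_mul_rpow (by linarith) one_pos hb)
  rw [integrableOn_univ] at h1
  refine h1.congr (ae_of_all _ fun t => ?_)
  simp only [smul_eq_mul, Real.rpow_one, abs_of_pos (Real.exp_pos t)]
  rw [← Real.exp_mul, ← mul_assoc, ← Real.exp_add]
  ring_nf

theorem integral_exp_mul_exp_neg_exp {a b : ℝ} (ha : 0 < a) (hb : 0 < b) :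
    ∫ t : ℝ, Real.exp (a * t) * Real.exp (-(b * Real.exp t)) = (1 / b) ^ a * Real.Gamma a := by
  rw [← Real.integral_rpow_mul_exp_neg_mul_Ioi ha hb, ← Real.range_exp, ← Set.image_univ,
    integral_image_eq_integral_abs_deriv_smul (s := Set.univ) MeasurableSet.univ
    (fun x _ => (Real.hasDerivAt_exp x).hasDerivWithinAt) (Real.exp_injective.injOn),
    setIntegral_univ]
  refine integral_congr_ae (ae_of_all _ fun t => ?_)
  simp only [smul_eq_mul, abs_of_pos (Real.exp_pos t)]
  have : Real.exp (a * t) = Real.exp t * Real.exp t ^ (a - 1) := by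
    rw [← Real.exp_mul, ← Real.exp_add]; ring_nf
  rw [this, mul_assoc]

/-- Splitting `cosh` isolates the factor `exp (-(τ/2) exp (-t))`. For `τ > 0` it lies in `(0, 1)`;
dropping it leaves an exact Gamma integral, which is the leading term, and its distance from `1`
controls the error. -/
theorem exp_mul_exp_neg_cosh (ν τ t : ℝ) :
    Real.exp (ν * t) * Real.exp (-τ * Real.cosh t) =
      Real.exp (ν * t) * Real.exp (-(τ / 2 * Real.exp t)) *
        Real.exp (-(τ / 2 * Real.exp (-t))) := by
  simp only [← Real.exp_add]
  rw [Real.cosh_eq]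
  ring_nf

theorem integrable_exp_mul_exp_neg_cosh {ν τ : ℝ} (hν : 0 < ν) (hτ : 0 < τ) :
    Integrable (fun t : ℝ => Real.exp (ν * t) * Real.exp (-τ * Real.cosh t)) := by
  refine (integrable_exp_mul_exp_neg_exp hν (half_pos hτ)).mono'
    (by fun_prop) (ae_of_all _ fun t => ?_)
  rw [exp_mul_exp_neg_cosh, Real.norm_of_nonneg (by positivity)]
  refine mul_le_of_le_one_right (by positivity) (Real.exp_le_one_iff.2 ?_)
  have : 0 ≤ τ / 2 * Real.exp (-t) := by positivity
  linarith

theorem two_mul_besselK {ν τ : ℝ} (hν : 0 < ν) (hτ : 0 < τ) :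
    2 * besselK ν τ = ∫ t : ℝ, Real.exp (ν * t) * Real.exp (-τ * Real.cosh t) := by
  have h1 := integrable_exp_mul_exp_neg_cosh hν hτ
  have h2 : Integrable (fun t : ℝ => Real.exp (ν * -t) * Real.exp (-τ * Real.cosh t)) := by
    simpa using h1.comp_neg
  have h3 : ∫ t : ℝ, Real.exp (ν * -t) * Real.exp (-τ * Real.cosh t) =
      ∫ t : ℝ, Real.exp (ν * t) * Real.exp (-τ * Real.cosh t) := by
    rw [← integral_neg_eq_self (fun t : ℝ => Real.exp (ν * t) * Real.exp (-τ * Real.cosh t))]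
    simp
  rw [besselK, ← integral_comp_abs (f := fun t : ℝ => Real.exp (-τ * Real.cosh t) *
    Real.cosh (ν * t))]
  calc ∫ t : ℝ, Real.exp (-τ * Real.cosh |t|) * Real.cosh (ν * |t|)
      = ∫ t : ℝ, ((1 / 2) * (Real.exp (ν * t) * Real.exp (-τ * Real.cosh t)) +
          (1 / 2) * (Real.exp (ν * -t) * Real.exp (-τ * Real.cosh t))) := by
        refine integral_congr_ae (ae_of_all _ fun t => ?_)
        have e : Real.cosh (ν * |t|) = Real.cosh (ν * t) := by
          rw [← Real.cosh_abs (ν * t), abs_mul, abs_of_pos hν]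
        dsimp only
        rw [e, Real.cosh_abs, Real.cosh_eq (ν * t)]
        ring_nf
    _ = _ := by
        rw [integral_add (h1.const_mul _) (h2.const_mul _), integral_const_mul,
          integral_const_mul, h3]
        ring

theorem besselK_nonneg (ν τ : ℝ) : 0 ≤ besselK ν τ := by
  refine setIntegral_nonneg measurableSet_Ioi fun t _ => ?_
  have := Real.cosh_pos (ν * t)
  positivity

theorem measurable_besselK (ν : ℝ) : Measurable (besselK ν) := by
  have : StronglyMeasurable (fun p : ℝ × ℝ => Real.exp (-p.1 * Real.cosh p.2) *
      Real.cosh (ν * p.2)) := by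
    apply Continuous.stronglyMeasurable
    fun_prop
  exact (this.integral_prod_right' (ν := volume.restrict (Set.Ioi 0))).measurable

/-- The linear bound by `x` would lower the Gamma index from `ν` to `ν - 1`, which is not positive
for `ν = 1`, that is in dimension one. The square root lowers it only to `ν - 1/2`. -/
theorem one_sub_exp_neg_le_sqrt {x : ℝ} (hx : 0 ≤ x) : 1 - Real.exp (-x) ≤ √x := by
  rcases le_total x 1 with h | h
  · have h1 := Real.add_one_le_exp (-x)
    have h2 : x ≤ √x := by
      rw [Real.le_sqrt hx hx]
      nlinarith
    linarith
  · have h1 := Real.exp_pos (-x)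
    have h2 : 1 ≤ √x := Real.one_le_sqrt.2 h
    linarith

theorem two_mul_besselK_le {ν τ : ℝ} (hν : 0 < ν) (hτ : 0 < τ) :
    2 * besselK ν τ ≤ (2 / τ) ^ ν * Real.Gamma ν := by
  rw [two_mul_besselK hν hτ, ← one_div_div τ 2, ← integral_exp_mul_exp_neg_exp hν (half_pos hτ)]
  refine integral_mono (integrable_exp_mul_exp_neg_cosh hν hτ)
    (integrable_exp_mul_exp_neg_exp hν (half_pos hτ)) fun t => ?_
  dsimp only
  rw [exp_mul_exp_neg_cosh]
  refine mul_le_of_le_one_right (by positivity) (Real.exp_le_one_iff.2 ?_)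
  have : 0 ≤ τ / 2 * Real.exp (-t) := by positivity
  linarith

/-- The error is one power of `τ` less singular than the main term: half a power comes from
`√(τ/2)`, half from the lowered Gamma index. -/
theorem sub_two_mul_besselK_le {ν τ : ℝ} (hν : 1 ≤ ν) (hτ : 0 < τ) :
    (2 / τ) ^ ν * Real.Gamma ν - 2 * besselK ν τ ≤
      (2 / τ) ^ (ν - 1) * Real.Gamma (ν - 1 / 2) := by
  have hν0 : 0 < ν := by linarith
  have hν1 : 0 < ν - 1 / 2 := by linarith
  have i1 := integrable_exp_mul_exp_neg_exp hν0 (half_pos hτ)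
  have i2 := integrable_exp_mul_exp_neg_cosh hν0 hτ
  have i3 := integrable_exp_mul_exp_neg_exp hν1 (half_pos hτ)
  have e1 : (2 / τ) ^ (ν - 1) * Real.Gamma (ν - 1 / 2) =
      √(τ / 2) * ((1 / (τ / 2)) ^ (ν - 1 / 2) * Real.Gamma (ν - 1 / 2)) := by
    have h0 : 0 < 2 / τ := by positivity
    rw [one_div_div, ← mul_assoc, Real.sqrt_eq_rpow]
    have h2 : (τ / 2 : ℝ) ^ (1 / 2 : ℝ) = (2 / τ) ^ (-(1 / 2) : ℝ) := by
      rw [Real.rpow_neg h0.le, ← Real.inv_rpow h0.le, inv_div]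
    rw [h2, ← Real.rpow_add h0]
    ring_nf
  rw [two_mul_besselK hν0 hτ, e1, ← one_div_div τ 2,
    ← integral_exp_mul_exp_neg_exp hν0 (half_pos hτ),
    ← integral_exp_mul_exp_neg_exp hν1 (half_pos hτ), ← integral_sub i1 i2,
    ← integral_const_mul]
  refine integral_mono (i1.sub i2) (i3.const_mul _) fun t => ?_
  dsimp only
  rw [exp_mul_exp_neg_cosh]
  have h1 := one_sub_exp_neg_le_sqrt (show 0 ≤ τ / 2 * Real.exp (-t) by positivity)
  have h2 : √(τ / 2 * Real.exp (-t)) = √(τ / 2) * Real.exp (-(1 / 2) * t) := by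
    rw [Real.sqrt_mul (by positivity), ← Real.exp_half]
    ring_nf
  rw [h2] at h1
  have h3 : Real.exp (ν * t) * Real.exp (-(1 / 2) * t) = Real.exp ((ν - 1 / 2) * t) := by
    rw [← Real.exp_add]; ring_nf
  calc _ = (1 - Real.exp (-(τ / 2 * Real.exp (-t)))) *
        (Real.exp (ν * t) * Real.exp (-(τ / 2 * Real.exp t))) := by ring
    _ ≤ (√(τ / 2) * Real.exp (-(1 / 2) * t)) *
        (Real.exp (ν * t) * Real.exp (-(τ / 2 * Real.exp t))) := by gcongr
    _ = _ := by rw [← h3]; ring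

end Bessel

/-! ### The Lévy density and its singularity at the origin. -/

section Levy

theorem measurable_levyDensity (d : ℕ) (m : ℝ) : Measurable (levyDensity d m) := by
  unfold levyDensity
  split_ifs
  · fun_prop
  · have := (measurable_besselK (((d : ℝ) + 1) / 2)).comp
      (measurable_norm.const_mul m : Measurable fun y : Space d => m * ‖y‖)
    simp only [Function.comp_def] at this
    fun_prop

theorem levyDensity_nonneg {d : ℕ} {m : ℝ} (hm : 0 ≤ m) (y : Space d) :
    0 ≤ levyDensity d m y := by
  unfold levyDensity
  split_ifs
  · have : 0 < Real.Gamma (((d : ℝ) + 1) / 2) := Real.Gamma_pos_of_pos (by positivity)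
    positivity
  · have := besselK_nonneg (((d : ℝ) + 1) / 2) (m * ‖y‖)
    positivity

theorem levyDensity_neg {d : ℕ} (m : ℝ) (y : Space d) :
    levyDensity d m (-y) = levyDensity d m y := by
  simp only [levyDensity, norm_neg]

/-- Near the origin the Lévy density behaves like a multiple of `|y|^{-d-1}`. -/
theorem exists_levyDensity_bounds {d : ℕ} (hd : 1 ≤ d) {m : ℝ} (hm : 0 ≤ m) :
    ∃ c C : ℝ, 0 ≤ C ∧ (∀ y : Space d, levyDensity d m y ≤ C / ‖y‖ ^ (d + 1)) ∧
      ∀ y : Space d, |levyDensity d m y - c / ‖y‖ ^ (d + 1)| ≤ C / ‖y‖ ^ d := by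
  rcases hm.eq_or_lt with rfl | hm
  · have : 0 < Real.Gamma (((d : ℝ) + 1) / 2) := Real.Gamma_pos_of_pos (by positivity)
    refine ⟨Real.Gamma (((d : ℝ) + 1) / 2) / Real.pi ^ (((d : ℝ) + 1) / 2),
      Real.Gamma (((d : ℝ) + 1) / 2) / Real.pi ^ (((d : ℝ) + 1) / 2), by positivity,
      fun y => ?_, fun y => ?_⟩
    · rw [levyDensity, if_pos rfl]
    · rw [levyDensity, if_pos rfl, sub_self, abs_zero]
      positivity
  · set ν : ℝ := ((d : ℝ) + 1) / 2 with hνdef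
    have hd' : (1 : ℝ) ≤ d := by exact_mod_cast hd
    have hν : 1 ≤ ν := by rw [hνdef]; linarith
    have hν0 : 0 < ν := by linarith
    set a : ℝ := 2 * (m / (2 * Real.pi)) ^ ν with ha
    have ha0 : 0 < a := by positivity
    have hΓ := Real.Gamma_pos_of_pos hν0
    have hΓ' := Real.Gamma_pos_of_pos (show 0 < ν - 1 / 2 by linarith)
    -- The constants come from the bounds on `2 K_ν(m|y|)`. With the extra factor `|y|^{-ν}` and `2ν
    -- = d + 1`, the main term becomes `c |y|^{-d-1}` and the error `C |y|^{-d}`.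
    set c : ℝ := a * ((2 / m) ^ ν * Real.Gamma ν) / 2 with hc
    set C : ℝ := a * ((2 / m) ^ (ν - 1) * Real.Gamma (ν - 1 / 2)) / 2 with hC
    have hc0 : 0 < c := by positivity
    have hC0 : 0 < C := by positivity
    have hn : ∀ y : Space d, levyDensity d m y = a * (besselK ν (m * ‖y‖) / ‖y‖ ^ ν) := by
      intro y
      rw [levyDensity, if_neg hm.ne']
    have e1 : ∀ y : Space d, 0 < ‖y‖ → c / ‖y‖ ^ (d + 1) =
        a * (((2 / (m * ‖y‖)) ^ ν * Real.Gamma ν) / 2 / ‖y‖ ^ ν) := by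
      intro y hy
      have h1 : ‖y‖ ^ (d + 1) = ‖y‖ ^ ν * ‖y‖ ^ ν := by
        rw [← Real.rpow_add hy, ← Real.rpow_natCast]
        congr 1
        push_cast
        rw [hνdef]; ring
      have h2 : (2 / (m * ‖y‖)) ^ ν = (2 / m) ^ ν / ‖y‖ ^ ν := by
        rw [← div_div, Real.div_rpow (by positivity) hy.le]
      rw [h1, h2, hc]
      field_simp
    have e2 : ∀ y : Space d, 0 < ‖y‖ → C / ‖y‖ ^ d =
        a * (((2 / (m * ‖y‖)) ^ (ν - 1) * Real.Gamma (ν - 1 / 2)) / 2 / ‖y‖ ^ ν) := by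
      intro y hy
      have h1 : ‖y‖ ^ d = ‖y‖ ^ ν * ‖y‖ ^ (ν - 1) := by
        rw [← Real.rpow_add hy, ← Real.rpow_natCast]
        congr 1
        rw [hνdef]; ring
      have h2 : (2 / (m * ‖y‖)) ^ (ν - 1) = (2 / m) ^ (ν - 1) / ‖y‖ ^ (ν - 1) := by
        rw [← div_div, Real.div_rpow (by positivity) hy.le]
      rw [h1, h2, hC]
      field_simp
    have hle : ∀ y : Space d, levyDensity d m y ≤ c / ‖y‖ ^ (d + 1) := by
      intro y
      rcases (norm_nonneg y).eq_or_lt with h0 | h0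
      · rw [hn, ← h0, Real.zero_rpow hν0.ne', zero_pow (by omega)]
        simp
      · rw [hn, e1 y h0]
        have := two_mul_besselK_le hν0 (mul_pos hm h0)
        gcongr
        linarith
    refine ⟨c, max c C, by positivity, fun y => (hle y).trans ?_, fun y => ?_⟩
    · gcongr
      exact le_max_left _ _
    · rcases (norm_nonneg y).eq_or_lt with h0 | h0
      · rw [hn, ← h0, Real.zero_rpow hν0.ne', zero_pow (by omega), zero_pow (by omega)]
        simp
      · rw [abs_sub_comm, abs_of_nonneg (sub_nonneg.2 (hle y))]
        refine le_trans ?_ (show C / ‖y‖ ^ d ≤ _ by gcongr; exact le_max_right _ _)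
        rw [hn, e1 y h0, e2 y h0, ← mul_sub, ← sub_div]
        have := sub_two_mul_besselK_le hν (mul_pos hm h0)
        gcongr
        linarith

end Levy

/-! ### Averages of the potential over segments; independence of the representative. -/

section Potentials

variable {d : ℕ}

/-- A probability measure on `[0, 1]` that is symmetric under `θ ↦ 1 - θ`. -/
structure IsSegmentWeight (μ : Measure ℝ) : Prop where
  prob : IsProbabilityMeasure μ
  mem_Icc : ∀ᵐ θ ∂μ, θ ∈ Set.Icc (0 : ℝ) 1
  symm : MeasurePreserving (fun θ : ℝ => 1 - θ) μ μ

theorem isSegmentWeight_dirac : IsSegmentWeight (Measure.dirac (1 / 2 : ℝ)) where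
  prob := inferInstance
  mem_Icc := by
    rw [ae_dirac_eq]
    simp only [eventually_pure, Set.mem_Icc]
    norm_num
  symm := by
    refine ⟨by fun_prop, ?_⟩
    rw [Measure.map_dirac' (by fun_prop)]
    norm_num

theorem isSegmentWeight_volume : IsSegmentWeight (volume.restrict (Set.Icc (0 : ℝ) 1)) where
  prob := ⟨by simp⟩
  mem_Icc := ae_restrict_mem measurableSet_Icc
  symm := by
    have h := (Measure.measurePreserving_sub_left (volume : Measure ℝ) 1).restrict_preimage
      (measurableSet_Icc (a := (0 : ℝ)) (b := 1))
    have e : (fun θ : ℝ => 1 - θ) ⁻¹' Set.Icc 0 1 = Set.Icc 0 1 := by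
      ext θ
      simp
    rwa [e] at h

/-- The average of `A` over the segment from `x` to `y` with respect to a weight. -/
def weightedPotential (μ : Measure ℝ) (A : Space d → Space d) (x y : Space d) : Space d :=
  ∫ θ, A ((1 - θ) • x + θ • y) ∂μ

theorem midPotential_eq (A : Space d → Space d) :
    midPotential A = weightedPotential (Measure.dirac (1 / 2)) A := by
  ext x y : 2
  rw [midPotential, weightedPotential, integral_dirac, smul_add]
  norm_num

theorem avgPotential_eq (A : Space d → Space d) :
    avgPotential A = weightedPotential (volume.restrict (Set.Icc (0 : ℝ) 1)) A := by
  ext x y : 2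
  rw [avgPotential, weightedPotential, intervalIntegral.integral_of_le zero_le_one,
    integral_Icc_eq_integral_Ioc]

/-- Symmetry of the weight is what makes the truncated integral operators Hermitian. -/
theorem weightedPotential_symm {μ : Measure ℝ} (hμ : IsSegmentWeight μ) (A : Space d → Space d)
    (x y : Space d) : weightedPotential μ A x y = weightedPotential μ A y x := by
  have he : MeasurableEmbedding (fun θ : ℝ => 1 - θ) :=
    (Homeomorph.subLeft (1 : ℝ)).measurableEmbedding
  have := hμ.symm.integral_comp he (fun θ => A ((1 - θ) • x + θ • y))
  rw [weightedPotential, weightedPotential, ← this]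
  simp only [sub_sub_cancel, add_comm]

theorem weightedPotential_add (μ : Measure ℝ) (A : Space d → Space d) (x y : Space d) :
    weightedPotential μ A x (x + y) = ∫ θ, A (x + θ • y) ∂μ := by
  unfold weightedPotential
  congr 1
  ext1 θ
  congr 1
  module

/-- For each fixed `w` the map is a translation, so by Fubini preimages of null sets are null. -/
theorem quasiMeasurePreserving_add_comp {W : Type*} [MeasurableSpace W] (ν : Measure W) [SFinite ν]
    {g : W → Space d} (hg : Measurable g) :
    Measure.QuasiMeasurePreserving (fun q : Space d × W => q.1 + g q.2)
      ((volume : Measure (Space d)).prod ν) volume := by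
  have h1 : MeasurePreserving (fun q : W × Space d => (q.1, q.2 + g q.1))
      (ν.prod volume) (ν.prod volume) := by
    refine (MeasurePreserving.id ν).skew_product (g := fun w z => z + g w) (by fun_prop) ?_
    exact ae_of_all _ fun w => (measurePreserving_add_right volume (g w)).map_eq
  have h2 : MeasurePreserving (Prod.swap : Space d × W → W × Space d)
      (volume.prod ν) (ν.prod volume) := Measure.measurePreserving_swap
  exact (Measure.quasiMeasurePreserving_snd.comp h1.quasiMeasurePreserving).comp
    h2.quasiMeasurePreserving

theorem measurePreserving_sub_prod' :
    MeasurePreserving (fun p : Space d × Space d => (p.1, p.2 - p.1))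
      (volume.prod volume) (volume.prod volume) := by
  refine (MeasurePreserving.id volume).skew_product (g := fun x y => y - x) (by fun_prop) ?_
  exact ae_of_all _ fun x => (measurePreserving_sub_right volume x).map_eq

/-- For almost every pair of endpoints, a Lebesgue null set is met by the segment only in a `μ`-null
set of parameters. This permits replacing `A` by a measurable representative. -/
theorem weightedPotential_congr {μ : Measure ℝ} (hμ : IsSegmentWeight μ)
    {A A' : Space d → Space d} (h : A =ᵐ[volume] A') :
    ∀ᵐ p : Space d × Space d,
      weightedPotential μ A p.1 p.2 = weightedPotential μ A' p.1 p.2 := by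
  have := hμ.prob
  have h1 := (quasiMeasurePreserving_add_comp ((volume : Measure (Space d)).prod μ)
    (g := fun w => w.2 • w.1) (by fun_prop)).ae h
  have h2 := (measurePreserving_prodAssoc (volume : Measure (Space d))
    (volume : Measure (Space d)) μ).quasiMeasurePreserving.ae h1
  have h3 := measurePreserving_sub_prod'.quasiMeasurePreserving.ae
    (Measure.ae_ae_of_ae_prod h2)
  filter_upwards [h3] with p hp
  refine integral_congr_ae ?_
  filter_upwards [hp] with θ hθ
  have e : (1 - θ) • p.1 + θ • p.2 = p.1 + θ • (p.2 - p.1) := by module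
  rw [e]
  exact hθ

theorem measurable_weightedPotential {μ : Measure ℝ} (hμ : IsSegmentWeight μ)
    {A : Space d → Space d} (hA : Measurable A) :
    Measurable (fun p : Space d × Space d => weightedPotential μ A p.1 p.2) := by
  have := hμ.prob
  have h : StronglyMeasurable (fun q : (Space d × Space d) × ℝ =>
      A ((1 - q.2) • q.1.1 + q.2 • q.1.2)) :=
    (hA.comp (by fun_prop)).stronglyMeasurable
  exact h.integral_prod_right'.measurable

theorem ae_ae_add_of_ae {p : Space d × Space d → Prop} (h : ∀ᵐ q, p q) :
    ∀ᵐ x, ∀ᵐ y, p (x, x + y) := by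
  have h1 := (measurePreserving_prod_add (volume : Measure (Space d))
    (volume : Measure (Space d))).quasiMeasurePreserving.ae h
  exact Measure.ae_ae_of_ae_prod h1

theorem formOperator_congr {P P' : Space d → Space d → Space d} (m : ℝ)
    (h : ∀ᵐ p : Space d × Space d, P p.1 p.2 = P' p.1 p.2) :
    formOperator P m = formOperator P' m := by
  have h0 : ∀ u : L2 d, magneticDifference P u =ᵐ[volume] magneticDifference P' u := by
    intro u
    filter_upwards [h] with p hp
    rw [magneticDifference, magneticDifference, hp]
  have h1 : formDomain P m = formDomain P' m := by
    ext u
    simp only [formDomain, Set.mem_ofPred_eq]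
    rw [lintegral_congr_ae]
    filter_upwards [h0 u] with p hp
    rw [hp]
  have h2 : ∀ u v, form P m u v = form P' m u v := by
    intro u v
    unfold form
    congr 2
    refine integral_congr_ae ?_
    filter_upwards [h0 u, h0 v] with p hp hq
    rw [hp, hq]
  simp only [formOperator, h1, h2]

theorem integralOperator_congr {P P' : Space d → Space d → Space d} (m : ℝ)
    (h : ∀ᵐ p : Space d × Space d, P p.1 p.2 = P' p.1 p.2) :
    integralOperator P m = integralOperator P' m := by
  have h1 : ∀ (r : ℝ) (f : Space d → ℂ),
      truncatedIntegral P m r f =ᵐ[volume] truncatedIntegral P' m r f := by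
    intro r f
    filter_upwards [ae_ae_add_of_ae h] with x hx
    refine integral_congr_ae (ae_restrict_of_ae ?_)
    filter_upwards [hx] with y hy
    rw [hy]
  ext q
  simp only [integralOperator, Set.mem_ofPred_eq]
  refine exists_congr fun f => and_congr Iff.rfl (and_congr Iff.rfl ?_)
  have : ∀ r : ℝ, eLpNorm
        (fun x => -truncatedIntegral P m r f x - (q.2 x - (m : ℂ) * f x)) 2 volume =
      eLpNorm (fun x => -truncatedIntegral P' m r f x - (q.2 x - (m : ℂ) * f x)) 2 volume := by
    intro r
    refine eLpNorm_congr_ae ?_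
    filter_upwards [h1 r f] with x hx
    rw [hx]
  simp only [this]

theorem LocLp.aestronglyMeasurable {A : Space d → Space d} {p : ℝ} (h : LocLp A p) :
    AEStronglyMeasurable A volume := by
  have h1 : ∀ n : ℕ, AEStronglyMeasurable A (volume.restrict (Metric.closedBall 0 (n : ℝ))) :=
    fun n => (h _ (isCompact_closedBall _ _)).aestronglyMeasurable
  have h2 := (aestronglyMeasurable_iUnion_iff (f := A)).2 h1
  rwa [Metric.iUnion_closedBall_nat, Measure.restrict_univ] at h2

theorem LocLp.congr {A A' : Space d → Space d} {p : ℝ} (h : LocLp A p) (h' : A =ᵐ[volume] A') :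
    LocLp A' p :=
  fun K hK => (h K hK).ae_eq (ae_restrict_of_ae h')

theorem LocLp.mono {A : Space d → Space d} {p q : ℝ} (h : LocLp A p) (hq : q ≤ p) :
    LocLp A q := by
  intro K hK
  have : IsFiniteMeasure (volume.restrict K) := ⟨by simpa using hK.measure_lt_top⟩
  exact (h K hK).mono_exponent (ENNReal.ofReal_le_ofReal hq)

/-- A locally `L^p` potential is almost everywhere equal to a measurable one. -/
theorem LocLp.exists_measurable {A : Space d → Space d} {p : ℝ} (h : LocLp A p) :
    ∃ A' : Space d → Space d, Measurable A' ∧ A =ᵐ[volume] A' ∧ LocLp A' p := by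
  have h1 := h.aestronglyMeasurable
  exact ⟨h1.mk A, h1.stronglyMeasurable_mk.measurable, h1.ae_eq_mk, h.congr h1.ae_eq_mk⟩

theorem LocLp.lintegral_lt_top {A : Space d → Space d} {p : ℝ} (hp : 0 < p) (h : LocLp A p)
    (R : ℝ) : ∫⁻ z in Metric.closedBall (0 : Space d) R, ‖A z‖ₑ ^ p < ⊤ := by
  have h1 := (h _ (isCompact_closedBall 0 R)).eLpNorm_lt_top
  have h2 := lintegral_rpow_enorm_lt_top_of_eLpNorm_lt_top
    (by simpa using hp) ENNReal.ofReal_ne_top h1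
  rwa [ENNReal.toReal_ofReal hp.le] at h2

/-- Integrals over segments of length at most one. -/
theorem lintegral_segment_le {μ : Measure ℝ} (hμ : IsSegmentWeight μ)
    {g : Space d → ENNReal} (hg : Measurable g) (R : ℝ) {y : Space d} (hy : ‖y‖ ≤ 1) :
    ∫⁻ x in Metric.closedBall 0 R, ∫⁻ θ, g (x + θ • y) ∂μ ≤
      ∫⁻ z in Metric.closedBall 0 (R + 1), g z := by
  have := hμ.prob
  rw [lintegral_lintegral_swap (by fun_prop)]
  calc ∫⁻ θ, ∫⁻ x in Metric.closedBall 0 R, g (x + θ • y) ∂volume ∂μ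
      ≤ ∫⁻ θ, ∫⁻ z in Metric.closedBall 0 (R + 1), g z ∂volume ∂μ := by
        refine lintegral_mono_ae ?_
        filter_upwards [hμ.mem_Icc] with θ hθ
        rw [← lintegral_indicator measurableSet_closedBall,
          ← lintegral_indicator measurableSet_closedBall,
          ← lintegral_add_right_eq_self ((Metric.closedBall 0 (R + 1)).indicator g) (θ • y)]
        refine lintegral_mono fun x => ?_
        by_cases hx : x ∈ Metric.closedBall (0 : Space d) R
        · rw [Set.indicator_of_mem hx, Set.indicator_of_mem]
          rw [mem_closedBall_zero_iff] at hx ⊢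
          refine (norm_add_le _ _).trans (add_le_add hx ?_)
          rw [norm_smul, Real.norm_of_nonneg hθ.1]
          exact mul_le_one₀ hθ.2 (norm_nonneg _) hy
        · rw [Set.indicator_of_notMem hx]
          exact zero_le
    _ = _ := by simp

/-- Jensen's inequality, read off from the monotonicity of `L^p` norms on a probability space. A
nonintegrable `F` has integral zero by convention, so the estimate covers it too. -/
theorem enorm_integral_rpow_le {μ : Measure ℝ} [IsProbabilityMeasure μ] {F : ℝ → Space d}
    (hF : Measurable F) {p : ℝ} (hp : 1 ≤ p) :
    ‖∫ θ, F θ ∂μ‖ₑ ^ p ≤ ∫⁻ θ, ‖F θ‖ₑ ^ p ∂μ := by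
  have h1 : eLpNorm F 1 μ ≤ eLpNorm F (ENNReal.ofReal p) μ :=
    eLpNorm_le_eLpNorm_of_exponent_le (by simpa using hp)
      hF.stronglyMeasurable.aestronglyMeasurable
  have h2 : ‖∫ θ, F θ ∂μ‖ₑ ≤ eLpNorm F 1 μ := by
    rw [eLpNorm_one_eq_lintegral_enorm]
    exact enorm_integral_le_lintegral_enorm _
  have hp0 : 0 < p := by linarith
  have h3 := ENNReal.rpow_le_rpow (h2.trans h1) hp0.le
  rwa [eLpNorm_eq_lintegral_rpow_enorm_toReal (by simpa using hp0) ENNReal.ofReal_ne_top,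
    ENNReal.toReal_ofReal hp0.le, ← ENNReal.rpow_mul, one_div,
    inv_mul_cancel₀ hp0.ne', ENNReal.rpow_one] at h3

end Potentials

/-! ### Integrability of powers, bounds on phases, and test functions. -/

section Integrability

variable {d : ℕ}

/-- In polar coordinates the radial integrand is `ρ^{s-1}`. -/
theorem integrableOn_norm_rpow_ball (hd : 1 ≤ d) {s : ℝ} (hs : 0 < s) :
    IntegrableOn (fun z : Space d => ‖z‖ ^ (s - d)) (Metric.ball 0 1) := by
  have : Nontrivial (Space d) := by
    have : Nonempty (Fin d) := ⟨⟨0, hd⟩⟩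
    infer_instance
  rw [integrableOn_fun_norm_addHaar volume (f := fun r : ℝ => r ^ (s - d))]
  have h1 : IntegrableOn (fun r : ℝ => r ^ (s - 1)) (Set.Ioo 0 1) := by
    rw [← intervalIntegrable_iff_integrableOn_Ioo_of_le zero_le_one]
    exact intervalIntegral.intervalIntegrable_rpow' (by linarith)
  refine h1.congr_fun (fun r hr => ?_) measurableSet_Ioo
  simp only [smul_eq_mul, finrank_euclideanSpace, Fintype.card_fin]
  rw [← Real.rpow_natCast, ← Real.rpow_add hr.1]
  congr 1
  rw [Nat.cast_sub hd]
  push_cast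
  ring

theorem integrableOn_inv_norm_pow {r : ℝ} (hr : 0 < r) :
    IntegrableOn (fun z : Space d => 1 / ‖z‖ ^ (d + 1)) {z | r ≤ ‖z‖} := by
  have hm : MeasurableSet {z : Space d | r ≤ ‖z‖} := measurableSet_le measurable_const measurable_norm
  have h1 : Integrable (fun z : Space d => (1 + ‖z‖) ^ (-((d : ℝ) + 1))) := by
    apply integrable_one_add_norm
    simp
  refine Integrable.mono' (h1.const_mul ((1 / r + 1) ^ (d + 1))).integrableOn
    (Measurable.aestronglyMeasurable (by fun_prop)) ?_
  refine (ae_restrict_iff' hm).2 (ae_of_all _ fun z hz => ?_)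
  have hz' : r ≤ ‖z‖ := hz
  have hz0 : 0 < ‖z‖ := hr.trans_le hz'
  rw [Real.norm_of_nonneg (by positivity), Real.rpow_neg (by positivity), ← div_eq_mul_inv]
  have e : (1 + ‖z‖) ^ ((d : ℝ) + 1) = (1 + ‖z‖) ^ (d + 1) := by
    rw [← Real.rpow_natCast]; push_cast; rfl
  rw [e, div_le_div_iff₀ (by positivity) (by positivity), one_mul, ← mul_pow]
  gcongr
  have : 1 ≤ 1 / r * ‖z‖ := by rw [div_mul_eq_mul_div, one_mul, le_div_iff₀ hr, one_mul]; exact hz'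
  linarith

theorem integrableOn_levyDensity (hd : 1 ≤ d) {m : ℝ} (hm : 0 ≤ m) {r : ℝ} (hr : 0 < r) :
    IntegrableOn (levyDensity d m) {z | r ≤ ‖z‖} := by
  obtain ⟨c, C, hC, h1, -⟩ := exists_levyDensity_bounds hd hm
  refine Integrable.mono' ((integrableOn_inv_norm_pow hr).const_mul C)
    (measurable_levyDensity d m).aestronglyMeasurable (ae_of_all _ fun z => ?_)
  rw [Real.norm_of_nonneg (levyDensity_nonneg hm z), mul_one_div]
  exact h1 z

theorem norm_exp_neg_I_mul (t : ℝ) : ‖Complex.exp (-Complex.I * (t : ℂ))‖ = 1 := by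
  rw [show -Complex.I * (t : ℂ) = ((-t : ℝ) : ℂ) * Complex.I by push_cast; ring]
  exact Complex.norm_exp_ofReal_mul_I _

theorem norm_exp_sub_one_le (t : ℝ) : ‖Complex.exp (-Complex.I * (t : ℂ)) - 1‖ ≤ |t| := by
  have h := Real.norm_exp_I_mul_ofReal_sub_one_le (x := -t)
  rw [show -Complex.I * (t : ℂ) = Complex.I * ((-t : ℝ) : ℂ) by push_cast; ring]
  simpa using h

/-- Interpolation between the bounds `|t|` and `2`. The exponent `1 + δ` asks no more of `A` than
`L^{1+δ}`, yet makes `|y|^{1+δ} |y|^{-d-1}` integrable at the origin. -/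
theorem norm_exp_sub_one_sq_le (t : ℝ) {δ : ℝ} (hδ : 0 < δ) (hδ1 : δ ≤ 1) :
    ‖Complex.exp (-Complex.I * (t : ℂ)) - 1‖ ^ 2 ≤ 4 * |t| ^ (1 + δ) := by
  have h1 := norm_exp_sub_one_le t
  rcases le_total |t| 1 with h | h
  · have h2 : |t| ^ (2 : ℝ) ≤ |t| ^ (1 + δ) :=
      Real.rpow_le_rpow_of_exponent_ge' (abs_nonneg t) h (by linarith) (by linarith)
    rw [Real.rpow_two] at h2
    have h3 : ‖Complex.exp (-Complex.I * (t : ℂ)) - 1‖ ^ 2 ≤ |t| ^ 2 := by gcongr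
    nlinarith [sq_nonneg t, sq_abs t]
  · have h2 : ‖Complex.exp (-Complex.I * (t : ℂ)) - 1‖ ≤ 2 := by
      refine (norm_sub_le _ _).trans ?_
      rw [norm_exp_neg_I_mul, norm_one]; norm_num
    have h3 : 1 ≤ |t| ^ (1 + δ) := Real.one_le_rpow h (by linarith)
    have h4 : ‖Complex.exp (-Complex.I * (t : ℂ)) - 1‖ ^ 2 ≤ 2 ^ 2 := by gcongr
    linarith

/-- A test function is bounded, Lipschitz and vanishes off a ball. -/
theorem IsTest.exists_bounds {f : Space d → ℂ} (hf : IsTest f) :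
    ∃ M L R : ℝ, 0 ≤ M ∧ 0 ≤ L ∧ 0 ≤ R ∧ (∀ x, ‖f x‖ ≤ M) ∧
      (∀ x y, ‖f x - f y‖ ≤ L * ‖x - y‖) ∧ ∀ x, R < ‖x‖ → f x = 0 := by
  obtain ⟨M, hM⟩ := hf.1.continuous.bounded_above_of_compact_support hf.2
  obtain ⟨L, hL⟩ := hf.1.lipschitzWith_of_hasCompactSupport hf.2 (by simp)
  obtain ⟨R, hR⟩ := hf.2.isCompact.isBounded.subset_closedBall (0 : Space d)
  refine ⟨max M 0, L, max R 0, le_max_right _ _, L.2, le_max_right _ _,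
    fun x => (hM x).trans (le_max_left _ _), fun x y => hL.norm_sub_le x y, fun x hx => ?_⟩
  by_contra h0
  have := hR (subset_tsupport f (Function.mem_support.2 h0))
  rw [mem_closedBall_zero_iff] at this
  exact absurd (this.trans (le_max_left R 0)) (not_le.2 hx)

theorem IsTest.memLp {f : Space d → ℂ} (hf : IsTest f) (p : ENNReal) : MemLp f p volume :=
  hf.1.continuous.memLp_of_hasCompactSupport hf.2

/-- The classes of test functions are dense in `L²`. -/
theorem dense_tests : Dense {u : L2 d | ∃ f : Space d → ℂ, IsTest f ∧ u =ᵐ[volume] f} := by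
  have h := Lp.dense_hasCompactSupport_contDiff (F := ℂ) (E := Space d)
    (μ := (volume : Measure (Space d))) (p := 2) (by simp)
  refine h.mono ?_
  rintro u ⟨g, h1, h2, h3⟩
  exact ⟨g, ⟨h3, h2⟩, h1⟩

end Integrability

/-! ### The quadratic form as the square of a closed difference map. -/

section FormOperator

variable {d : ℕ}

/-- The Hilbert space `L²(ℝ^d × ℝ^d; ℂ)`. -/
abbrev L2Prod (d : ℕ) : Type := Lp ℂ 2 (volume : Measure (Space d × Space d))

theorem ae_fst {p : Space d → Prop} (h : ∀ᵐ x, p x) :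
    ∀ᵐ q : Space d × Space d, p q.1 :=
  Measure.quasiMeasurePreserving_fst.ae h

theorem ae_snd {p : Space d → Prop} (h : ∀ᵐ x, p x) :
    ∀ᵐ q : Space d × Space d, p q.2 :=
  Measure.quasiMeasurePreserving_snd.ae h

/-- The density of the form: `√(n(x - y) / 2)` times the magnetic difference. -/
def weightedDifference (P : Space d → Space d → Space d) (m : ℝ) (u : L2 d)
    (p : Space d × Space d) : ℂ :=
  magneticDifference P u p * ((√(levyDensity d m (p.1 - p.2) / 2) : ℝ) : ℂ)

theorem aestronglyMeasurable_magneticDifference {P : Space d → Space d → Space d}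
    (hP : Measurable fun p : Space d × Space d => P p.1 p.2) (u : L2 d) :
    AEStronglyMeasurable (magneticDifference P u) volume := by
  have hu := (Lp.stronglyMeasurable u).measurable
  refine Measurable.aestronglyMeasurable ?_
  unfold magneticDifference
  have h1 : Measurable fun p : Space d × Space d => ⟪p.1 - p.2, P p.1 p.2⟫_ℝ :=
    Measurable.inner (by fun_prop) hP
  have h2 : Measurable fun p : Space d × Space d => ((⟪p.1 - p.2, P p.1 p.2⟫_ℝ : ℝ) : ℂ) :=
    Complex.measurable_ofReal.comp h1
  fun_prop

theorem aestronglyMeasurable_weightedDifference {P : Space d → Space d → Space d}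
    (hP : Measurable fun p : Space d × Space d => P p.1 p.2) (m : ℝ) (u : L2 d) :
    AEStronglyMeasurable (weightedDifference P m u) volume := by
  refine (aestronglyMeasurable_magneticDifference hP u).mul ?_
  refine Measurable.aestronglyMeasurable ?_
  have := measurable_levyDensity d m
  fun_prop

theorem norm_weightedDifference_sq {m : ℝ} (hm : 0 ≤ m) (P : Space d → Space d → Space d)
    (u : L2 d) (p : Space d × Space d) :
    ‖weightedDifference P m u p‖ ^ 2 =
      (‖magneticDifference P u p‖ ^ 2 * levyDensity d m (p.1 - p.2)) / 2 := by
  have h := levyDensity_nonneg (d := d) hm (p.1 - p.2)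
  rw [weightedDifference, norm_mul, mul_pow, Complex.norm_real, Real.norm_eq_abs, sq_abs,
    Real.sq_sqrt (by positivity)]
  ring

theorem mem_formDomain_iff {m : ℝ} (hm : 0 ≤ m) {P : Space d → Space d → Space d}
    (hP : Measurable fun p : Space d × Space d => P p.1 p.2) (u : L2 d) :
    u ∈ formDomain P m ↔ MemLp (weightedDifference P m u) 2 volume := by
  have h1 : ∀ p : Space d × Space d,
      ENNReal.ofReal (‖magneticDifference P u p‖ ^ 2 * levyDensity d m (p.1 - p.2)) =
        ENNReal.ofReal 2 * ‖weightedDifference P m u p‖ₑ ^ (2 : ℝ) := by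
    intro p
    rw [← ofReal_norm, ENNReal.ofReal_rpow_of_nonneg (norm_nonneg _) (by norm_num),
      ← ENNReal.ofReal_mul (by norm_num), Real.rpow_two, norm_weightedDifference_sq hm]
    congr 1
    ring
  have hms := aestronglyMeasurable_weightedDifference hP m u
  change ∫⁻ p : Space d × Space d, ENNReal.ofReal _ < ⊤ ↔ _
  simp_rw [h1]
  rw [lintegral_const_mul' _ _ (by simp), ENNReal.mul_lt_top_iff]
  simp only [MemLp, hms, true_and]
  rw [eLpNorm_lt_top_iff_lintegral_rpow_enorm_lt_top (by simp) (by simp)]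
  simp only [ENNReal.ofReal_lt_top, true_and, ENNReal.toReal_ofNat]
  constructor
  · rintro (h | h | h)
    · exact h
    · simp at h
    · rw [h]; simp
  · exact Or.inl

theorem weightedDifference_add (P : Space d → Space d → Space d) (m : ℝ) (u v : L2 d) :
    weightedDifference P m (u + v) =ᵐ[volume]
      weightedDifference P m u + weightedDifference P m v := by
  have h := Lp.coeFn_add u v
  filter_upwards [ae_fst h, ae_snd h] with p h1 h2
  simp only [weightedDifference, magneticDifference, Pi.add_apply, h1, h2]
  ring

theorem weightedDifference_smul (P : Space d → Space d → Space d) (m : ℝ) (c : ℂ) (u : L2 d) :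
    weightedDifference P m (c • u) =ᵐ[volume] c • weightedDifference P m u := by
  have h := Lp.coeFn_smul c u
  filter_upwards [ae_fst h, ae_snd h] with p h1 h2
  simp only [weightedDifference, magneticDifference, Pi.smul_apply, h1, h2, smul_eq_mul]
  ring

/-- The graph of `u ↦ √(n/2) (e^{-i(x-y)·P} u(x) - u(y))`. -/
def differenceGraph (P : Space d → Space d → Space d) (m : ℝ) :
    Submodule ℂ (WithLp 2 (L2 d × L2Prod d)) where
  carrier := {z | z.snd =ᵐ[volume] weightedDifference P m z.fst}
  zero_mem' := by
    have h := Lp.coeFn_zero ℂ 2 (volume : Measure (Space d))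
    change (0 : L2Prod d) =ᵐ[volume] weightedDifference P m 0
    filter_upwards [ae_fst h, ae_snd h, Lp.coeFn_zero ℂ 2 (volume : Measure (Space d × Space d))]
      with p h1 h2 h3
    simp only [weightedDifference, magneticDifference, h1, h2, h3]
    simp
  add_mem' := by
    intro a b ha hb
    replace ha : a.snd =ᵐ[volume] weightedDifference P m a.fst := ha
    replace hb : b.snd =ᵐ[volume] weightedDifference P m b.fst := hb
    change ((a.snd + b.snd : L2Prod d) : Space d × Space d → ℂ) =ᵐ[volume]
      weightedDifference P m (a.fst + b.fst)
    refine (Lp.coeFn_add _ _).trans ?_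
    exact (EventuallyEq.add ha hb).trans (weightedDifference_add P m _ _).symm
  smul_mem' := by
    intro c a ha
    replace ha : a.snd =ᵐ[volume] weightedDifference P m a.fst := ha
    change ((c • a.snd : L2Prod d) : Space d × Space d → ℂ) =ᵐ[volume]
      weightedDifference P m (c • a.fst)
    refine (Lp.coeFn_smul _ _).trans ?_
    exact (EventuallyEq.const_smul ha c).trans (weightedDifference_smul P m _ _).symm

theorem mem_differenceGraph {P : Space d → Space d → Space d} {m : ℝ} {u : L2 d} {g : L2Prod d} :
    WithLp.toLp 2 (u, g) ∈ differenceGraph P m ↔ g =ᵐ[volume] weightedDifference P m u :=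
  Iff.rfl

theorem exists_subseq_ae_tendsto {α : Type*} [MeasurableSpace α] {μ : Measure α}
    {u : ℕ → Lp ℂ 2 μ} {v : Lp ℂ 2 μ} (h : Tendsto u atTop (𝓝 v)) :
    ∃ ns : ℕ → ℕ, StrictMono ns ∧ ∀ᵐ x ∂μ, Tendsto (fun k => u (ns k) x) atTop (𝓝 (v x)) :=
  (tendstoInMeasure_of_tendsto_Lp h).exists_seq_tendsto_ae

/-- The difference is a pointwise expression in `u`, so it survives almost everywhere convergence.
The second subsequence is taken inside the first, so that both components converge almost everywhere
together. -/
theorem isClosed_differenceGraph (P : Space d → Space d → Space d) (m : ℝ) :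
    IsClosed (differenceGraph P m : Set (WithLp 2 (L2 d × L2Prod d))) := by
  refine IsSeqClosed.isClosed ?_
  intro z w hz hzw
  have hcont := WithLp.prod_continuous_ofLp 2 (L2 d) (L2Prod d)
  have h1 : Tendsto (fun k => (z k).fst) atTop (𝓝 w.fst) :=
    ((continuous_fst.comp hcont).tendsto w).comp hzw
  have h2 : Tendsto (fun k => (z k).snd) atTop (𝓝 w.snd) :=
    ((continuous_snd.comp hcont).tendsto w).comp hzw
  obtain ⟨ns, hns, a1⟩ := exists_subseq_ae_tendsto h1
  obtain ⟨ms, hms, a2⟩ := exists_subseq_ae_tendsto (h2.comp hns.tendsto_atTop)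
  have a3 : ∀ᵐ p : Space d × Space d, ∀ k, (z k).snd p = weightedDifference P m (z k).fst p :=
    ae_all_iff.2 fun k => hz k
  change w.snd =ᵐ[volume] weightedDifference P m w.fst
  filter_upwards [ae_fst a1, ae_snd a1, a2, a3] with p b1 b2 b3 b4
  refine tendsto_nhds_unique b3 ?_
  simp only [Function.comp_def, b4]
  refine Tendsto.mul_const _ (Tendsto.sub (Tendsto.const_mul _ ?_) ?_)
  · exact b1.comp hms.tendsto_atTop
  · exact b2.comp hms.tendsto_atTop

theorem form_eq {m : ℝ} (hm : 0 ≤ m) {P : Space d → Space d → Space d} {u v : L2 d}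
    {g h : L2Prod d} (hg : g =ᵐ[volume] weightedDifference P m u)
    (hh : h =ᵐ[volume] weightedDifference P m v) :
    form P m u v = (m : ℂ) * ⟪u, v⟫_ℂ + ⟪g, h⟫_ℂ := by
  rw [form, L2.inner_def (𝕜 := ℂ) g h, ← integral_const_mul]
  congr 1
  refine integral_congr_ae ?_
  filter_upwards [hg, hh] with p h1 h2
  rw [h1, h2, RCLike.inner_apply, weightedDifference, weightedDifference, map_mul,
    Complex.conj_ofReal]
  have h3 : ((√(levyDensity d m (p.1 - p.2) / 2) : ℝ) : ℂ) *
      ((√(levyDensity d m (p.1 - p.2) / 2) : ℝ) : ℂ) =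
      ((levyDensity d m (p.1 - p.2) : ℝ) : ℂ) / 2 := by
    rw [← Complex.ofReal_mul, Real.mul_self_sqrt]
    · push_cast; rfl
    · have := levyDensity_nonneg (d := d) hm (p.1 - p.2)
      positivity
  linear_combination (-(starRingEnd ℂ (magneticDifference P u p) * magneticDifference P v p)) * h3

/-- Splitting off the mass leaves the form `⟪T u, T v⟫` of the difference map `T`, so the operator
is `T* T + m` and the abstract theory applies. -/
theorem mem_formOperator_iff {m : ℝ} (hm : 0 ≤ m) {P : Space d → Space d → Space d}
    (hP : Measurable fun p : Space d × Space d => P p.1 p.2) (u w : L2 d) :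
    (u, w) ∈ formOperator P m ↔ (u, w - (m : ℂ) • u) ∈ associated (differenceGraph P m) := by
  have hsub : ∀ v : L2 d, ⟪w - (m : ℂ) • u, v⟫_ℂ = ⟪w, v⟫_ℂ - (m : ℂ) * ⟪u, v⟫_ℂ := by
    intro v
    rw [inner_sub_left, inner_smul_left, Complex.conj_ofReal]
  constructor
  · rintro ⟨h1, h2⟩
    have hu := (mem_formDomain_iff hm hP u).1 h1
    refine ⟨hu.toLp _, hu.coeFn_toLp, fun v h hv => ?_⟩
    have hv' := mem_differenceGraph.1 hv
    have hvd : v ∈ formDomain P m :=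
      (mem_formDomain_iff hm hP v).2 ((memLp_congr_ae hv').1 (Lp.memLp h))
    have := h2 v hvd
    dsimp only at this ⊢
    rw [form_eq hm hu.coeFn_toLp hv'] at this
    rw [hsub, ← this]
    ring
  · rintro ⟨g, hg, h2⟩
    have hg' := mem_differenceGraph.1 hg
    refine ⟨(mem_formDomain_iff hm hP u).2 ((memLp_congr_ae hg').1 (Lp.memLp g)), fun v hv => ?_⟩
    have hv' := (mem_formDomain_iff hm hP v).1 hv
    have := h2 v (hv'.toLp _) hv'.coeFn_toLp
    dsimp only at this ⊢
    rw [form_eq hm hg' hv'.coeFn_toLp, this, hsub]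
    ring

/-- If the form domain contains all test functions, the form operator is selfadjoint and bounded
below by `m`. -/
theorem exists_isFormOperator {m : ℝ} (hm : 0 ≤ m) {P : Space d → Space d → Space d}
    (hP : Measurable fun p : Space d × Space d => P p.1 p.2)
    (htest : ∀ (u : L2 d) (f : Space d → ℂ), IsTest f → u =ᵐ[volume] f → u ∈ formDomain P m) :
    ∃ H : L2 d →ₗ.[ℂ] L2 d, IsFormOperator P m H ∧
      BoundedBelow (H.graph : Set (L2 d × L2 d)) m := by
  have hd : Dense {u : L2 d | ∃ g, WithLp.toLp 2 (u, g) ∈ differenceGraph P m} := by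
    refine dense_tests.mono ?_
    rintro u ⟨f, hf, hu⟩
    have h1 := (mem_formDomain_iff hm hP u).1 (htest u f hf hu)
    exact ⟨h1.toLp _, h1.coeFn_toLp⟩
  obtain ⟨H, hH, hg⟩ := exists_isSelfAdjoint_associated (differenceGraph P m)
    (isClosed_differenceGraph P m) hd m
  refine ⟨H, ⟨hH, ?_⟩, ?_⟩
  · ext ⟨u, w⟩
    rw [mem_formOperator_iff hm hP, ← hg]
    rfl
  · intro u w huw
    have h1 := associated_nonneg ((hg u w).1 huw)
    have h2 : ⟪u, u⟫_ℂ = ((‖u‖ ^ 2 : ℝ) : ℂ) := by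
      rw [inner_self_eq_norm_sq_to_K]; norm_cast
    rw [inner_sub_right, inner_smul_right, h2, ← Complex.ofReal_mul, Complex.sub_im,
      Complex.sub_re, Complex.ofReal_re, Complex.ofReal_im, sub_zero, sub_nonneg] at h1
    exact h1

end FormOperator

/-! ### Test functions have finite magnetic energy. -/

section TestsInFormDomain

variable {d : ℕ}

/-- The power count near the diagonal. It is an equality for `ρ > 0`; at `ρ = 0` the left side
vanishes. -/
theorem rpow_mul_inv_pow_le {ρ s C : ℝ} (hρ : 0 ≤ ρ) (hs : 0 < s) (hC : 0 ≤ C) :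
    ρ ^ (1 + s) * (C / ρ ^ (d + 1)) ≤ C * ρ ^ (s - d) := by
  rcases hρ.eq_or_lt with rfl | hρ
  · rw [Real.zero_rpow (by linarith), zero_mul]
    positivity
  · refine le_of_eq ?_
    have e : ρ ^ (s - d) = ρ ^ (1 + s) / ρ ^ (d + 1) := by
      rw [← Real.rpow_natCast, ← Real.rpow_sub hρ]
      congr 1
      push_cast
      ring
    rw [e]
    ring

/-- Jensen passes the power inside the average, and each segment point is a translate of `x` by at
most one unit. Hence one bound over a larger ball serves every displacement `z`. -/
theorem exists_lintegral_potential_le {μ : Measure ℝ} (hμ : IsSegmentWeight μ)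
    {A : Space d → Space d} (hA : Measurable A) {p : ℝ} (hp : 1 ≤ p) (hL : LocLp A p) (R : ℝ) :
    ∃ M : ENNReal, M < ⊤ ∧ ∀ z : Space d, ‖z‖ ≤ 1 →
      ∫⁻ x in Metric.closedBall 0 R, (1 + ‖weightedPotential μ A x (x + z)‖ₑ ^ p) ≤ M := by
  have := hμ.prob
  refine ⟨volume (Metric.closedBall (0 : Space d) R) +
    ∫⁻ z in Metric.closedBall (0 : Space d) (R + 1), ‖A z‖ₑ ^ p, ?_, fun z hz => ?_⟩
  · exact ENNReal.add_lt_top.2 ⟨measure_closedBall_lt_top, hL.lintegral_lt_top (by linarith) _⟩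
  · rw [lintegral_add_left measurable_const, setLIntegral_one]
    refine add_le_add le_rfl ?_
    refine le_trans (lintegral_mono fun x => ?_)
      (lintegral_segment_le hμ (g := fun z => ‖A z‖ₑ ^ p) (by fun_prop) R hz)
    rw [weightedPotential_add]
    exact enorm_integral_rpow_le (F := fun θ => A (x + θ • z)) (hA.comp (by fun_prop)) hp

/-- In the coordinates `(x, x + z)` the integral is split at `|z| = 1`. For short `z` the difference
is at most `|e^{-it} - 1| |f(x)| + |f(x) - f(x + z)|`, whose square is of order `|z|^{1+δ} (1 +
|P|^{1+δ})`; against the density this leaves the integrable `|z|^{δ-d}`. For long `z` the density is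
integrable and `f` is square integrable. -/
theorem test_mem_formDomain (hd : 1 ≤ d) {m : ℝ} (hm : 0 ≤ m) {μ : Measure ℝ}
    (hμ : IsSegmentWeight μ) {A : Space d → Space d} (hA : Measurable A) {δ : ℝ} (hδ : 0 < δ)
    (hL : LocLp A (1 + δ)) {u : L2 d} {f : Space d → ℂ} (hf : IsTest f) (hu : u =ᵐ[volume] f) :
    u ∈ formDomain (weightedPotential μ A) m := by
  -- Lowering `δ` weakens the hypothesis on `A`; with `δ ≤ 1` the Lipschitz term `|z|²` is at most
  -- `|z|^{1+δ}` on the unit ball.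
  wlog hδ1 : δ ≤ 1 generalizing δ
  · exact this one_pos (hL.mono (by linarith)) le_rfl
  set P := weightedPotential μ A with hPdef
  have hP : Measurable fun p : Space d × Space d => P p.1 p.2 := measurable_weightedPotential hμ hA
  obtain ⟨M, L, R, hM0, hL0, hR0, hM, hLip, hR⟩ := hf.exists_bounds
  obtain ⟨c, C, hC, hn, -⟩ := exists_levyDensity_bounds hd hm
  obtain ⟨I, hI, hIle⟩ := exists_lintegral_potential_le hμ hA (by linarith) hL (R + 1)
  have hfm : Measurable f := hf.1.continuous.measurable
  have hnm := measurable_levyDensity d m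
  set E : Space d × Space d → ℂ :=
    fun p => Complex.exp (-Complex.I * ((⟪p.1 - p.2, P p.1 p.2⟫_ℝ : ℝ) : ℂ)) with hE
  have hEm : Measurable E := by
    have h1 : Measurable fun p : Space d × Space d => ⟪p.1 - p.2, P p.1 p.2⟫_ℝ :=
      Measurable.inner (by fun_prop) hP
    have h2 := Complex.measurable_ofReal.comp h1
    exact (h2.const_mul _).cexp
  set F : Space d × Space d → ENNReal := fun p =>
    ENNReal.ofReal (‖E p * f p.1 - f p.2‖ ^ 2 * levyDensity d m (p.1 - p.2)) with hF
  have hFm : Measurable F := by fun_prop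
  have e1 : ∫⁻ p : Space d × Space d, ENNReal.ofReal
      (‖magneticDifference P u p‖ ^ 2 * levyDensity d m (p.1 - p.2)) = ∫⁻ p, F p := by
    refine lintegral_congr_ae ?_
    filter_upwards [ae_fst hu, ae_snd hu] with p h1 h2
    rw [magneticDifference, h1, h2]
  have e2 : ∫⁻ p, F p = ∫⁻ z, ∫⁻ x, F (x, x + z) := by
    have h1 := (measurePreserving_prod_add (volume : Measure (Space d))
      (volume : Measure (Space d))).lintegral_comp hFm
    have h2 := lintegral_prod_symm (μ := (volume : Measure (Space d)))
      (ν := (volume : Measure (Space d))) (fun q => F (q.1, q.1 + q.2))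
      (hFm.comp (by fun_prop)).aemeasurable
    exact h1.symm.trans h2
  change ∫⁻ p : Space d × Space d, ENNReal.ofReal _ < ⊤
  rw [e1, e2]
  have hnz : ∀ x z : Space d, levyDensity d m (x - (x + z)) = levyDensity d m z := by
    intro x z
    rw [← levyDensity_neg]
    congr 1
    abel
  -- From `(a + b)² ≤ 2a² + 2b²`, with `L²` for the increment of `f`, `4 M²` for the phase, and `C`
  -- for the density.
  set K : ℝ := (2 * L ^ 2 + 8 * M ^ 2) * C with hK
  have hK0 : 0 ≤ K := by positivity
  -- short distances
  have near : ∀ z : Space d, ‖z‖ < 1 →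
      ∫⁻ x, F (x, x + z) ≤ ENNReal.ofReal (K * ‖z‖ ^ (δ - d)) * I := by
    intro z hz
    have hpt : ∀ x, F (x, x + z) ≤ (Metric.closedBall (0 : Space d) (R + 1)).indicator
        (fun x => ENNReal.ofReal (K * ‖z‖ ^ (δ - d)) * (1 + ‖P x (x + z)‖ₑ ^ (1 + δ))) x := by
      intro x
      by_cases hx : x ∈ Metric.closedBall (0 : Space d) (R + 1)
      · rw [Set.indicator_of_mem hx]
        have h1 : 1 + ‖P x (x + z)‖ₑ ^ (1 + δ) =
            ENNReal.ofReal (1 + ‖P x (x + z)‖ ^ (1 + δ)) := by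
          rw [ENNReal.ofReal_add zero_le_one (by positivity), ENNReal.ofReal_one, ← ofReal_norm,
            ENNReal.ofReal_rpow_of_nonneg (norm_nonneg _) (by linarith)]
        rw [h1, ← ENNReal.ofReal_mul (by positivity)]
        refine ENNReal.ofReal_le_ofReal ?_
        dsimp only
        rw [hnz]
        set t : ℝ := ⟪x - (x + z), P x (x + z)⟫_ℝ with ht
        have hEt : E (x, x + z) = Complex.exp (-Complex.I * (t : ℂ)) := rfl
        have htle : |t| ≤ ‖z‖ * ‖P x (x + z)‖ := by
          refine (abs_real_inner_le_norm _ _).trans (le_of_eq ?_)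
          rw [sub_add_cancel_left, norm_neg]
        have h2 : ‖E (x, x + z) * f x - f (x + z)‖ ≤
            ‖E (x, x + z) - 1‖ * ‖f x‖ + ‖f x - f (x + z)‖ := by
          rw [← norm_mul]
          refine le_trans (le_of_eq ?_) (norm_add_le _ _)
          ring_nf
        have h3 : ‖f x - f (x + z)‖ ^ 2 ≤ L ^ 2 * ‖z‖ ^ (1 + δ) := by
          have h4 := hLip x (x + z)
          rw [sub_add_cancel_left, norm_neg] at h4
          have h5 : ‖z‖ ^ (2 : ℝ) ≤ ‖z‖ ^ (1 + δ) :=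
            Real.rpow_le_rpow_of_exponent_ge' (norm_nonneg z) hz.le (by linarith) (by linarith)
          rw [Real.rpow_two] at h5
          calc ‖f x - f (x + z)‖ ^ 2 ≤ (L * ‖z‖) ^ 2 := by gcongr
            _ = L ^ 2 * ‖z‖ ^ 2 := by ring
            _ ≤ _ := by gcongr
        have h6 : (‖E (x, x + z) - 1‖ * ‖f x‖) ^ 2 ≤
            4 * M ^ 2 * (‖z‖ ^ (1 + δ) * ‖P x (x + z)‖ ^ (1 + δ)) := by
          have h7 := norm_exp_sub_one_sq_le t hδ hδ1
          rw [← hEt] at h7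
          have h8 : |t| ^ (1 + δ) ≤ ‖z‖ ^ (1 + δ) * ‖P x (x + z)‖ ^ (1 + δ) := by
            rw [← Real.mul_rpow (norm_nonneg _) (norm_nonneg _)]
            gcongr
          rw [mul_pow]
          calc ‖E (x, x + z) - 1‖ ^ 2 * ‖f x‖ ^ 2
              ≤ (4 * (‖z‖ ^ (1 + δ) * ‖P x (x + z)‖ ^ (1 + δ))) * M ^ 2 := by
                gcongr
                · linarith
                · exact hM x
            _ = _ := by ring
        have h9 : ‖E (x, x + z) * f x - f (x + z)‖ ^ 2 ≤
            (2 * L ^ 2 + 8 * M ^ 2) * ‖z‖ ^ (1 + δ) * (1 + ‖P x (x + z)‖ ^ (1 + δ)) := by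
          have a1 : 0 ≤ ‖z‖ ^ (1 + δ) := by positivity
          have a2 : 0 ≤ ‖P x (x + z)‖ ^ (1 + δ) := by positivity
          have a3 := pow_le_pow_left₀ (norm_nonneg _) h2 2
          have a4 : 0 ≤ L ^ 2 * (‖z‖ ^ (1 + δ) * ‖P x (x + z)‖ ^ (1 + δ)) := by positivity
          have a5 : 0 ≤ M ^ 2 * ‖z‖ ^ (1 + δ) := by positivity
          nlinarith [sq_nonneg (‖E (x, x + z) - 1‖ * ‖f x‖ - ‖f x - f (x + z)‖)]
        calc ‖E (x, x + z) * f x - f (x + z)‖ ^ 2 * levyDensity d m z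
            ≤ ((2 * L ^ 2 + 8 * M ^ 2) * ‖z‖ ^ (1 + δ) * (1 + ‖P x (x + z)‖ ^ (1 + δ))) *
              (C / ‖z‖ ^ (d + 1)) := by
              gcongr
              · exact levyDensity_nonneg hm z
              · exact hn z
          _ = (2 * L ^ 2 + 8 * M ^ 2) * (‖z‖ ^ (1 + δ) * (C / ‖z‖ ^ (d + 1))) *
              (1 + ‖P x (x + z)‖ ^ (1 + δ)) := by ring
          _ ≤ (2 * L ^ 2 + 8 * M ^ 2) * (C * ‖z‖ ^ (δ - d)) *
              (1 + ‖P x (x + z)‖ ^ (1 + δ)) := by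
              have := rpow_mul_inv_pow_le (d := d) (norm_nonneg z) hδ hC
              exact mul_le_mul_of_nonneg_right (mul_le_mul_of_nonneg_left this (by positivity))
                (by positivity)
          _ = _ := by rw [hK]; ring
      · rw [Set.indicator_of_notMem hx]
        rw [mem_closedBall_zero_iff, not_le] at hx
        have h1 : f x = 0 := hR x (by linarith)
        have h2 : f (x + z) = 0 := by
          apply hR
          have : ‖x‖ ≤ ‖x + z‖ + ‖z‖ := by
            have := norm_sub_le (x + z) z
            rwa [add_sub_cancel_right] at this
          linarith
        simp [hF, h1, h2]
    refine (lintegral_mono hpt).trans ?_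
    rw [lintegral_indicator measurableSet_closedBall, lintegral_const_mul' _ _ ENNReal.ofReal_ne_top]
    gcongr
    exact hIle z hz.le
  -- long distances
  set J : ENNReal := ENNReal.ofReal (2 * M ^ 2) * volume (Metric.closedBall (0 : Space d) R) +
    ENNReal.ofReal (2 * M ^ 2) * volume (Metric.closedBall (0 : Space d) R) with hJ
  have hJt : J < ⊤ := by
    have : ENNReal.ofReal (2 * M ^ 2) * volume (Metric.closedBall (0 : Space d) R) < ⊤ :=
      ENNReal.mul_lt_top ENNReal.ofReal_lt_top measure_closedBall_lt_top
    exact ENNReal.add_lt_top.2 ⟨this, this⟩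
  have hfi : ∀ x, 2 * ‖f x‖ ^ 2 ≤ (Metric.closedBall (0 : Space d) R).indicator
      (fun _ => 2 * M ^ 2) x := by
    intro x
    by_cases hx : x ∈ Metric.closedBall (0 : Space d) R
    · rw [Set.indicator_of_mem hx]
      have := hM x
      gcongr
    · rw [Set.indicator_of_notMem hx]
      rw [mem_closedBall_zero_iff, not_le] at hx
      simp [hR x hx]
  have hfl : ∫⁻ x, ENNReal.ofReal (2 * ‖f x‖ ^ 2) ≤
      ENNReal.ofReal (2 * M ^ 2) * volume (Metric.closedBall (0 : Space d) R) := by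
    rw [← setLIntegral_const, ← lintegral_indicator measurableSet_closedBall]
    refine lintegral_mono fun x => ?_
    refine (ENNReal.ofReal_le_ofReal (hfi x)).trans (le_of_eq ?_)
    by_cases hx : x ∈ Metric.closedBall (0 : Space d) R
    · rw [Set.indicator_of_mem hx, Set.indicator_of_mem hx]
    · rw [Set.indicator_of_notMem hx, Set.indicator_of_notMem hx, ENNReal.ofReal_zero]
  have far : ∀ z : Space d, ∫⁻ x, F (x, x + z) ≤ ENNReal.ofReal (levyDensity d m z) * J := by
    intro z
    have hpt : ∀ x, F (x, x + z) ≤ ENNReal.ofReal (levyDensity d m z) *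
        (ENNReal.ofReal (2 * ‖f x‖ ^ 2) + ENNReal.ofReal (2 * ‖f (x + z)‖ ^ 2)) := by
      intro x
      rw [← ENNReal.ofReal_add (by positivity) (by positivity),
        ← ENNReal.ofReal_mul (levyDensity_nonneg hm z)]
      refine ENNReal.ofReal_le_ofReal ?_
      dsimp only
      rw [hnz, mul_comm]
      refine mul_le_mul_of_nonneg_left ?_ (levyDensity_nonneg hm z)
      have h2 : ‖E (x, x + z) * f x - f (x + z)‖ ≤ ‖f x‖ + ‖f (x + z)‖ := by
        refine (norm_sub_le _ _).trans (le_of_eq ?_)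
        rw [norm_mul, hE]
        dsimp only
        rw [norm_exp_neg_I_mul, one_mul]
      have a3 := pow_le_pow_left₀ (norm_nonneg _) h2 2
      nlinarith [sq_nonneg (‖f x‖ - ‖f (x + z)‖)]
    refine (lintegral_mono hpt).trans ?_
    rw [lintegral_const_mul' _ _ ENNReal.ofReal_ne_top]
    gcongr
    rw [lintegral_add_left (by fun_prop), hJ,
      lintegral_add_right_eq_self (fun x => ENNReal.ofReal (2 * ‖f x‖ ^ 2)) z]
    gcongr
  rw [← lintegral_add_compl _ (measurableSet_ball (x := (0 : Space d)) (ε := 1))]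
  refine ENNReal.add_lt_top.2 ⟨?_, ?_⟩
  · refine lt_of_le_of_lt (setLIntegral_mono' measurableSet_ball fun z hz =>
      near z (mem_ball_zero_iff.1 hz)) ?_
    rw [lintegral_mul_const' _ _ hI.ne]
    refine ENNReal.mul_lt_top ?_ hI
    exact ((integrableOn_norm_rpow_ball hd hδ).const_mul K).lintegral_lt_top
  · refine lt_of_le_of_lt (lintegral_mono far) ?_
    rw [lintegral_mul_const' _ _ hJt.ne]
    refine ENNReal.mul_lt_top ?_ hJt
    have e : (Metric.ball (0 : Space d) 1)ᶜ = {z | 1 ≤ ‖z‖} := by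
      ext z
      simp
    rw [e]
    exact (integrableOn_levyDensity hd hm one_pos).lintegral_lt_top

/-- The operator associated with the form is selfadjoint and bounded below by `m`. -/
theorem exists_formOperator_weighted (hd : 1 ≤ d) {m : ℝ} (hm : 0 ≤ m) {μ : Measure ℝ}
    (hμ : IsSegmentWeight μ) {A : Space d → Space d} {δ : ℝ} (hδ : 0 < δ)
    (hL : LocLp A (1 + δ)) :
    ∃ H : L2 d →ₗ.[ℂ] L2 d, IsFormOperator (weightedPotential μ A) m H ∧
      BoundedBelow (H.graph : Set (L2 d × L2 d)) m := by
  obtain ⟨A', hA', hAA', hL'⟩ := hL.exists_measurable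
  obtain ⟨H, hH, hb⟩ := exists_isFormOperator hm (measurable_weightedPotential hμ hA')
    (fun u f hf hu => test_mem_formDomain hd hm hμ hA' hδ hL' hf hu)
  refine ⟨H, ⟨hH.1, ?_⟩, hb⟩
  rw [hH.2]
  exact (formOperator_congr m (weightedPotential_congr hμ hAA')).symm

end TestsInFormDomain

/-! ### The square root of the magnetic Laplacian plus `m²`. -/

section SquareRoot

variable {d : ℕ}

theorem magneticLaplacian_nonneg {A : Space d → Space d} {u w : L2 d}
    (h : (u, w) ∈ magneticLaplacian A) : 0 ≤ (⟪u, w⟫_ℂ).re := by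
  obtain ⟨g, hg, hv⟩ := h
  have h1 := hv u g hg
  dsimp only at h1
  rw [← inner_conj_symm, Complex.conj_re, ← h1, Complex.re_sum]
  exact Finset.sum_nonneg fun k _ => inner_self_nonneg (𝕜 := ℂ)

/-- A square root of `(-i∇ - A)² + m²` is bounded below by `m`. -/
theorem IsMagneticSqrt.boundedBelow {A : Space d → Space d} {m : ℝ} (hm : 0 ≤ m)
    {H : L2 d →ₗ.[ℂ] L2 d} (hH : IsMagneticSqrt A m H) :
    BoundedBelow (H.graph : Set (L2 d × L2 d)) m := by
  obtain ⟨hsa, hpos, hsq⟩ := hH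
  have hpos' : ∀ u w, (u, w) ∈ H.graph → (⟪u, w⟫_ℂ).im = 0 ∧ 0 ≤ (⟪u, w⟫_ℂ).re := by
    intro u w huw
    have := hpos u w huw
    rwa [zero_mul] at this
  intro u w huw
  refine ⟨(hpos' u w huw).1, lower_bound_of_sq hsa hm hpos' ?_ huw⟩
  intro a b c hab hbc
  have h1 := magneticLaplacian_nonneg ((hsq a c).1 ⟨b, hab, hbc⟩)
  have h2 : ⟪a, a⟫_ℂ = ((‖a‖ ^ 2 : ℝ) : ℂ) := by
    rw [inner_self_eq_norm_sq_to_K]; norm_cast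
  rw [inner_sub_right, inner_smul_right, h2, ← Complex.ofReal_mul, Complex.sub_re,
    Complex.ofReal_re, sub_nonneg] at h1
  exact h1

theorem LocLp.apply {A : Space d → Space d} {p : ℝ} (h : LocLp A p) (k : Fin d) {K : Set (Space d)}
    (hK : IsCompact K) :
    MemLp (fun x => ((A x k : ℝ) : ℂ)) (ENNReal.ofReal p) (volume.restrict K) := by
  have h1 := h K hK
  refine h1.mono ?_ (ae_of_all _ fun x => ?_)
  · have h2 : Continuous fun v : Space d => ((v k : ℝ) : ℂ) := by fun_prop
    exact h2.comp_aestronglyMeasurable h1.aestronglyMeasurable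
  · rw [Complex.norm_real]
    exact PiLp.norm_apply_le (A x) k

/-- The product of a locally `L^p` function with a test function is in `L^p`. -/
theorem LocLp.memLp_mul_test {A : Space d → Space d} {p : ℝ} (h : LocLp A p) (k : Fin d)
    {φ : Space d → ℂ} (hφ : IsTest φ) :
    MemLp (fun x => ((A x k : ℝ) : ℂ) * φ x) (ENNReal.ofReal p) volume := by
  have h1 := h.apply k hφ.2.isCompact
  have h2 : MemLp (fun x => φ x * ((A x k : ℝ) : ℂ)) (ENNReal.ofReal p)
      (volume.restrict (tsupport φ)) := by
    obtain ⟨M, hM⟩ := hφ.1.continuous.bounded_above_of_compact_support hφ.2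
    refine h1.of_le_mul (c := M)
      (hφ.1.continuous.aestronglyMeasurable.mul h1.aestronglyMeasurable) (ae_of_all _ fun x => ?_)
    rw [norm_mul]
    exact mul_le_mul_of_nonneg_right (hM x) (norm_nonneg _)
  rw [← memLp_indicator_iff_restrict (isClosed_tsupport φ).measurableSet] at h2
  refine (memLp_congr_ae (ae_of_all _ fun x => ?_)).1 h2
  by_cases hx : x ∈ tsupport φ
  · rw [Set.indicator_of_mem hx, mul_comm]
  · rw [Set.indicator_of_notMem hx, image_eq_zero_of_notMem_tsupport hx, mul_zero]

theorem IsTest.memLp_fderiv {φ : Space d → ℂ} (hφ : IsTest φ) (v : Space d) (p : ENNReal) :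
    MemLp (fun x => fderiv ℝ φ x v) p volume := by
  have h1 : Continuous fun x => fderiv ℝ φ x v := by
    have := hφ.1.continuous_fderiv (by simp)
    fun_prop
  exact h1.memLp_of_hasCompactSupport (hφ.2.fderiv_apply (𝕜 := ℝ) v)

theorem two_eq_ofReal : (2 : ENNReal) = ENNReal.ofReal 2 := by simp

theorem memLp_magnetic_test {A : Space d → Space d} (hA : LocLp A 2) (k : Fin d)
    {φ : Space d → ℂ} (hφ : IsTest φ) (c : ℂ) :
    MemLp (fun x => c * fderiv ℝ φ x (EuclideanSpace.single k 1) - ((A x k : ℝ) : ℂ) * φ x) 2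
      volume := by
  have h1 := hA.memLp_mul_test k hφ
  rw [← two_eq_ofReal] at h1
  exact ((hφ.memLp_fderiv _ 2).const_mul c).sub h1

theorem memLp_conj {f : Space d → ℂ} (hf : MemLp f 2 volume) :
    MemLp (fun x => (starRingEnd ℂ) (f x)) 2 volume := hf.star

/-- The pairing `∫ u ψ` as an inner product. -/
theorem inner_toLp_conj {ψ : Space d → ℂ} (hψ : MemLp ψ 2 volume) (u : L2 d) :
    ⟪(memLp_conj hψ).toLp _, u⟫_ℂ = ∫ x, u x * ψ x := by
  rw [L2.inner_def]
  refine integral_congr_ae ?_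
  filter_upwards [(memLp_conj hψ).coeFn_toLp] with x hx
  rw [hx, RCLike.inner_apply, Complex.conj_conj]

/-- For `A` locally square integrable, `i ∂ₖφ - Aₖ φ` is in `L²`. The distributional equation thus
compares continuous functionals of `u` and `g`, which makes the graph closed. Conjugates appear
because the inner product is antilinear on the left. -/
theorem isMagneticGradient_iff {A : Space d → Space d} (hA : LocLp A 2) (u : L2 d)
    (g : Fin d → L2 d) : IsMagneticGradient A u g ↔ ∀ (k : Fin d) (φ : Space d → ℂ) (hφ : IsTest φ),
      ⟪(memLp_conj (memLp_magnetic_test hA k hφ Complex.I)).toLp _, u⟫_ℂ =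
        ⟪(memLp_conj (hφ.memLp 2)).toLp _, g k⟫_ℂ := by
  have hloc : ∀ k : Fin d, LocallyIntegrable (fun x => ((A x k : ℝ) : ℂ) * u x) volume := by
    intro k
    rw [locallyIntegrable_iff]
    intro K hK
    have h1 := hA.apply k hK
    rw [← two_eq_ofReal] at h1
    exact MemLp.integrable_mul h1 ((Lp.memLp u).restrict K)
  refine forall_congr' fun k => ?_
  simp only [hloc k, true_and]
  refine forall_congr' fun φ => forall_congr' fun hφ => ?_
  rw [inner_toLp_conj (memLp_magnetic_test hA k hφ Complex.I), inner_toLp_conj (hφ.memLp 2)]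
  have e : ∀ x, Complex.I * (u x * fderiv ℝ φ x (EuclideanSpace.single k 1)) -
      ((A x k : ℝ) : ℂ) * u x * φ x = u x * (Complex.I * fderiv ℝ φ x (EuclideanSpace.single k 1) -
        ((A x k : ℝ) : ℂ) * φ x) := fun x => by ring
  simp only [e]

/-- The graph of `u ↦ ((-i∇ - A)u, m u)`. -/
def magneticGraph {A : Space d → Space d} (hA : LocLp A 2) (m : ℝ) :
    Submodule ℂ (WithLp 2 (L2 d × PiLp 2 (fun _ : Option (Fin d) => L2 d))) where
  carrier := {z | (∀ (k : Fin d) (φ : Space d → ℂ) (hφ : IsTest φ),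
    ⟪(memLp_conj (memLp_magnetic_test hA k hφ Complex.I)).toLp _, z.fst⟫_ℂ =
        ⟪(memLp_conj (hφ.memLp 2)).toLp _, z.snd (some k)⟫_ℂ) ∧ z.snd none = (m : ℂ) • z.fst}
  zero_mem' := by
    refine ⟨fun k φ hφ => ?_, ?_⟩
    · change ⟪_, (0 : L2 d)⟫_ℂ = ⟪_, (0 : L2 d)⟫_ℂ
      rw [inner_zero_right, inner_zero_right]
    · change (0 : L2 d) = (m : ℂ) • (0 : L2 d)
      rw [smul_zero]
  add_mem' := by
    rintro a b ⟨ha, ha'⟩ ⟨hb, hb'⟩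
    refine ⟨fun k φ hφ => ?_, ?_⟩
    · change ⟪_, a.fst + b.fst⟫_ℂ = ⟪_, a.snd (some k) + b.snd (some k)⟫_ℂ
      rw [inner_add_right, inner_add_right, ha k φ hφ, hb k φ hφ]
    · change a.snd none + b.snd none = (m : ℂ) • (a.fst + b.fst)
      rw [smul_add, ha', hb']
  smul_mem' := by
    rintro c a ⟨ha, ha'⟩
    refine ⟨fun k φ hφ => ?_, ?_⟩
    · change ⟪_, c • a.fst⟫_ℂ = ⟪_, c • a.snd (some k)⟫_ℂ
      rw [inner_smul_right, inner_smul_right, ha k φ hφ]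
    · change c • a.snd none = (m : ℂ) • (c • a.fst)
      rw [smul_comm, ha']

theorem mem_magneticGraph {A : Space d → Space d} (hA : LocLp A 2) (m : ℝ) (u : L2 d)
    (g : PiLp 2 (fun _ : Option (Fin d) => L2 d)) :
    WithLp.toLp 2 (u, g) ∈ magneticGraph hA m ↔
      IsMagneticGradient A u (fun k => g (some k)) ∧ g none = (m : ℂ) • u := by
  rw [isMagneticGradient_iff hA]
  rfl

theorem isClosed_magneticGraph {A : Space d → Space d} (hA : LocLp A 2) (m : ℝ) :
    IsClosed (magneticGraph hA m :
      Set (WithLp 2 (L2 d × PiLp 2 (fun _ : Option (Fin d) => L2 d)))) := by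
  have hcont := WithLp.prod_continuous_ofLp 2 (L2 d) (PiLp 2 (fun _ : Option (Fin d) => L2 d))
  have c1 : Continuous fun z : WithLp 2 (L2 d × PiLp 2 (fun _ : Option (Fin d) => L2 d)) =>
      z.fst := continuous_fst.comp hcont
  have c2 : ∀ k, Continuous fun z : WithLp 2 (L2 d × PiLp 2 (fun _ : Option (Fin d) => L2 d)) =>
      z.snd k := fun k => (PiLp.continuous_apply 2 _ k).comp (continuous_snd.comp hcont)
  have : (magneticGraph hA m : Set (WithLp 2 (L2 d × PiLp 2 (fun _ : Option (Fin d) => L2 d)))) =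
      (⋂ (k : Fin d) (φ : Space d → ℂ) (hφ : IsTest φ),
        {z | ⟪(memLp_conj (memLp_magnetic_test hA k hφ Complex.I)).toLp _, z.fst⟫_ℂ =
          ⟪(memLp_conj (hφ.memLp 2)).toLp _, z.snd (some k)⟫_ℂ}) ∩
        {z | z.snd none = (m : ℂ) • z.fst} := by
    ext z
    simp only [Set.mem_inter_iff, Set.mem_iInter]
    rfl
  rw [this]
  refine IsClosed.inter ?_ (isClosed_eq (c2 none) (by fun_prop))
  refine isClosed_iInter fun k => isClosed_iInter fun φ => isClosed_iInter fun hφ => ?_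
  exact isClosed_eq (continuous_const.inner c1) (continuous_const.inner (c2 (some k)))

/-- A test function `f` belongs to the domain: `-i ∂ₖf - Aₖ f` lies in `L²`, and integration by
parts identifies it with the distributional gradient. -/
theorem dense_magneticGraph {A : Space d → Space d} (hA : LocLp A 2) (m : ℝ) :
    Dense {u : L2 d | ∃ g, WithLp.toLp 2 (u, g) ∈ magneticGraph hA m} := by
  refine dense_tests.mono ?_
  rintro u ⟨f, hf, hu⟩
  let g : Fin d → L2 d := fun k => (memLp_magnetic_test hA k hf (-Complex.I)).toLp _
  refine ⟨WithLp.toLp 2 (fun o => o.elim ((m : ℂ) • u) g), ?_⟩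
  refine ⟨fun k φ hφ => ?_, rfl⟩
  change ⟪_, u⟫_ℂ = ⟪_, g k⟫_ℂ
  rw [inner_toLp_conj (memLp_magnetic_test hA k hφ Complex.I), inner_toLp_conj (hφ.memLp 2)]
  set e := EuclideanSpace.single (𝕜 := ℝ) k 1 with he
  have e1 : ∫ x, u x * (Complex.I * fderiv ℝ φ x e - ((A x k : ℝ) : ℂ) * φ x) =
      ∫ x, (Complex.I * (f x * fderiv ℝ φ x e) - f x * (((A x k : ℝ) : ℂ) * φ x)) := by
    refine integral_congr_ae ?_
    filter_upwards [hu] with x hx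
    rw [hx]; ring
  have e2 : ∫ x, g k x * φ x =
      ∫ x, (-Complex.I * (fderiv ℝ f x e * φ x) - f x * (((A x k : ℝ) : ℂ) * φ x)) := by
    refine integral_congr_ae ?_
    filter_upwards [(memLp_magnetic_test hA k hf (-Complex.I)).coeFn_toLp] with x hx
    rw [hx]; ring
  have h1 := hA.memLp_mul_test k hφ
  rw [← two_eq_ofReal] at h1
  have i1 : Integrable fun x => f x * fderiv ℝ φ x e :=
    MemLp.integrable_mul (hf.memLp 2) (hφ.memLp_fderiv e 2)
  have i2 : Integrable fun x => fderiv ℝ f x e * φ x :=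
    MemLp.integrable_mul (hf.memLp_fderiv e 2) (hφ.memLp 2)
  have i3 : Integrable fun x => f x * φ x := MemLp.integrable_mul (hf.memLp 2) (hφ.memLp 2)
  have i4 : Integrable fun x => f x * (((A x k : ℝ) : ℂ) * φ x) :=
    MemLp.integrable_mul (hf.memLp 2) h1
  rw [e1, e2, integral_sub (i1.const_mul _) i4, integral_sub (i2.const_mul _) i4,
    integral_const_mul, integral_const_mul,
    integral_mul_fderiv_eq_neg_fderiv_mul_of_integrable i2 i1 i3
      (fun x _ => hf.1.differentiable (by simp) x) (fun x _ => hφ.1.differentiable (by simp) x)]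
  ring

/-- The square root of `(-i∇ - A)² + m²` exists for locally square integrable potentials. -/
theorem exists_isMagneticSqrt {A : Space d → Space d} (hA : LocLp A 2) (m : ℝ) :
    ∃ H : L2 d →ₗ.[ℂ] L2 d, IsMagneticSqrt A m H := by
  -- The component `m u`, indexed by `none`, puts the mass inside the form: `T* T` is already `(-i∇
  -- - A)² + m²`, and its root is the operator sought.
  obtain ⟨H, hH, hpos, hsq⟩ := exists_sqrt_associated (magneticGraph hA m)
    (isClosed_magneticGraph hA m) (dense_magneticGraph hA m)
  refine ⟨H, hH, fun u w huw => ?_, fun u w => ?_⟩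
  · rw [zero_mul]
    exact hpos u w huw
  · rw [hsq]
    have hsub : ∀ v : L2 d, ⟪w - ((m ^ 2 : ℝ) : ℂ) • u, v⟫_ℂ =
        ⟪w, v⟫_ℂ - (m : ℂ) ^ 2 * ⟪u, v⟫_ℂ := by
      intro v
      rw [inner_sub_left, inner_smul_left, Complex.conj_ofReal, Complex.ofReal_pow]
    have hin : ∀ (v : L2 d) (g h : PiLp 2 (fun _ : Option (Fin d) => L2 d)),
        g none = (m : ℂ) • u → h none = (m : ℂ) • v →
        ⟪g, h⟫_ℂ = (m : ℂ) ^ 2 * ⟪u, v⟫_ℂ + ∑ k, ⟪g (some k), h (some k)⟫_ℂ := by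
      intro v g h h1 h2
      rw [PiLp.inner_apply, Fintype.sum_option, h1, h2, inner_smul_left, inner_smul_right,
        Complex.conj_ofReal]
      ring
    constructor
    · rintro ⟨g, hg, hv⟩
      obtain ⟨h1, h2⟩ := (mem_magneticGraph hA m _ _).1 hg
      refine ⟨_, h1, fun v h hh => ?_⟩
      have hm' : WithLp.toLp 2 (v, (WithLp.toLp 2 (fun o => o.elim ((m : ℂ) • v) h) :
          PiLp 2 (fun _ : Option (Fin d) => L2 d))) ∈ magneticGraph hA m :=
        (mem_magneticGraph hA m _ _).2 ⟨hh, rfl⟩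
      have h3 := hv _ _ hm'
      rw [hin v _ _ h2 rfl] at h3
      dsimp only at h3 ⊢
      rw [hsub, ← h3]
      simp
    · rintro ⟨g, hg, hv⟩
      refine ⟨WithLp.toLp 2 (fun o => o.elim ((m : ℂ) • u) g),
        (mem_magneticGraph hA m _ _).2 ⟨hg, rfl⟩, fun v h hh => ?_⟩
      obtain ⟨h1, h2⟩ := (mem_magneticGraph hA m _ _).1 hh
      have h3 := hv _ _ h1
      rw [hin v _ _ rfl h2]
      dsimp only at h3 ⊢
      rw [hsub] at h3
      simp only [Option.elim_some] at h3 ⊢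
      rw [h3]
      ring

end SquareRoot

/-! ### Positivity of the truncated integral operators and the lower bound for their limit. -/

section IntegralOperatorLowerBound

variable {d : ℕ}

/-- The integrand of the truncated integral, with the phase `e^{-i y·P(x, x+y)}`. -/
def phase (P : Space d → Space d → Space d) (p : Space d × Space d) : ℂ :=
  Complex.exp (-Complex.I * ((⟪p.2, P p.1 (p.1 + p.2)⟫_ℝ : ℝ) : ℂ))

theorem norm_phase (P : Space d → Space d → Space d) (p : Space d × Space d) :
    ‖phase P p‖ = 1 := norm_exp_neg_I_mul _

theorem measurable_potential_add {P : Space d → Space d → Space d}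
    (hP : Measurable fun p : Space d × Space d => P p.1 p.2) :
    Measurable fun p : Space d × Space d => P p.1 (p.1 + p.2) :=
  hP.comp (g := fun p : Space d × Space d => P p.1 p.2)
    (f := fun p : Space d × Space d => (p.1, p.1 + p.2)) (by fun_prop)

theorem measurable_phase {P : Space d → Space d → Space d}
    (hP : Measurable fun p : Space d × Space d => P p.1 p.2) : Measurable (phase P) := by
  have h1 : Measurable fun p : Space d × Space d => ⟪p.2, P p.1 (p.1 + p.2)⟫_ℝ :=
    Measurable.inner (by fun_prop) (measurable_potential_add hP)
  have h2 := Complex.measurable_ofReal.comp h1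
  exact (h2.const_mul _).cexp

/-- Hermitian symmetry of the kernel: exchanging the endpoints `x` and `x + y` reverses the
displacement and leaves the potential unchanged. -/
theorem phase_reflect {P : Space d → Space d → Space d} (hs : ∀ x y, P x y = P y x)
    (x y : Space d) : phase P (x + y, -y) = (starRingEnd ℂ) (phase P (x, y)) := by
  simp only [phase]
  rw [← Complex.exp_conj, add_neg_cancel_right, hs (x + y) x, inner_neg_left]
  congr 1
  simp

/-- The truncated Lévy density. -/
def truncatedDensity (d : ℕ) (m r : ℝ) : Space d → ℝ :=
  {y : Space d | r ≤ ‖y‖}.indicator (levyDensity d m)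

theorem measurableSet_le_norm (r : ℝ) : MeasurableSet {y : Space d | r ≤ ‖y‖} :=
  measurableSet_le measurable_const measurable_norm

theorem truncatedDensity_nonneg {m : ℝ} (hm : 0 ≤ m) (r : ℝ) (y : Space d) :
    0 ≤ truncatedDensity d m r y :=
  Set.indicator_nonneg (fun y _ => levyDensity_nonneg hm y) y

theorem truncatedDensity_neg (m r : ℝ) (y : Space d) :
    truncatedDensity d m r (-y) = truncatedDensity d m r y := by
  by_cases h : r ≤ ‖y‖
  · rw [truncatedDensity, Set.indicator_of_mem (by simpa using h), Set.indicator_of_mem (by simpa using h),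
      levyDensity_neg]
  · rw [truncatedDensity, Set.indicator_of_notMem (by simpa using h),
      Set.indicator_of_notMem (by simpa using h)]

theorem measurable_truncatedDensity (m r : ℝ) : Measurable (truncatedDensity d m r) :=
  (measurable_levyDensity d m).indicator (measurableSet_le_norm r)

theorem integrable_truncatedDensity (hd : 1 ≤ d) {m : ℝ} (hm : 0 ≤ m) {r : ℝ} (hr : 0 < r) :
    Integrable (truncatedDensity d m r) :=
  (integrable_indicator_iff (measurableSet_le_norm r)).2 (integrableOn_levyDensity hd hm hr)

theorem truncatedIntegral_eq (P : Space d → Space d → Space d) (m r : ℝ) (f : Space d → ℂ)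
    (x : Space d) : truncatedIntegral P m r f x =
      ∫ y, (phase P (x, y) * f (x + y) - f x) * ((truncatedDensity d m r y : ℝ) : ℂ) := by
  rw [truncatedIntegral, ← integral_indicator (measurableSet_le_norm r)]
  congr 1
  ext1 y
  by_cases h : y ∈ {y : Space d | r ≤ ‖y‖}
  · rw [truncatedDensity, Set.indicator_of_mem h, Set.indicator_of_mem h]
    rfl
  · rw [truncatedDensity, Set.indicator_of_notMem h, Set.indicator_of_notMem h]
    simp

theorem aestronglyMeasurable_truncatedIntegral {P : Space d → Space d → Space d}
    (hP : Measurable fun p : Space d × Space d => P p.1 p.2) (m r : ℝ) {f : Space d → ℂ}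
    (hf : Measurable f) : AEStronglyMeasurable (truncatedIntegral P m r f) volume := by
  have h1 := measurable_phase hP
  have h2 := measurable_truncatedDensity (d := d) m r
  have h3 : StronglyMeasurable fun p : Space d × Space d =>
      (phase P p * f (p.1 + p.2) - f p.1) * ((truncatedDensity d m r p.2 : ℝ) : ℂ) := by
    apply Measurable.stronglyMeasurable
    fun_prop
  have h4 := h3.integral_prod_right' (ν := (volume : Measure (Space d)))
  have h5 : truncatedIntegral P m r f = fun x => ∫ y, (phase P (x, y) * f (x + y) - f x) *
      ((truncatedDensity d m r y : ℝ) : ℂ) := by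
    ext1 x
    exact truncatedIntegral_eq P m r f x
  rw [h5]
  exact h4.aestronglyMeasurable

/-- The exchange of endpoints, in the coordinates of base point and displacement. -/
theorem measurePreserving_reflect :
    MeasurePreserving (fun p : Space d × Space d => (p.1 + p.2, -p.2))
      (volume.prod volume) (volume.prod volume) :=
  (measurePreserving_add_prod_neg (volume : Measure (Space d))
    (volume : Measure (Space d))).comp Measure.measurePreserving_swap

theorem measurePreserving_shear :
    MeasurePreserving (fun p : Space d × Space d => (p.1 + p.2, p.2))
      (volume.prod volume) (volume.prod volume) := by
  have h : MeasurePreserving (Prod.map id Neg.neg : Space d × Space d → Space d × Space d)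
      (volume.prod volume) (volume.prod volume) :=
    (MeasurePreserving.id volume).prod (Measure.measurePreserving_neg volume)
  have := h.comp measurePreserving_reflect
  simpa [Function.comp_def, Prod.map] using this

/-- The form is `∫ N - ∫ S` with diagonal term `N` and cross term `S`, both integrable thanks to the
truncation. The exchange of endpoints sends `S` to its conjugate, so `∫ S` is real. Moreover `|S|`
is at most the mean of `N` at the two endpoints, and each of these integrates to `∫ N`. -/
theorem truncated_form_nonneg (hd : 1 ≤ d) {m : ℝ} (hm : 0 ≤ m) {P : Space d → Space d → Space d}
    (hP : Measurable fun p : Space d × Space d => P p.1 p.2) (hs : ∀ x y, P x y = P y x)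
    {f : Space d → ℂ} (hf : IsTest f) {r : ℝ} (hr : 0 < r) :
    (∫ x, (starRingEnd ℂ) (f x) * -truncatedIntegral P m r f x).im = 0 ∧
      0 ≤ (∫ x, (starRingEnd ℂ) (f x) * -truncatedIntegral P m r f x).re := by
  obtain ⟨M, -, -, hM0, -, -, hM, -, -⟩ := hf.exists_bounds
  have hfm : Measurable f := hf.1.continuous.measurable
  set n := truncatedDensity d m r with hn
  have hni : Integrable n := integrable_truncatedDensity hd hm hr
  have hn0 : ∀ y, 0 ≤ n y := truncatedDensity_nonneg hm r
  have hnm : Measurable n := measurable_truncatedDensity m r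
  have hphm := measurable_phase hP
  have hfi : Integrable f := memLp_one_iff_integrable.1 (hf.memLp 1)
  have hf2 : Integrable fun x => ‖f x‖ ^ 2 := (hf.memLp 2).integrable_norm_pow (by norm_num)
  let S : Space d × Space d → ℂ := fun p =>
    (starRingEnd ℂ) (f p.1) * phase P p * f (p.1 + p.2) * ((n p.2 : ℝ) : ℂ)
  let N : Space d × Space d → ℝ := fun p => ‖f p.1‖ ^ 2 * n p.2
  have hconj : Measurable fun p : Space d × Space d => (starRingEnd ℂ) (f p.1) :=
    Complex.continuous_conj.measurable.comp (hfm.comp measurable_fst)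
  have hSm : Measurable S := by
    refine Measurable.mul (Measurable.mul (hconj.mul hphm) ?_) ?_ <;> fun_prop
  have hNi : Integrable N (volume.prod volume) := hf2.mul_prod hni
  have hSi : Integrable S (volume.prod volume) := by
    refine Integrable.mono' ((hfi.norm.mul_prod hni).const_mul M) hSm.aestronglyMeasurable
      (ae_of_all _ fun p => ?_)
    simp only [S, norm_mul, RCLike.norm_conj, norm_phase, mul_one, Complex.norm_real,
      Real.norm_of_nonneg (hn0 p.2)]
    calc ‖f p.1‖ * ‖f (p.1 + p.2)‖ * n p.2 ≤ ‖f p.1‖ * M * n p.2 := by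
          gcongr
          · exact hn0 _
          · exact hM _
      _ = _ := by ring
  have hQ : ∫ x, (starRingEnd ℂ) (f x) * -truncatedIntegral P m r f x =
      ((∫ p, N p ∂(volume.prod volume) : ℝ) : ℂ) - ∫ p, S p ∂(volume.prod volume) := by
    have hNi' : Integrable (fun p => ((N p : ℝ) : ℂ)) (volume.prod volume) := hNi.ofReal
    rw [← integral_complex_ofReal, ← integral_sub hNi' hSi,
      integral_prod (fun a => ((N a : ℝ) : ℂ) - S a) (hNi'.sub hSi)]
    congr 1
    ext1 x
    rw [truncatedIntegral_eq, ← integral_neg, ← integral_const_mul]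
    congr 1
    ext1 y
    simp only [N, S]
    have h1 : ((‖f x‖ ^ 2 * n y : ℝ) : ℂ) = (starRingEnd ℂ) (f x) * f x * ((n y : ℝ) : ℂ) := by
      rw [Complex.conj_mul']
      push_cast
      rfl
    rw [h1]
    ring
  have him : (∫ p, S p ∂(volume.prod volume)).im = 0 := by
    have h1 : ∫ p, S p ∂(volume.prod volume) =
        ∫ p : Space d × Space d, (starRingEnd ℂ) (S p) ∂(volume.prod volume) := by
      conv_lhs => rw [← measurePreserving_reflect.map_eq]
      rw [integral_map measurePreserving_reflect.aemeasurable hSm.aestronglyMeasurable]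
      congr 1
      ext1 p
      simp only [S, map_mul, Complex.conj_conj, Complex.conj_ofReal]
      rw [phase_reflect hs, add_neg_cancel_right, hn, truncatedDensity_neg]
      ring
    rw [integral_conj] at h1
    have h2 := congrArg Complex.im h1
    rw [Complex.conj_im] at h2
    linarith
  have hre : (∫ p, S p ∂(volume.prod volume)).re ≤ ∫ p, N p ∂(volume.prod volume) := by
    have hN2 : ∫ p : Space d × Space d, N (p.1 + p.2, p.2) ∂(volume.prod volume) =
        ∫ p, N p ∂(volume.prod volume) := by
      conv_rhs => rw [← measurePreserving_shear.map_eq]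
      rw [integral_map measurePreserving_shear.aemeasurable]
      rw [measurePreserving_shear.map_eq]
      exact hNi.aestronglyMeasurable
    have hN2i : Integrable (fun p : Space d × Space d => N (p.1 + p.2, p.2))
        (volume.prod volume) := measurePreserving_shear.integrable_comp_of_integrable hNi
    calc (∫ p, S p ∂(volume.prod volume)).re ≤ ‖∫ p, S p ∂(volume.prod volume)‖ :=
          Complex.re_le_norm _
      _ ≤ ∫ p : Space d × Space d, (1 / 2 * N p + 1 / 2 * N (p.1 + p.2, p.2))
            ∂(volume.prod volume) := by
          refine norm_integral_le_of_norm_le ((hNi.const_mul _).add (hN2i.const_mul _))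
            (ae_of_all _ fun p => ?_)
          simp only [S, N, norm_mul, RCLike.norm_conj, norm_phase, mul_one, Complex.norm_real,
            Real.norm_of_nonneg (hn0 p.2)]
          have := hn0 p.2
          nlinarith [mul_nonneg (sq_nonneg (‖f p.1‖ - ‖f (p.1 + p.2)‖)) this]
      _ = _ := by
          rw [integral_add (hNi.const_mul _) (hN2i.const_mul _), integral_const_mul,
            integral_const_mul, hN2]
          ring
  rw [hQ]
  simp only [Complex.sub_im, Complex.sub_re, Complex.ofReal_im, Complex.ofReal_re, him]
  exact ⟨by ring, by linarith⟩

/-- Pairing with the fixed `f` is continuous in `L²`, so reality and nonnegativity of the truncated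
forms pass to the limit `w - m u`. -/
theorem integralOperator_lower_bound (hd : 1 ≤ d) {m : ℝ} (hm : 0 ≤ m)
    {P : Space d → Space d → Space d}
    (hP : Measurable fun p : Space d × Space d => P p.1 p.2) (hs : ∀ x y, P x y = P y x) :
    BoundedBelow (integralOperator P m) m := by
  rintro u w ⟨f, hf, hu, hlim⟩
  dsimp only at hu hlim
  have hfm : Measurable f := hf.1.continuous.measurable
  set v : L2 d := w - (m : ℂ) • u with hv
  have hva : v =ᵐ[volume] fun x => w x - (m : ℂ) * f x := by
    filter_upwards [Lp.coeFn_sub w ((m : ℂ) • u), Lp.coeFn_smul (m : ℂ) u, hu] with x h1 h2 h3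
    rw [h1, Pi.sub_apply, h2, Pi.smul_apply, h3, smul_eq_mul]
  have hT : ∀ r, AEStronglyMeasurable
      (fun x => -truncatedIntegral P m r f x - (w x - (m : ℂ) * f x)) volume := by
    intro r
    refine (aestronglyMeasurable_truncatedIntegral hP m r hfm).neg.sub ?_
    exact (Lp.aestronglyMeasurable w).sub (hfm.aestronglyMeasurable.const_mul _)
  have hkey : Tendsto (fun r => ∫ x, (starRingEnd ℂ) (f x) * -truncatedIntegral P m r f x)
      (𝓝[>] 0) (𝓝 ⟪u, v⟫_ℂ) := by
    -- Convergence to zero of the extended norm makes it eventually finite, so the differences are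
    -- elements of `L²` for small `r`.
    have hfin : ∀ᶠ r in 𝓝[>] (0 : ℝ), eLpNorm
        (fun x => -truncatedIntegral P m r f x - (w x - (m : ℂ) * f x)) 2 volume < ⊤ :=
      hlim.eventually_lt_const ENNReal.zero_lt_top
    rw [tendsto_iff_norm_sub_tendsto_zero]
    have hlim' : Tendsto (fun r : ℝ => ‖u‖ * (eLpNorm
        (fun x => -truncatedIntegral P m r f x - (w x - (m : ℂ) * f x)) 2 volume).toReal)
        (𝓝[>] 0) (𝓝 0) := by
      have h1 := (ENNReal.tendsto_toReal (ENNReal.zero_ne_top)).comp hlim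
      have h2 := h1.const_mul ‖u‖
      simpa [Function.comp_def] using h2
    refine squeeze_zero' (Eventually.of_forall fun r => norm_nonneg _) ?_ hlim'
    filter_upwards [hfin] with r hr
    have hmem : MemLp (fun x => -truncatedIntegral P m r f x - (w x - (m : ℂ) * f x)) 2 volume :=
      ⟨hT r, hr⟩
    set z : L2 d := hmem.toLp _ with hz
    have h1 : ∫ x, (starRingEnd ℂ) (f x) * -truncatedIntegral P m r f x = ⟪u, z + v⟫_ℂ := by
      rw [L2.inner_def]
      refine integral_congr_ae ?_
      filter_upwards [hu, hva, Lp.coeFn_add z v, hmem.coeFn_toLp] with x h1 h2 h3 h4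
      rw [h3, Pi.add_apply, h2, h4, h1, RCLike.inner_apply]
      ring
    rw [h1, inner_add_right, add_sub_cancel_right]
    refine (norm_inner_le_norm u z).trans (le_of_eq ?_)
    rw [hz, Lp.norm_toLp]
  have hpos : ∀ᶠ r in 𝓝[>] (0 : ℝ),
      (∫ x, (starRingEnd ℂ) (f x) * -truncatedIntegral P m r f x) ∈
        {c : ℂ | c.im = 0 ∧ 0 ≤ c.re} := by
    filter_upwards [self_mem_nhdsWithin] with r hr
    exact truncated_form_nonneg hd hm hP hs hf hr
  have hcl : IsClosed {c : ℂ | c.im = 0 ∧ 0 ≤ c.re} :=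
    (isClosed_eq Complex.continuous_im continuous_const).inter
      (isClosed_le continuous_const Complex.continuous_re)
  have h1 : (⟪u, v⟫_ℂ).im = 0 ∧ 0 ≤ (⟪u, v⟫_ℂ).re := hcl.mem_of_tendsto hkey hpos
  have h2 : ⟪u, u⟫_ℂ = ((‖u‖ ^ 2 : ℝ) : ℂ) := by
    rw [inner_self_eq_norm_sq_to_K]; norm_cast
  rw [hv, inner_sub_right, inner_smul_right, h2, ← Complex.ofReal_mul, Complex.sub_im,
    Complex.sub_re, Complex.ofReal_re, Complex.ofReal_im, sub_zero, sub_nonneg] at h1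
  exact h1

theorem BoundedBelow.closure {G : Set (L2 d × L2 d)} {c : ℝ} (h : BoundedBelow G c) :
    BoundedBelow (closure G) c := by
  have hcl : IsClosed {q : L2 d × L2 d | (⟪q.1, q.2⟫_ℂ).im = 0 ∧
      c * ‖q.1‖ ^ 2 ≤ (⟪q.1, q.2⟫_ℂ).re} := by
    have h0 : Continuous fun q : L2 d × L2 d => c * ‖q.1‖ ^ 2 := by fun_prop
    refine (isClosed_eq ?_ continuous_const).inter (isClosed_le h0 ?_)
    · exact Complex.continuous_im.comp (continuous_fst.inner continuous_snd)
    · exact Complex.continuous_re.comp (continuous_fst.inner continuous_snd)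
  intro u w huw
  exact closure_minimal (fun q hq => h q.1 q.2 hq) hcl huw

end IntegralOperatorLowerBound

/-! ### Uniform bounds for truncated sine transforms of an odd kernel of degree `-d`. -/

section Multiplier

variable {d : ℕ}

/-- Integration by parts leaves boundary terms of size `1/x` and `1/y` and an integral of size `1/x
- 1/y`, in total at most `2/x`. -/
theorem abs_integral_sin_div_le_of_one_le {x y : ℝ} (hx : 1 ≤ x) (hxy : x ≤ y) :
    |∫ t in x..y, Real.sin t / t| ≤ 2 := by
  have hpos : ∀ t ∈ Set.uIcc x y, 0 < t := fun t ht => by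
    rw [Set.uIcc_of_le hxy] at ht
    linarith [ht.1]
  have h1 : ∀ t ∈ Set.uIcc x y, HasDerivAt (fun t : ℝ => -Real.cos t / t)
      (Real.sin t / t + Real.cos t / t ^ 2) t := by
    intro t ht
    have h0 := (hpos t ht).ne'
    refine HasDerivAt.congr_deriv
      (((Real.hasDerivAt_cos t).fun_neg).fun_div (hasDerivAt_id' t) h0) ?_
    field_simp
    ring
  have h2 : ∀ t ∈ Set.uIcc x y, HasDerivAt (fun t : ℝ => -t⁻¹) (1 / t ^ 2) t := by
    intro t ht
    have h0 := (hpos t ht).ne'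
    refine HasDerivAt.congr_deriv (hasDerivAt_inv h0).fun_neg ?_
    field_simp
  have c1 : ContinuousOn (fun t : ℝ => Real.sin t / t) (Set.uIcc x y) :=
    ContinuousOn.div (by fun_prop) (by fun_prop) fun t ht => (hpos t ht).ne'
  have c2 : ContinuousOn (fun t : ℝ => Real.cos t / t ^ 2) (Set.uIcc x y) :=
    ContinuousOn.div (by fun_prop) (by fun_prop) fun t ht => (pow_pos (hpos t ht) 2).ne'
  have c3 : ContinuousOn (fun t : ℝ => 1 / t ^ 2) (Set.uIcc x y) :=
    ContinuousOn.div (by fun_prop) (by fun_prop) fun t ht => (pow_pos (hpos t ht) 2).ne'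
  have e1 := intervalIntegral.integral_eq_sub_of_hasDerivAt h1
    (c1.intervalIntegrable.add c2.intervalIntegrable)
  have e2 := intervalIntegral.integral_eq_sub_of_hasDerivAt h2 c3.intervalIntegrable
  rw [intervalIntegral.integral_add c1.intervalIntegrable c2.intervalIntegrable] at e1
  have h3 : |∫ t in x..y, Real.cos t / t ^ 2| ≤ ∫ t in x..y, 1 / t ^ 2 := by
    rw [← Real.norm_eq_abs]
    refine intervalIntegral.norm_integral_le_of_norm_le hxy (ae_of_all _ fun t _ => ?_)
      c3.intervalIntegrable
    rw [norm_div, Real.norm_eq_abs, Real.norm_of_nonneg (sq_nonneg t)]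
    gcongr
    exact Real.abs_cos_le_one t
  have hx0 : 0 < x := by linarith
  have hy0 : 0 < y := by linarith
  have h4 : |(-Real.cos y / y)| ≤ y⁻¹ := by
    rw [abs_div, abs_neg, abs_of_pos hy0, div_eq_mul_inv]
    exact mul_le_of_le_one_left (by positivity) (Real.abs_cos_le_one y)
  have h5 : |(-Real.cos x / x)| ≤ x⁻¹ := by
    rw [abs_div, abs_neg, abs_of_pos hx0, div_eq_mul_inv]
    exact mul_le_of_le_one_left (by positivity) (Real.abs_cos_le_one x)
  have h6 : x⁻¹ ≤ 1 := inv_le_one_of_one_le₀ hx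
  rw [abs_le] at h3 h4 h5 ⊢
  constructor <;> linarith [h3.1, h3.2, h4.1, h4.2, h5.1, h5.2]

theorem abs_sin_div_le_one (t : ℝ) : |Real.sin t / t| ≤ 1 := by
  rw [abs_div]
  exact div_le_one_of_le₀ Real.abs_sin_le_abs (abs_nonneg t)

/-- The part below `1` contributes at most `1`, the part above at most `2`. -/
theorem abs_integral_sin_div_le {x y : ℝ} (hx : 0 < x) (hxy : x ≤ y) :
    |∫ t in x..y, Real.sin t / t| ≤ 3 := by
  have small : ∀ z, x ≤ z → z ≤ 1 → |∫ t in x..z, Real.sin t / t| ≤ 1 := by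
    intro z hxz hz
    have := intervalIntegral.norm_integral_le_of_norm_le_const (a := x) (b := z) (C := 1)
      (f := fun t => Real.sin t / t) (fun t _ => abs_sin_div_le_one t)
    rw [one_mul, Real.norm_eq_abs, abs_of_nonneg (by linarith : 0 ≤ z - x)] at this
    linarith
  rcases le_total y 1 with hy | hy
  · linarith [small y hxy hy]
  rcases le_total 1 x with hx1 | hx1
  · linarith [abs_integral_sin_div_le_of_one_le hx1 hxy]
  have hi : ∀ a b : ℝ, 0 < a → a ≤ b →
      IntervalIntegrable (fun t : ℝ => Real.sin t / t) volume a b := by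
    intro a b ha hab
    refine ContinuousOn.intervalIntegrable (ContinuousOn.div (by fun_prop) (by fun_prop) ?_)
    intro t ht
    rw [Set.uIcc_of_le hab] at ht
    linarith [ht.1]
  rw [← intervalIntegral.integral_add_adjacent_intervals (hi x 1 hx hx1) (hi 1 y one_pos hy)]
  have h1 := small 1 hx1 le_rfl
  have h2 := abs_integral_sin_div_le_of_one_le le_rfl hy
  exact (abs_add_le _ _).trans (by linarith)

/-- The measure `dρ/ρ` is invariant under scaling, which removes the frequency `a` and makes the
bound uniform. -/
theorem abs_integral_sin_mul_div_le (a : ℝ) {r : ℝ} (hr : 0 < r) (hr1 : r ≤ 1) :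
    |∫ ρ in r..1, Real.sin (a * ρ) / ρ| ≤ 3 := by
  have pos : ∀ a : ℝ, 0 < a → |∫ ρ in r..1, Real.sin (a * ρ) / ρ| ≤ 3 := by
    intro a ha
    have h1 := intervalIntegral.integral_comp_mul_left (a := r) (b := 1)
      (fun t => Real.sin t / t) ha.ne'
    have h2 : ∫ ρ in r..1, Real.sin (a * ρ) / ρ =
        a * ∫ ρ in r..1, Real.sin (a * ρ) / (a * ρ) := by
      rw [← intervalIntegral.integral_const_mul]
      congr 1
      ext1 ρ
      rcases eq_or_ne ρ 0 with rfl | hρ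
      · simp
      · field_simp
    rw [h2, h1, smul_eq_mul, mul_inv_cancel_left₀ ha.ne']
    refine abs_integral_sin_div_le (by positivity) ?_
    gcongr
  rcases lt_trichotomy a 0 with ha | rfl | ha
  · have := pos (-a) (by linarith)
    simp only [neg_mul, Real.sin_neg, neg_div, intervalIntegral.integral_neg, abs_neg] at this
    exact this
  · simp
  · exact pos a ha

/-- Integration in polar coordinates. -/
theorem integral_polar (hd : 1 ≤ d) {F : Space d → ℝ} (hF : Integrable F) :
    ∫ y, F y = ∫ σ : Metric.sphere (0 : Space d) 1,
      (∫ ρ in Set.Ioi (0 : ℝ), ρ ^ (d - 1) * F (ρ • (σ : Space d)))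
        ∂(volume : Measure (Space d)).toSphere := by
  have : Nontrivial (Space d) := by
    have : Nonempty (Fin d) := ⟨⟨0, hd⟩⟩
    infer_instance
  have hfr : Module.finrank ℝ (Space d) = d := by simp
  have hmp := (volume : Measure (Space d)).measurePreserving_homeomorphUnitSphereProd
  have hemb := (homeomorphUnitSphereProd (Space d)).measurableEmbedding
  have hms : MeasurableSet ({(0 : Space d)}ᶜ : Set (Space d)) := (measurableSet_singleton _).compl
  let g : Metric.sphere (0 : Space d) 1 × Set.Ioi (0 : ℝ) → ℝ := fun q => F (q.2.1 • q.1.1)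
  have hg : ∀ x : ({(0 : Space d)}ᶜ : Set (Space d)),
      g (homeomorphUnitSphereProd (Space d) x) = F x := by
    intro x
    have hx : ‖(x : Space d)‖ ≠ 0 := norm_ne_zero_iff.2 x.2
    simp only [g, homeomorphUnitSphereProd_apply_snd_coe, homeomorphUnitSphereProd_apply_fst_coe]
    rw [smul_smul, mul_inv_cancel₀ hx, one_smul]
  have e1 : ∫ y, F y = ∫ x : ({(0 : Space d)}ᶜ : Set (Space d)), F x ∂((volume : Measure (Space d)).comap Subtype.val) := by
    rw [integral_subtype_comap hms F, restrict_compl_singleton]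
  have e2 : ∫ x : ({(0 : Space d)}ᶜ : Set (Space d)), F x ∂((volume : Measure (Space d)).comap Subtype.val) =
      ∫ q, g q ∂((volume : Measure (Space d)).toSphere.prod (Measure.volumeIoiPow (d - 1))) := by
    have := hmp.integral_comp hemb g
    rw [hfr] at this
    rw [← this]
    exact integral_congr_ae (ae_of_all _ fun x => (hg x).symm)
  have hgi : Integrable g ((volume : Measure (Space d)).toSphere.prod
      (Measure.volumeIoiPow (d - 1))) := by
    have h1 := hmp.integrable_comp_emb hemb (g := g)
    rw [hfr] at h1
    rw [← h1]
    have h2 : Integrable (fun x : ({(0 : Space d)}ᶜ : Set (Space d)) => F x)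
        ((volume : Measure (Space d)).comap Subtype.val) := by
      have h3 := (integrableOn_iff_comap_subtypeVal hms (f := F) (μ := volume)).1 hF.integrableOn
      exact h3
    exact h2.congr (ae_of_all _ fun x => (hg x).symm)
  rw [e1, e2, integral_prod _ hgi]
  congr 1
  ext1 σ
  simp only [Measure.volumeIoiPow, ENNReal.ofReal, g]
  rw [integral_withDensity_eq_integral_smul (measurable_subtype_coe.pow_const _).real_toNNReal,
    integral_subtype_comap measurableSet_Ioi
      fun a : ℝ => Real.toNNReal (a ^ (d - 1)) • F (a • (σ : Space d))]
  refine setIntegral_congr_fun measurableSet_Ioi fun ρ hρ => ?_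
  rw [NNReal.smul_def, Real.coe_toNNReal _ (pow_nonneg (le_of_lt hρ) _), smul_eq_mul]

/-- The annulus `r ≤ |y| < 1`. -/
def annulus (d : ℕ) (r : ℝ) : Set (Space d) := {y | r ≤ ‖y‖ ∧ ‖y‖ < 1}

theorem measurableSet_annulus (r : ℝ) : MeasurableSet (annulus d r) :=
  (measurableSet_le measurable_const measurable_norm).inter
    (measurableSet_lt measurable_norm measurable_const)

/-- The odd kernel `y_j / |y|^{d+1}` cut off to the annulus. -/
def rieszKernel (j : Fin d) (r : ℝ) : Space d → ℝ :=
  (annulus d r).indicator fun y => y j / ‖y‖ ^ (d + 1)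

theorem measurable_rieszKernel (j : Fin d) (r : ℝ) : Measurable (rieszKernel j r) := by
  refine Measurable.indicator ?_ (measurableSet_annulus r)
  fun_prop

theorem abs_div_norm_pow_le (j : Fin d) (y : Space d) :
    |y j / ‖y‖ ^ (d + 1)| ≤ ‖y‖ / ‖y‖ ^ (d + 1) := by
  rw [abs_div, abs_of_nonneg (by positivity : (0 : ℝ) ≤ ‖y‖ ^ (d + 1))]
  gcongr
  exact PiLp.norm_apply_le y j

theorem integrable_rieszKernel (j : Fin d) {r : ℝ} (hr : 0 < r) :
    Integrable (rieszKernel j r) := by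
  rw [rieszKernel, integrable_indicator_iff (measurableSet_annulus r)]
  refine Integrable.mono' ((integrableOn_inv_norm_pow hr).mono_set
    (fun y (hy : r ≤ ‖y‖ ∧ ‖y‖ < 1) => hy.1))
    (Measurable.aestronglyMeasurable (by fun_prop)) ?_
  refine (ae_restrict_iff' (measurableSet_annulus r)).2 (ae_of_all _ fun y hy => ?_)
  refine (abs_div_norm_pow_le j y).trans ?_
  gcongr
  exact hy.2.le

theorem rieszKernel_neg (j : Fin d) (r : ℝ) (y : Space d) :
    rieszKernel j r (-y) = -rieszKernel j r y := by
  by_cases h : y ∈ annulus d r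
  · have h' : -y ∈ annulus d r := by simpa [annulus] using h
    rw [rieszKernel, Set.indicator_of_mem h, Set.indicator_of_mem h', norm_neg]
    simp [neg_div]
  · have h' : -y ∉ annulus d r := by simpa [annulus] using h
    rw [rieszKernel, Set.indicator_of_notMem h, Set.indicator_of_notMem h', neg_zero]

/-- The sine transform of the truncated kernel is bounded uniformly in the truncation. -/
theorem exists_abs_integral_rieszKernel_le (hd : 1 ≤ d) (j : Fin d) :
    ∃ C : ℝ, 0 ≤ C ∧ ∀ (r : ℝ) (η : Space d), 0 < r → r ≤ 1 →
      |∫ y, rieszKernel j r y * Real.sin ⟪y, η⟫_ℝ| ≤ C := by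
  refine ⟨3 * (volume : Measure (Space d)).toSphere.real Set.univ, by positivity,
    fun r η hr hr1 => ?_⟩
  have hi : Integrable fun y => rieszKernel j r y * Real.sin ⟪y, η⟫_ℝ := by
    refine (integrable_rieszKernel j hr).mul_bdd (c := 1)
      (Continuous.aestronglyMeasurable (by fun_prop)) (ae_of_all _ fun y => ?_)
    exact Real.abs_sin_le_one _
  rw [integral_polar hd hi, ← Real.norm_eq_abs]
  refine (norm_integral_le_of_norm_le_const (C := 3) (ae_of_all _ fun σ => ?_))
  have hσ : ‖(σ : Space d)‖ = 1 := norm_eq_of_mem_sphere σ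
  -- The Jacobian `ρ^{d-1}` against a kernel homogeneous of degree `-d` leaves `dρ/ρ`. Along each
  -- ray this is a sine integral of frequency `⟪σ, η⟫`, at most `3` for every frequency and
  -- truncation.
  have e1 : ∫ ρ in Set.Ioi (0 : ℝ), ρ ^ (d - 1) *
      (rieszKernel j r (ρ • (σ : Space d)) * Real.sin ⟪ρ • (σ : Space d), η⟫_ℝ) =
      (σ : Space d) j * ∫ ρ in r..1, Real.sin (⟪(σ : Space d), η⟫_ℝ * ρ) / ρ := by
    rw [intervalIntegral.integral_of_le hr1, ← integral_Ico_eq_integral_Ioc,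
      ← integral_const_mul, ← integral_indicator measurableSet_Ioi,
      ← integral_indicator measurableSet_Ico]
    congr 1
    ext1 ρ
    by_cases hρ : ρ ∈ Set.Ico r 1
    · have hρ0 : 0 < ρ := hr.trans_le hρ.1
      have hn : ‖ρ • (σ : Space d)‖ = ρ := by
        rw [norm_smul, hσ, mul_one, Real.norm_of_nonneg hρ0.le]
      have hmem : ρ • (σ : Space d) ∈ annulus d r := by
        change r ≤ ‖ρ • (σ : Space d)‖ ∧ ‖ρ • (σ : Space d)‖ < 1
        rw [hn]
        exact hρ
      rw [Set.indicator_of_mem hρ, Set.indicator_of_mem (Set.mem_Ioi.2 hρ0), rieszKernel,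
        Set.indicator_of_mem hmem, hn, real_inner_smul_left, PiLp.smul_apply, smul_eq_mul,
        mul_comm ρ ⟪_, _⟫_ℝ]
      have e : ρ ^ (d + 1) = ρ ^ (d - 1) * ρ ^ 2 := by
        rw [← pow_add]
        congr 1
        omega
      rw [e]
      field_simp
    · rw [Set.indicator_of_notMem hρ]
      by_cases hρ0 : ρ ∈ Set.Ioi (0 : ℝ)
      · have hn : ‖ρ • (σ : Space d)‖ = ρ := by
          rw [norm_smul, hσ, mul_one, Real.norm_of_nonneg (le_of_lt hρ0)]
        have hmem : ρ • (σ : Space d) ∉ annulus d r := by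
          intro h
          change r ≤ ‖ρ • (σ : Space d)‖ ∧ ‖ρ • (σ : Space d)‖ < 1 at h
          rw [hn] at h
          exact hρ h
        rw [Set.indicator_of_mem hρ0, rieszKernel, Set.indicator_of_notMem hmem, zero_mul, mul_zero]
      · rw [Set.indicator_of_notMem hρ0]
  rw [e1, norm_mul]
  have h1 : ‖(σ : Space d) j‖ ≤ 1 := (PiLp.norm_apply_le (σ : Space d) j).trans hσ.le
  have h2 := abs_integral_sin_mul_div_le ⟪(σ : Space d), η⟫_ℝ hr hr1
  rw [← Real.norm_eq_abs] at h2
  calc _ ≤ 1 * (3 : ℝ) := by gcongr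
    _ = 3 := one_mul 3

end Multiplier

/-! ### Minkowski's integral inequality for kernels with a product majorant. -/

section Minkowski

variable {X W : Type*} [MeasurableSpace X] [MeasurableSpace W]

/-- The Cauchy-Schwarz inequality with a weight. -/
theorem lintegral_mul_sq_le {ν : Measure W} {κ b : W → ENNReal} (hκ : AEMeasurable κ ν)
    (hb : AEMeasurable b ν) :
    (∫⁻ w, κ w * b w ∂ν) ^ 2 ≤ (∫⁻ w, κ w ∂ν) * ∫⁻ w, κ w * b w ^ 2 ∂ν := by
  have h := ENNReal.lintegral_mul_le_Lp_mul_Lq ν Real.HolderConjugate.two_two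
    (f := fun w => κ w ^ (1 / 2 : ℝ)) (g := fun w => κ w ^ (1 / 2 : ℝ) * b w)
    (hκ.pow_const _) ((hκ.pow_const _).mul hb)
  have e0 : ∀ a : ENNReal, a ^ (1 / 2 : ℝ) * a ^ (1 / 2 : ℝ) = a := by
    intro a
    rw [← ENNReal.rpow_add_of_nonneg _ _ (by norm_num) (by norm_num)]
    norm_num
  have e0' : ∀ a : ENNReal, (a ^ (1 / 2 : ℝ)) ^ (2 : ℝ) = a := by
    intro a
    rw [← ENNReal.rpow_mul]
    norm_num
  have e1 : ∀ w, ((fun w => κ w ^ (1 / 2 : ℝ)) * fun w => κ w ^ (1 / 2 : ℝ) * b w) w =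
      κ w * b w := by
    intro w
    rw [Pi.mul_apply, ← mul_assoc, e0]
  have e3 : ∀ w, (κ w ^ (1 / 2 : ℝ) * b w) ^ (2 : ℝ) = κ w * b w ^ 2 := by
    intro w
    rw [ENNReal.mul_rpow_of_nonneg _ _ (by norm_num), e0', ENNReal.rpow_two]
  simp only [e1, e3, e0'] at h
  calc (∫⁻ w, κ w * b w ∂ν) ^ 2 ≤ _ := pow_le_pow_left₀ zero_le h 2
    _ = _ := by
      rw [← ENNReal.rpow_two, ENNReal.mul_rpow_of_nonneg _ _ (by norm_num), e0', e0']

/-- A form of Minkowski's integral inequality. -/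
theorem lintegral_sq_lintegral_le {ρ : Measure X} {ν : Measure W} [SFinite ρ] [SFinite ν]
    {κ : W → ENNReal} {b : X → W → ENNReal} (hκ : Measurable κ)
    (hb : Measurable (Function.uncurry b)) {B : ENNReal}
    (hB : ∀ᵐ w ∂ν, ∫⁻ x, b x w ^ 2 ∂ρ ≤ B) :
    ∫⁻ x, (∫⁻ w, κ w * b x w ∂ν) ^ 2 ∂ρ ≤ B * (∫⁻ w, κ w ∂ν) ^ 2 := by
  have hb1 : ∀ x, Measurable (b x) := fun x => hb.comp measurable_prodMk_left
  have hb2 : ∀ w, Measurable fun x => b x w := fun w => hb.comp measurable_prodMk_right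
  calc ∫⁻ x, (∫⁻ w, κ w * b x w ∂ν) ^ 2 ∂ρ
      ≤ ∫⁻ x, (∫⁻ w, κ w ∂ν) * ∫⁻ w, κ w * b x w ^ 2 ∂ν ∂ρ :=
        lintegral_mono fun x => lintegral_mul_sq_le hκ.aemeasurable (hb1 x).aemeasurable
    _ = (∫⁻ w, κ w ∂ν) * ∫⁻ x, ∫⁻ w, κ w * b x w ^ 2 ∂ν ∂ρ := by
        rw [lintegral_const_mul]
        have : Measurable fun p : X × W => κ p.2 * b p.1 p.2 ^ 2 :=
          (hκ.comp measurable_snd).mul (hb.pow_const 2)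
        exact this.lintegral_prod_right'
    _ = (∫⁻ w, κ w ∂ν) * ∫⁻ w, κ w * ∫⁻ x, b x w ^ 2 ∂ρ ∂ν := by
        rw [lintegral_lintegral_swap]
        · congr 1
          refine lintegral_congr fun w => ?_
          rw [lintegral_const_mul _ ((hb2 w).pow_const 2)]
        · exact ((hκ.comp measurable_snd).mul (hb.pow_const 2)).aemeasurable
    _ ≤ (∫⁻ w, κ w ∂ν) * ∫⁻ w, κ w * B ∂ν := by
        refine mul_le_mul_right (lintegral_mono_ae ?_) _
        filter_upwards [hB] with w hw
        gcongr
    _ = _ := by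
        rw [lintegral_mul_const _ hκ]
        ring

/-- The common source of the `L²` estimates for averages of translates, for the absolutely
convergent remainder, and for the truncated integral away from the diagonal. -/
theorem eLpNorm_integral_le {ρ : Measure X} {ν : Measure W} [SFinite ρ] [SFinite ν]
    {κ : W → ENNReal} {b : X → W → ENNReal} (hκ : Measurable κ)
    (hb : Measurable (Function.uncurry b)) {B : ENNReal}
    (hB : ∀ᵐ w ∂ν, ∫⁻ x, b x w ^ 2 ∂ρ ≤ B) {D : X → W → ℂ}
    (hD : ∀ᵐ x ∂ρ, ∀ᵐ w ∂ν, ‖D x w‖ₑ ≤ κ w * b x w) :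
    eLpNorm (fun x => ∫ w, D x w ∂ν) 2 ρ ≤ B ^ (1 / 2 : ℝ) * ∫⁻ w, κ w ∂ν := by
  rw [eLpNorm_eq_lintegral_rpow_enorm_toReal (by simp) (by simp)]
  simp only [ENNReal.toReal_ofNat]
  have h1 : ∫⁻ x, ‖∫ w, D x w ∂ν‖ₑ ^ (2 : ℝ) ∂ρ ≤ B * (∫⁻ w, κ w ∂ν) ^ 2 := by
    refine le_trans ?_ (lintegral_sq_lintegral_le hκ hb hB)
    refine lintegral_mono_ae ?_
    filter_upwards [hD] with x hx
    rw [ENNReal.rpow_two]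
    gcongr
    exact (enorm_integral_le_lintegral_enorm _).trans (lintegral_mono_ae hx)
  calc _ ≤ (B * (∫⁻ w, κ w ∂ν) ^ 2) ^ (1 / 2 : ℝ) := ENNReal.rpow_le_rpow h1 (by norm_num)
    _ = _ := by
      rw [ENNReal.mul_rpow_of_nonneg _ _ (by norm_num), ← ENNReal.rpow_two, ← ENNReal.rpow_mul]
      norm_num

/-- Almost every section is integrable. -/
theorem ae_integrable_of_le {ρ : Measure X} {ν : Measure W} [SFinite ρ] [SFinite ν]
    {κ : W → ENNReal} {b : X → W → ENNReal} (hκ : Measurable κ)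
    (hb : Measurable (Function.uncurry b)) {B : ENNReal} (hBt : B < ⊤)
    (hκt : ∫⁻ w, κ w ∂ν < ⊤)
    (hB : ∀ᵐ w ∂ν, ∫⁻ x, b x w ^ 2 ∂ρ ≤ B) {D : X → W → ℂ}
    (hDm : Measurable (Function.uncurry D))
    (hD : ∀ᵐ x ∂ρ, ∀ᵐ w ∂ν, ‖D x w‖ₑ ≤ κ w * b x w) :
    ∀ᵐ x ∂ρ, Integrable (D x) ν := by
  have h1 := lintegral_sq_lintegral_le hκ hb hB
  have hm : Measurable fun x => (∫⁻ w, κ w * b x w ∂ν) ^ 2 := by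
    have : Measurable fun p : X × W => κ p.2 * b p.1 p.2 := (hκ.comp measurable_snd).mul hb
    exact this.lintegral_prod_right'.pow_const 2
  have h2 := ae_lt_top hm (h1.trans_lt (ENNReal.mul_lt_top hBt (ENNReal.pow_lt_top hκt))).ne
  filter_upwards [h2, hD] with x hx hx'
  refine ⟨(hDm.comp measurable_prodMk_left).aestronglyMeasurable, ?_⟩
  refine (lintegral_mono_ae hx').trans_lt ?_
  by_contra hcon
  rw [not_lt, top_le_iff] at hcon
  rw [hcon] at hx
  simp at hx

end Minkowski

/-! ### Averages of translates as Fourier multipliers. -/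

section Plancherel

variable {d : ℕ}

open FourierTransform

/-- On `L¹ ∩ L²` the Fourier transform of `L²` is given by the Fourier integral. -/
theorem fourier_toLp_ae_eq {g : Space d → ℂ} (h1 : Integrable g) (h2 : MemLp g 2 volume) :
    ((𝓕 (h2.toLp g) : L2 d) : Space d → ℂ) =ᵐ[volume] 𝓕 g := by
  have hc : Continuous (𝓕 g) :=
    VectorFourier.fourierIntegral_continuous Real.continuous_fourierChar
      (innerSL ℝ).continuous₂ h1
  -- Both sides are locally integrable, so they may be compared by testing. The `L²` transform acts
  -- on Schwartz functions by duality, and for the Fourier integral the same duality is Fubini's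
  -- theorem.
  refine ae_eq_of_integral_contDiff_smul_eq
    ((Lp.memLp (𝓕 (h2.toLp g) : L2 d)).locallyIntegrable (by norm_num))
    hc.locallyIntegrable fun φ hφ hφc => ?_
  let ψ : Space d → ℂ := fun x => (φ x : ℂ)
  have hψ : ContDiff ℝ ∞ ψ := Complex.ofRealCLM.contDiff.comp hφ
  have hψc : HasCompactSupport ψ := hφc.comp_left (g := fun t : ℝ => (t : ℂ)) (by simp)
  let Ψ : SchwartzMap (Space d) ℂ := hψc.toSchwartzMap hψ
  have e := congrArg (fun T : TemperedDistribution (Space d) ℂ => T Ψ)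
    (Lp.fourier_toTemperedDistribution_eq (h2.toLp g))
  simp only [TemperedDistribution.fourier_apply, Lp.toTemperedDistribution_apply] at e
  have hΨ : ∀ x, Ψ x = (φ x : ℂ) := fun x => rfl
  have e2 : ∫ x, (𝓕 Ψ) x • (h2.toLp g) x = ∫ x, Ψ x • 𝓕 g x := by
    have h3 : ∫ x, (𝓕 Ψ) x • (h2.toLp g) x = ∫ x, (𝓕 (Ψ : Space d → ℂ)) x • g x := by
      refine integral_congr_ae ?_
      filter_upwards [h2.coeFn_toLp] with x hx
      rw [hx, SchwartzMap.fourier_coe]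
    rw [h3]
    have := VectorFourier.integral_fourierIntegral_smul_eq_flip (L := innerₗ (Space d))
      Real.continuous_fourierChar continuous_inner Ψ.integrable h1 (μ := volume) (ν := volume)
    rw [flip_innerₗ] at this
    exact this
  rw [e2] at e
  simp only [hΨ] at e
  simpa only [Complex.real_smul, smul_eq_mul] using e.symm

variable {W : Type*} [MeasurableSpace W]

/-- The average of translates `∫ k(w) G(x + g(w)) dw`. -/
def translateAverage (ν : Measure W) (k : W → ℂ) (g : W → Space d) (G : Space d → ℂ)
    (x : Space d) : ℂ := ∫ w, k w * G (x + g w) ∂ν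

/-- The multiplier corresponding to an average of translates. -/
def translateMultiplier (ν : Measure W) (k : W → ℂ) (g : W → Space d) (ξ : Space d) : ℂ :=
  ∫ w, k w * Complex.exp (((2 * Real.pi * ⟪g w, ξ⟫_ℝ : ℝ) : ℂ) * Complex.I) ∂ν

theorem integrable_translate_prod {ν : Measure W} [SFinite ν] {k : W → ℂ} (hk : Integrable k ν)
    {g : W → Space d} (hg : Measurable g) {G : Space d → ℂ} (hG : Integrable G) :
    Integrable (fun p : Space d × W => k p.2 * G (p.1 + g p.2)) (volume.prod ν) := by
  have h0 : Integrable (fun p : Space d × W => G p.1 * k p.2) (volume.prod ν) := hG.mul_prod hk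
  have hmp : MeasurePreserving (fun p : Space d × W => (p.1 + g p.2, p.2))
      (volume.prod ν) (volume.prod ν) := by
    have h1 : MeasurePreserving (fun q : W × Space d => (q.1, q.2 + g q.1))
        (ν.prod volume) (ν.prod volume) := by
      refine (MeasurePreserving.id ν).skew_product (g := fun w z => z + g w) (by fun_prop) ?_
      exact ae_of_all _ fun w => (measurePreserving_add_right volume (g w)).map_eq
    exact (Measure.measurePreserving_swap.comp h1).comp Measure.measurePreserving_swap
  have := hmp.integrable_comp_of_integrable h0
  refine this.congr (ae_of_all _ fun p => ?_)
  simp only [Function.comp_apply]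
  ring

theorem integrable_translateAverage {ν : Measure W} [SFinite ν] {k : W → ℂ} (hk : Integrable k ν)
    {g : W → Space d} (hg : Measurable g) {G : Space d → ℂ} (hG : Integrable G) :
    Integrable (translateAverage ν k g G) :=
  (integrable_translate_prod hk hg hG).integral_prod_left

/-- Fubini, then a translation of the inner integral. The sign in the multiplier is positive because
`G` is evaluated at `x + g w`. -/
theorem fourier_translateAverage {ν : Measure W} [SFinite ν] {k : W → ℂ} (hk : Integrable k ν)
    {g : W → Space d} (hg : Measurable g) {G : Space d → ℂ} (hG : Integrable G) (ξ : Space d) :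
    𝓕 (translateAverage ν k g G) ξ = translateMultiplier ν k g ξ * 𝓕 G ξ := by
  have hi := integrable_translate_prod hk hg hG
  let e : Space d → ℂ := fun v => Complex.exp (((-2 * Real.pi * ⟪v, ξ⟫_ℝ : ℝ) : ℂ) * Complex.I)
  have he : Continuous e := by fun_prop
  have hen : ∀ v, ‖e v‖ = 1 := fun v => Complex.norm_exp_ofReal_mul_I _
  have hi2 : Integrable (fun p : Space d × W => e p.1 * (k p.2 * G (p.1 + g p.2)))
      (volume.prod ν) := by
    refine hi.bdd_mul (c := 1) (he.measurable.comp measurable_fst).aestronglyMeasurable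
      (ae_of_all _ fun p => (hen _).le)
  rw [Real.fourier_eq', Real.fourier_eq']
  calc ∫ v, Complex.exp (((-2 * Real.pi * ⟪v, ξ⟫_ℝ : ℝ) : ℂ) * Complex.I) •
        translateAverage ν k g G v
      = ∫ v, ∫ w, e v * (k w * G (v + g w)) ∂ν := by
        congr 1
        ext1 v
        rw [translateAverage, smul_eq_mul, ← integral_const_mul]
    _ = ∫ w, (∫ v, e v * (k w * G (v + g w))) ∂ν := integral_integral_swap hi2
    _ = ∫ w, (k w * Complex.exp (((2 * Real.pi * ⟪g w, ξ⟫_ℝ : ℝ) : ℂ) * Complex.I)) *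
          (∫ v, e v * G v) ∂ν := by
        congr 1
        ext1 w
        have h1 := integral_add_right_eq_self (μ := (volume : Measure (Space d)))
          (fun v => e (v - g w) * (k w * G v)) (g w)
        simp only [add_sub_cancel_right] at h1
        rw [h1, ← integral_const_mul]
        congr 1
        ext1 v
        have h2 : e (v - g w) =
            Complex.exp (((2 * Real.pi * ⟪g w, ξ⟫_ℝ : ℝ) : ℂ) * Complex.I) * e v := by
          simp only [e]
          rw [← Complex.exp_add, inner_sub_left]
          congr 1
          push_cast
          ring
        rw [h2]
        ring
    _ = _ := by
        rw [integral_mul_const]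
        rfl

end Plancherel

/-! ### Convergence in `L²` of the truncated singular integrals. -/

section SingularLimit

variable {d : ℕ}

open FourierTransform

theorem memLp_translateAverage {W : Type*} [MeasurableSpace W] {ν : Measure W} [SFinite ν]
    {k : W → ℂ} (hkm : Measurable k) (hk : Integrable k ν) {g : W → Space d} (hg : Measurable g)
    {G : Space d → ℂ} (hGm : Measurable G) (hG1 : Integrable G) (hG2 : MemLp G 2 volume) :
    MemLp (translateAverage ν k g G) 2 volume := by
  refine ⟨(integrable_translateAverage hk hg hG1).aestronglyMeasurable, ?_⟩
  have hG2' : ∫⁻ x, ‖G x‖ₑ ^ 2 < ⊤ := by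
    have := lintegral_rpow_enorm_lt_top_of_eLpNorm_lt_top (by simp) (by simp) hG2.eLpNorm_lt_top
    simpa using this
  have h := eLpNorm_integral_le (ρ := (volume : Measure (Space d))) (ν := ν)
    (κ := fun w => ‖k w‖ₑ) (b := fun x w => ‖G (x + g w)‖ₑ) (B := ∫⁻ x, ‖G x‖ₑ ^ 2)
    (D := fun x w => k w * G (x + g w)) (by fun_prop)
    (by
      have : Measurable fun p : Space d × W => G (p.1 + g p.2) := hGm.comp (by fun_prop)
      exact this.enorm)
    (ae_of_all _ fun w => (lintegral_add_right_eq_self (fun x => ‖G x‖ₑ ^ 2) (g w)).le)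
    (ae_of_all _ fun x => ae_of_all _ fun w => (enorm_mul _ _).le)
  refine h.trans_lt (ENNReal.mul_lt_top ?_ hk.2)
  exact ENNReal.rpow_lt_top_of_nonneg (by norm_num) hG2'.ne

/-- Averages of translates whose multipliers are uniformly bounded and converge pointwise converge
in `L²`. -/
theorem exists_tendsto_translateAverage {W : Type*} [MeasurableSpace W] {ν : Measure W} [SFinite ν]
    {k : ℝ → W → ℂ} (hkm : ∀ r, Measurable (k r)) (hk : ∀ r, 0 < r → Integrable (k r) ν)
    {g : W → Space d} (hg : Measurable g) {C : ℝ}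
    (hC : ∀ r ξ, 0 < r → r ≤ 1 → ‖translateMultiplier ν (k r) g ξ‖ ≤ C)
    {M : Space d → ℂ}
    (hM : ∀ ξ, Tendsto (fun r => translateMultiplier ν (k r) g ξ) (𝓝[>] 0) (𝓝 (M ξ)))
    {G : Space d → ℂ} (hGm : Measurable G) (hG1 : Integrable G) (hG2 : MemLp G 2 volume) :
    ∃ S : L2 d, Tendsto (fun r => eLpNorm (fun x => translateAverage ν (k r) g G x - S x) 2 volume)
      (𝓝[>] 0) (𝓝 0) := by
  have hev : ∀ᶠ r in 𝓝[>] (0 : ℝ), 0 < r ∧ r ≤ 1 := by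
    filter_upwards [Ioc_mem_nhdsGT (zero_lt_one' ℝ)] with r hr using hr
  have hmm : ∀ r, Measurable (translateMultiplier ν (k r) g) := by
    intro r
    have h1 := hkm r
    have : StronglyMeasurable fun p : Space d × W => k r p.2 *
        Complex.exp (((2 * Real.pi * ⟪g p.2, p.1⟫_ℝ : ℝ) : ℂ) * Complex.I) := by
      apply Measurable.stronglyMeasurable
      have h2 : Measurable fun p : Space d × W => ⟪g p.2, p.1⟫_ℝ :=
        Measurable.inner (by fun_prop) (by fun_prop)
      fun_prop
    exact this.integral_prod_right'.measurable
  have hMm : Measurable M :=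
    measurable_of_tendsto_metrizable' (𝓝[>] (0 : ℝ)) hmm (tendsto_pi_nhds.2 hM)
  have hMC : ∀ ξ, ‖M ξ‖ ≤ C := by
    intro ξ
    refine le_of_tendsto (hM ξ).norm ?_
    filter_upwards [hev] with r hr using hC r ξ hr.1 hr.2
  have hGF : MemLp (𝓕 G) 2 volume :=
    (memLp_congr_ae (fourier_toLp_ae_eq hG1 hG2)).1 (Lp.memLp _)
  have hZ : MemLp (fun ξ => M ξ * 𝓕 G ξ) 2 volume := by
    refine hGF.of_le_mul (c := C) (hMm.aestronglyMeasurable.mul hGF.aestronglyMeasurable)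
      (ae_of_all _ fun ξ => ?_)
    rw [norm_mul]
    exact mul_le_mul_of_nonneg_right (hMC ξ) (norm_nonneg _)
  let Φ := Lp.fourierTransformₗᵢ (Space d) ℂ
  -- The limit is defined on the Fourier side by the limiting multiplier `M`. By Plancherel,
  -- convergence becomes dominated convergence with majorant `(2C)² |𝓕 G|²`.
  let S : L2 d := Φ.symm (hZ.toLp _)
  refine ⟨S, ?_⟩
  have hnorm : ∀ r, 0 < r → eLpNorm (fun x => translateAverage ν (k r) g G x - S x) 2 volume =
      eLpNorm (fun ξ => (translateMultiplier ν (k r) g ξ - M ξ) * 𝓕 G ξ) 2 volume := by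
    intro r hr
    have hT := memLp_translateAverage (hkm r) (hk r hr) hg hGm hG1 hG2
    have hTi := integrable_translateAverage (hk r hr) hg hG1
    have e1 : eLpNorm (fun x => translateAverage ν (k r) g G x - S x) 2 volume =
        ‖hT.toLp _ - S‖ₑ := by
      rw [Lp.enorm_def]
      refine eLpNorm_congr_ae ?_
      filter_upwards [hT.coeFn_toLp, Lp.coeFn_sub (hT.toLp _) S] with x h1 h2
      rw [h2, Pi.sub_apply, h1]
    have e2 : ‖hT.toLp _ - S‖ₑ = ‖Φ (hT.toLp _) - hZ.toLp _‖ₑ := by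
      rw [← Φ.enorm_map (hT.toLp _ - S), map_sub]
      congr 2
      exact Φ.apply_symm_apply _
    rw [e1, e2, Lp.enorm_def]
    refine eLpNorm_congr_ae ?_
    filter_upwards [Lp.coeFn_sub (Φ (hT.toLp _)) (hZ.toLp _), fourier_toLp_ae_eq hTi hT,
      hZ.coeFn_toLp] with ξ h1 h2 h3
    rw [h1, Pi.sub_apply, h3]
    change (𝓕 (hT.toLp _) : L2 d) ξ - _ = _
    rw [h2, fourier_translateAverage (hk r hr) hg hG1]
    ring
  have hlim : Tendsto (fun r => ∫⁻ ξ, ‖(translateMultiplier ν (k r) g ξ - M ξ) * 𝓕 G ξ‖ₑ ^ (2 : ℝ))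
      (𝓝[>] 0) (𝓝 0) := by
    have h0 : (0 : ENNReal) = ∫⁻ _ : Space d, 0 := by simp
    rw [h0]
    refine tendsto_lintegral_filter_of_dominated_convergence
      (fun ξ => ENNReal.ofReal (2 * C) ^ (2 : ℝ) * ‖𝓕 G ξ‖ₑ ^ (2 : ℝ)) ?_ ?_ ?_ ?_
    · filter_upwards with r
      have hGFm : Measurable (𝓕 G) := by
        have : Continuous (𝓕 G) :=
          VectorFourier.fourierIntegral_continuous Real.continuous_fourierChar
            (innerSL ℝ).continuous₂ hG1
        exact this.measurable
      have := hmm r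
      fun_prop
    · filter_upwards [hev] with r hr
      refine ae_of_all _ fun ξ => ?_
      rw [enorm_mul, ENNReal.mul_rpow_of_nonneg _ _ (by norm_num)]
      gcongr
      rw [← ofReal_norm]
      refine ENNReal.ofReal_le_ofReal ((norm_sub_le _ _).trans ?_)
      linarith [hC r ξ hr.1 hr.2, hMC ξ]
    · have hCt : ENNReal.ofReal (2 * C) ^ (2 : ℝ) ≠ ⊤ :=
        ENNReal.rpow_ne_top_of_nonneg (by norm_num) ENNReal.ofReal_ne_top
      rw [lintegral_const_mul' _ _ hCt]
      refine ENNReal.mul_ne_top hCt ?_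
      have := lintegral_rpow_enorm_lt_top_of_eLpNorm_lt_top (by simp) (by simp) hGF.eLpNorm_lt_top
      simpa using this.ne
    · refine ae_of_all _ fun ξ => ?_
      have h1 : Tendsto (fun r => (translateMultiplier ν (k r) g ξ - M ξ) * 𝓕 G ξ) (𝓝[>] 0)
          (𝓝 ((M ξ - M ξ) * 𝓕 G ξ)) := ((hM ξ).sub_const _).mul_const _
      rw [sub_self, zero_mul] at h1
      have h2 := (ENNReal.continuous_rpow_const (y := 2)).tendsto _ |>.comp h1.enorm
      simpa [Function.comp_def] using h2
  have h2 : Tendsto (fun r => eLpNorm (fun ξ => (translateMultiplier ν (k r) g ξ - M ξ) * 𝓕 G ξ) 2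
      volume) (𝓝[>] 0) (𝓝 0) := by
    have h3 := (ENNReal.continuous_rpow_const (y := 1 / 2)).tendsto _ |>.comp hlim
    rw [ENNReal.zero_rpow_of_pos (by norm_num)] at h3
    refine h3.congr fun r => ?_
    rw [eLpNorm_eq_lintegral_rpow_enorm_toReal (by simp) (by simp)]
    simp
  refine h2.congr' ?_
  filter_upwards [hev] with r hr using (hnorm r hr.1).symm

theorem integral_eq_zero_of_odd {E : Type*} [NormedAddCommGroup E] [NormedSpace ℝ E]
    [IsAddTorsionFree E] {h : Space d → E} (hh : ∀ y, h (-y) = -h y) : ∫ y, h y = 0 := by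
  have h1 := integral_neg_eq_self h volume
  simp only [hh, integral_neg] at h1
  exact self_eq_neg.1 h1.symm

/-- The multiplier of the truncated kernel at a fixed point of the segment. -/
theorem integral_rieszKernel_mul_exp (j : Fin d) {r : ℝ} (hr : 0 < r) (η : Space d) :
    ∫ y, ((rieszKernel j r y : ℝ) : ℂ) * Complex.exp (((⟪y, η⟫_ℝ : ℝ) : ℂ) * Complex.I) =
      ((∫ y, rieszKernel j r y * Real.sin ⟪y, η⟫_ℝ : ℝ) : ℂ) * Complex.I := by
  have hi := integrable_rieszKernel j hr
  have i1 : Integrable fun y => rieszKernel j r y * Real.sin ⟪y, η⟫_ℝ :=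
    hi.mul_bdd (c := 1) (Continuous.aestronglyMeasurable (by fun_prop))
      (ae_of_all _ fun y => Real.abs_sin_le_one _)
  have i2 : Integrable fun y => rieszKernel j r y * Real.cos ⟪y, η⟫_ℝ :=
    hi.mul_bdd (c := 1) (Continuous.aestronglyMeasurable (by fun_prop))
      (ae_of_all _ fun y => Real.abs_cos_le_one _)
  have h0 : ∫ y, rieszKernel j r y * Real.cos ⟪y, η⟫_ℝ = 0 := by
    refine integral_eq_zero_of_odd fun y => ?_
    rw [rieszKernel_neg, inner_neg_left, Real.cos_neg]
    ring
  calc _ = ∫ y, (((rieszKernel j r y * Real.cos ⟪y, η⟫_ℝ : ℝ) : ℂ) +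
        ((rieszKernel j r y * Real.sin ⟪y, η⟫_ℝ : ℝ) : ℂ) * Complex.I) := by
        congr 1
        ext1 y
        rw [Complex.exp_mul_I, ← Complex.ofReal_cos, ← Complex.ofReal_sin]
        push_cast
        ring
    _ = _ := by
        rw [integral_add i2.ofReal (i1.ofReal.mul_const _), integral_mul_const,
          integral_complex_ofReal, integral_complex_ofReal, h0]
        simp

/-- The singular integrals of an `L¹ ∩ L²` function along segments converge in `L²`. -/
theorem exists_tendsto_riesz (hd : 1 ≤ d) (j : Fin d) {μ : Measure ℝ} (hμ : IsSegmentWeight μ)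
    {G : Space d → ℂ} (hGm : Measurable G) (hG1 : Integrable G) (hG2 : MemLp G 2 volume) :
    ∃ S : L2 d, Tendsto (fun r => eLpNorm (fun x =>
      translateAverage ((volume : Measure (Space d)).prod μ)
        (fun w => ((rieszKernel j r w.1 : ℝ) : ℂ)) (fun w => w.2 • w.1) G x - S x) 2 volume)
      (𝓝[>] 0) (𝓝 0) := by
  have := hμ.prob
  obtain ⟨C, hC0, hC⟩ := exists_abs_integral_rieszKernel_le hd j
  let k : ℝ → Space d × ℝ → ℂ := fun r w => ((rieszKernel j r w.1 : ℝ) : ℂ)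
  let g : Space d × ℝ → Space d := fun w => w.2 • w.1
  have hg : Measurable g := by fun_prop
  have hkm : ∀ r, Measurable (k r) := fun r =>
    Complex.measurable_ofReal.comp ((measurable_rieszKernel j r).comp measurable_fst)
  have hk : ∀ r, 0 < r → Integrable (k r) ((volume : Measure (Space d)).prod μ) := by
    intro r hr
    have h : Integrable fun y : Space d => ((rieszKernel j r y : ℝ) : ℂ) :=
      (integrable_rieszKernel j hr).ofReal
    exact h.comp_fst μ
  have hexp : ∀ ξ : Space d, Continuous fun w : Space d × ℝ =>
      Complex.exp (((2 * Real.pi * ⟪g w, ξ⟫_ℝ : ℝ) : ℂ) * Complex.I) := by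
    intro ξ
    fun_prop
  have hint : ∀ r ξ, 0 < r → Integrable (fun w => k r w *
      Complex.exp (((2 * Real.pi * ⟪g w, ξ⟫_ℝ : ℝ) : ℂ) * Complex.I))
      ((volume : Measure (Space d)).prod μ) := by
    intro r ξ hr
    exact (hk r hr).mul_bdd (c := 1) (hexp ξ).aestronglyMeasurable
      (ae_of_all _ fun w => (Complex.norm_exp_ofReal_mul_I _).le)
  -- For fixed `θ` the inner integral is the sine transform at `2πθξ`, bounded by `C` whatever `θ`
  -- is, so its `μ`-average obeys the same bound.
  have hbound : ∀ r ξ, 0 < r → r ≤ 1 →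
      ‖translateMultiplier ((volume : Measure (Space d)).prod μ) (k r) g ξ‖ ≤ C := by
    intro r ξ hr hr1
    rw [translateMultiplier, integral_prod_symm _ (hint r ξ hr)]
    have := norm_integral_le_of_norm_le_const (μ := μ) (C := C) (f := fun θ : ℝ => ∫ y : Space d,
      k r (y, θ) * Complex.exp (((2 * Real.pi * ⟪g (y, θ), ξ⟫_ℝ : ℝ) : ℂ) * Complex.I))
      (ae_of_all _ fun θ => ?_)
    · simpa using this
    · have e : ∀ y : Space d, 2 * Real.pi * ⟪g (y, θ), ξ⟫_ℝ = ⟪y, (2 * Real.pi * θ) • ξ⟫_ℝ := by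
        intro y
        simp only [g]
        rw [real_inner_smul_left, real_inner_smul_right]
        ring
      simp only [e, k]
      rw [integral_rieszKernel_mul_exp j hr, norm_mul, Complex.norm_I, mul_one, Complex.norm_real]
      exact hC r _ hr hr1
  -- At `r = 0` the kernel fills the whole unit ball, with the value `0 / 0 = 0` at the origin.
  let M : Space d → ℂ := fun ξ => ∫ w, k 0 w *
    (Complex.exp (((2 * Real.pi * ⟪g w, ξ⟫_ℝ : ℝ) : ℂ) * Complex.I) - 1)
      ∂((volume : Measure (Space d)).prod μ)
  refine exists_tendsto_translateAverage hkm hk hg hbound (M := M) ?_ hGm hG1 hG2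
  intro ξ
  have hev : ∀ᶠ r in 𝓝[>] (0 : ℝ), 0 < r := self_mem_nhdsWithin
  -- The kernel is odd, so `1` may be subtracted from the exponential for free. The difference is of
  -- order `|y| |ξ|`, which reduces the singularity to the integrable `|y|^{1-d}` and permits
  -- dominated convergence.
  have e0 : ∀ r, 0 < r → ∫ w, k r w ∂((volume : Measure (Space d)).prod μ) = 0 := by
    intro r hr
    rw [integral_prod _ (hk r hr)]
    simp only [k, integral_const, probReal_univ, one_smul]
    rw [integral_complex_ofReal, integral_eq_zero_of_odd (rieszKernel_neg j r), Complex.ofReal_zero]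
  have e1 : ∀ r, 0 < r → translateMultiplier ((volume : Measure (Space d)).prod μ) (k r) g ξ =
      ∫ w, k r w * (Complex.exp (((2 * Real.pi * ⟪g w, ξ⟫_ℝ : ℝ) : ℂ) * Complex.I) - 1)
        ∂((volume : Measure (Space d)).prod μ) := by
    intro r hr
    simp only [mul_sub, mul_one]
    rw [integral_sub (hint r ξ hr) (hk r hr), e0 r hr, sub_zero]
    rfl
  suffices h : Tendsto (fun r => ∫ w, k r w *
      (Complex.exp (((2 * Real.pi * ⟪g w, ξ⟫_ℝ : ℝ) : ℂ) * Complex.I) - 1)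
        ∂((volume : Measure (Space d)).prod μ)) (𝓝[>] 0) (𝓝 (M ξ)) by
    refine h.congr' ?_
    filter_upwards [hev] with r hr using (e1 r hr).symm
  let bd : Space d → ℝ := (Metric.ball (0 : Space d) 1).indicator fun y => ‖y‖ ^ ((1 : ℝ) - d)
  have hbd : Integrable bd :=
    (integrable_indicator_iff measurableSet_ball).2 (integrableOn_norm_rpow_ball hd one_pos)
  refine tendsto_integral_filter_of_dominated_convergence
    (fun w => 2 * Real.pi * ‖ξ‖ * bd w.1) ?_ ?_ ?_ ?_
  · filter_upwards with r
    exact (hkm r).aestronglyMeasurable.mul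
      ((hexp ξ).aestronglyMeasurable.sub aestronglyMeasurable_const)
  · filter_upwards [hev] with r hr
    have hθ : ∀ᵐ w ∂((volume : Measure (Space d)).prod μ), w.2 ∈ Set.Icc (0 : ℝ) 1 :=
      Measure.quasiMeasurePreserving_snd.ae hμ.mem_Icc
    filter_upwards [hθ] with w hw
    rw [norm_mul]
    by_cases hy : w.1 ∈ annulus d r
    · have hyb : w.1 ∈ Metric.ball (0 : Space d) 1 := mem_ball_zero_iff.2 hy.2
      have hpos : 0 < ‖w.1‖ := hr.trans_le hy.1
      have h1 : ‖k r w‖ ≤ ‖w.1‖ / ‖w.1‖ ^ (d + 1) := by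
        simp only [k, Complex.norm_real, rieszKernel]
        rw [Set.indicator_of_mem hy]
        exact abs_div_norm_pow_le j w.1
      have h2 : ‖Complex.exp (((2 * Real.pi * ⟪g w, ξ⟫_ℝ : ℝ) : ℂ) * Complex.I) - 1‖ ≤
          2 * Real.pi * (‖w.1‖ * ‖ξ‖) := by
        rw [mul_comm _ Complex.I]
        refine (Real.norm_exp_I_mul_ofReal_sub_one_le).trans ?_
        rw [norm_mul, Real.norm_of_nonneg (by positivity : 0 ≤ 2 * Real.pi)]
        gcongr
        refine (norm_inner_le_norm _ _).trans ?_
        gcongr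
        simp only [g]
        rw [norm_smul, Real.norm_of_nonneg hw.1]
        exact mul_le_of_le_one_left (norm_nonneg _) hw.2
      have e : bd w.1 = ‖w.1‖ / ‖w.1‖ ^ (d + 1) * ‖w.1‖ := by
        simp only [bd]
        rw [Set.indicator_of_mem hyb, Real.rpow_sub hpos, Real.rpow_one, Real.rpow_natCast]
        field_simp
        ring
      rw [e]
      calc _ ≤ (‖w.1‖ / ‖w.1‖ ^ (d + 1)) * (2 * Real.pi * (‖w.1‖ * ‖ξ‖)) := by gcongr
        _ = _ := by ring
    · simp only [k, rieszKernel]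
      rw [Set.indicator_of_notMem hy]
      simp only [Complex.ofReal_zero, norm_zero, zero_mul]
      have : 0 ≤ bd w.1 := Set.indicator_nonneg (fun y _ => by positivity) _
      positivity
  · exact (hbd.comp_fst μ).const_mul _
  · refine ae_of_all _ fun w => ?_
    refine Tendsto.mul_const _ (tendsto_const_nhds.congr' ?_)
    rcases (norm_nonneg w.1).eq_or_lt with h0 | h0
    · filter_upwards with r
      have h1 : w.1 = 0 := norm_eq_zero.1 h0.symm
      have h2 : ∀ s, rieszKernel j s (0 : Space d) = 0 := by
        intro s
        rw [rieszKernel, Set.indicator_apply_eq_zero]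
        simp
      simp only [k, h1, h2]
    · have : ∀ᶠ r in 𝓝[>] (0 : ℝ), r < ‖w.1‖ :=
        nhdsWithin_le_nhds (Iio_mem_nhds h0)
      filter_upwards [this] with r hr
      have : w.1 ∈ annulus d 0 ↔ w.1 ∈ annulus d r := by
        change (0 ≤ ‖w.1‖ ∧ ‖w.1‖ < 1) ↔ (r ≤ ‖w.1‖ ∧ ‖w.1‖ < 1)
        simp [hr.le]
      simp only [k, rieszKernel]
      by_cases hw : w.1 ∈ annulus d r
      · rw [Set.indicator_of_mem hw, Set.indicator_of_mem (this.2 hw)]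
      · rw [Set.indicator_of_notMem hw, Set.indicator_of_notMem (mt this.1 hw)]

end SingularLimit

/-! ### Pointwise bound for the integrand minus its singular part. -/

section Remainder

variable {d : ℕ}

/-- Interpolation between quadratic behaviour at small `t` and linear growth at large `t`. Squared
in `L²`, the exponent `1 + s` costs `A` the exponent `2 + 2s`, only slightly more than `2`. -/
theorem norm_exp_sub_one_add_le (t : ℝ) {s : ℝ} (hs : 0 ≤ s) (hs1 : s ≤ 1) :
    ‖Complex.exp (-Complex.I * (t : ℂ)) - 1 + Complex.I * (t : ℂ)‖ ≤ 3 * |t| ^ (1 + s) := by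
  have hn : ‖-Complex.I * (t : ℂ)‖ = |t| := by simp
  rcases le_total |t| 1 with h | h
  · have h1 := Complex.norm_exp_sub_one_sub_id_le (x := -Complex.I * (t : ℂ)) (by rwa [hn])
    have h2 : |t| ^ (2 : ℝ) ≤ |t| ^ (1 + s) :=
      Real.rpow_le_rpow_of_exponent_ge' (abs_nonneg t) h (by linarith) (by linarith)
    rw [Real.rpow_two] at h2
    rw [hn, neg_mul, sub_neg_eq_add] at h1
    rw [neg_mul]
    have : 0 ≤ |t| ^ 2 := by positivity
    linarith
  · have h1 : ‖Complex.exp (-Complex.I * (t : ℂ)) - 1 + Complex.I * (t : ℂ)‖ ≤ 1 + 1 + |t| := by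
      refine (norm_add_le _ _).trans (add_le_add ((norm_sub_le _ _).trans ?_) ?_)
      · rw [norm_exp_neg_I_mul, norm_one]
      · simp
    have h2 : |t| ^ (1 : ℝ) ≤ |t| ^ (1 + s) := Real.rpow_le_rpow_of_exponent_le h (by linarith)
    rw [Real.rpow_one] at h2
    linarith

/-- Taylor's formula to first order, uniformly on the whole space. -/
theorem IsTest.exists_taylor {f : Space d → ℂ} (hf : IsTest f) :
    ∃ L : ℝ, 0 ≤ L ∧ ∀ x y, ‖f (x + y) - f x - fderiv ℝ f x y‖ ≤ L * ‖y‖ ^ 2 := by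
  have h1 : ContDiff ℝ 1 (fderiv ℝ f) :=
    hf.1.fderiv_right (by rw [one_add_one_eq_two]; exact ENat.LEInfty.out)
  obtain ⟨L, hL⟩ := h1.lipschitzWith_of_hasCompactSupport (hf.2.fderiv ℝ) (by simp)
  refine ⟨L, L.2, fun x y => ?_⟩
  have h2 := Convex.norm_image_sub_le_of_norm_fderiv_le' (𝕜 := ℝ) (f := f) (C := L * ‖y‖)
    (s := Metric.closedBall x ‖y‖) (x := x) (y := x + y) (φ := fderiv ℝ f x)
    (fun z _ => hf.1.differentiable (by simp) z) (fun z hz => ?_) (convex_closedBall _ _)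
    (by simp) (by simp)
  · rw [add_sub_cancel_left] at h2
    calc _ ≤ _ := h2
      _ = _ := by ring
  · refine (hL.norm_sub_le z x).trans ?_
    gcongr
    simpa [dist_eq_norm] using hz

/-- The difference between the integrand of the truncated integral and its principal part. -/
def remainder (μ : Measure ℝ) (A : Space d → Space d) (m c : ℝ) (f : Space d → ℂ)
    (x y : Space d) : ℂ :=
  (phase (weightedPotential μ A) (x, y) * f (x + y) - f x - fderiv ℝ f x y) *
      ((levyDensity d m y : ℝ) : ℂ) +
    Complex.I * (c : ℂ) * ∑ j, ((y j / ‖y‖ ^ (d + 1) : ℝ) : ℂ) *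
      ∫ θ, ((A (x + θ • y) j : ℝ) : ℂ) * f (x + θ • y) ∂μ

theorem measurable_remainder {μ : Measure ℝ} (hμ : IsSegmentWeight μ) {A : Space d → Space d}
    (hA : Measurable A) (m c : ℝ) {f : Space d → ℂ} (hf : IsTest f) :
    Measurable (Function.uncurry (remainder μ A m c f)) := by
  have := hμ.prob
  have h1 := measurable_phase (measurable_weightedPotential hμ hA)
  have h2 := measurable_levyDensity d m
  have h3 : Measurable f := hf.1.continuous.measurable
  have h4 : Measurable fun p : Space d × Space d => fderiv ℝ f p.1 p.2 := by
    have := hf.1.continuous_fderiv (by simp)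
    have h : Continuous fun p : Space d × Space d => fderiv ℝ f p.1 p.2 := by fun_prop
    exact h.measurable
  have h5 : ∀ j, Measurable fun p : Space d × Space d =>
      ∫ θ, ((A (p.1 + θ • p.2) j : ℝ) : ℂ) * f (p.1 + θ • p.2) ∂μ := by
    intro j
    have hAj : Measurable fun z : Space d => A z j := by fun_prop
    have h6 : Measurable fun z : Space d => ((A z j : ℝ) : ℂ) * f z := by fun_prop
    have h7 : StronglyMeasurable fun p : (Space d × Space d) × ℝ =>
        ((A (p.1.1 + p.2 • p.1.2) j : ℝ) : ℂ) * f (p.1.1 + p.2 • p.1.2) :=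
      (h6.comp (by fun_prop : Measurable fun p : (Space d × Space d) × ℝ =>
        p.1.1 + p.2 • p.1.2)).stronglyMeasurable
    exact h7.integral_prod_right'.measurable
  have e : Function.uncurry (remainder μ A m c f) = fun p : Space d × Space d =>
      (phase (weightedPotential μ A) p * f (p.1 + p.2) - f p.1 - fderiv ℝ f p.1 p.2) *
      ((levyDensity d m p.2 : ℝ) : ℂ) +
    Complex.I * (c : ℂ) * ∑ j, ((p.2 j / ‖p.2‖ ^ (d + 1) : ℝ) : ℂ) *
      ∫ θ, ((A (p.1 + θ • p.2) j : ℝ) : ℂ) * f (p.1 + θ • p.2) ∂μ := rfl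
  rw [e]
  refine Measurable.add (by fun_prop) (Measurable.const_mul ?_ _)
  refine Finset.measurable_sum _ fun j _ => Measurable.mul (by fun_prop) (h5 j)

/-- The terms of the remainder at a point where the potential is integrable along the segment. -/
theorem norm_remainder_le {μ : Measure ℝ} (hμ : IsSegmentWeight μ) {A : Space d → Space d}
    (hA : Measurable A) {m c C s M L L' : ℝ} (hC : 0 ≤ C) (hm : 0 ≤ m)
    (hs : 0 < s) (hs1 : s ≤ 1) (hM0 : 0 ≤ M) (hL0 : 0 ≤ L) (hL' : 0 ≤ L')
    (hn : ∀ y : Space d, levyDensity d m y ≤ C / ‖y‖ ^ (d + 1))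
    (hn' : ∀ y : Space d, |levyDensity d m y - c / ‖y‖ ^ (d + 1)| ≤ C / ‖y‖ ^ d)
    {f : Space d → ℂ} (hf : Continuous f) (hM : ∀ x, ‖f x‖ ≤ M)
    (hL : ∀ x y, ‖f x - f y‖ ≤ L * ‖x - y‖)
    (hT : ∀ x y, ‖f (x + y) - f x - fderiv ℝ f x y‖ ≤ L' * ‖y‖ ^ 2)
    {x y : Space d} (hy0 : y ≠ 0) (hy : ‖y‖ < 1)
    (hi : Integrable (fun θ => ‖A (x + θ • y)‖ ^ (1 + s)) μ) :
    ‖remainder μ A m c f x y‖ ≤ (3 * M * C + L' * C + (L + M) * C) * ‖y‖ ^ (s - d) *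
      (1 + ∫ θ, ‖A (x + θ • y)‖ ^ (1 + s) ∂μ) := by
  have := hμ.prob
  set F : ℝ → Space d := fun θ => A (x + θ • y) with hF
  have hFm : Measurable F := hA.comp (by fun_prop)
  set a : ℝ := ∫ θ, ‖F θ‖ ^ (1 + s) ∂μ with ha
  have ha0 : 0 ≤ a := integral_nonneg fun θ => by positivity
  have hρ : 0 < ‖y‖ := norm_pos_iff.2 hy0
  have hle : ∀ t : ℝ, 0 ≤ t → t ≤ 1 + t ^ (1 + s) := by
    intro t ht
    rcases le_total t 1 with h | h
    · have : 0 ≤ t ^ (1 + s) := by positivity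
      linarith
    · have h2 : t ^ (1 : ℝ) ≤ t ^ (1 + s) := Real.rpow_le_rpow_of_exponent_le h (by linarith)
      rw [Real.rpow_one] at h2
      linarith
  have hFn : Integrable (fun θ => ‖F θ‖) μ := by
    refine Integrable.mono' ((integrable_const (1 : ℝ)).add hi)
      hFm.norm.aestronglyMeasurable (ae_of_all _ fun θ => ?_)
    rw [norm_norm]
    exact hle _ (norm_nonneg _)
  have hFi : Integrable F μ := (integrable_norm_iff hFm.aestronglyMeasurable).1 hFn
  have hFa : ∫ θ, ‖F θ‖ ∂μ ≤ 1 + a := by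
    calc ∫ θ, ‖F θ‖ ∂μ ≤ ∫ θ, (1 + ‖F θ‖ ^ (1 + s)) ∂μ :=
          integral_mono hFn ((integrable_const (1 : ℝ)).add hi) fun θ => hle _ (norm_nonneg _)
      _ = 1 + a := by rw [integral_add (integrable_const _) hi]; simp [ha, hF]
  have hPa : ‖∫ θ, F θ ∂μ‖ ^ (1 + s) ≤ a := by
    have h1 := enorm_integral_rpow_le (μ := μ) hFm (p := 1 + s) (by linarith)
    have h2 : ∀ z : Space d, ‖z‖ₑ ^ (1 + s) = ENNReal.ofReal (‖z‖ ^ (1 + s)) := by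
      intro z
      rw [← ofReal_norm, ENNReal.ofReal_rpow_of_nonneg (norm_nonneg _) (by linarith)]
    simp only [h2] at h1
    rw [← ofReal_integral_eq_lintegral_ofReal hi (ae_of_all _ fun θ => by positivity)] at h1
    exact (ENNReal.ofReal_le_ofReal_iff ha0).1 h1
  set n : ℝ := levyDensity d m y with hndef
  have hn0 : 0 ≤ n := levyDensity_nonneg hm y
  set φ : ℝ := ⟪y, ∫ θ, F θ ∂μ⟫_ℝ with hφ
  have hφle : |φ| ≤ ‖y‖ * ‖∫ θ, F θ ∂μ‖ := abs_real_inner_le_norm _ _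
  have hφint : φ = ∫ θ, ⟪y, F θ⟫_ℝ ∂μ := by
    rw [hφ, integral_inner hFi]
  have hphase : phase (weightedPotential μ A) (x, y) = Complex.exp (-Complex.I * (φ : ℂ)) := by
    simp only [phase]
    rw [weightedPotential_add]
  have hFj : ∀ j, Integrable (fun θ => ((F θ j : ℝ) : ℂ) * f (x + θ • y)) μ := by
    intro j
    have h1 : Integrable (fun θ => F θ j) μ := by
      refine Integrable.mono' hFn (Measurable.aestronglyMeasurable (by fun_prop))
        (ae_of_all _ fun θ => PiLp.norm_apply_le _ _)
    have h2 : Integrable (fun θ => ((F θ j : ℝ) : ℂ)) μ := h1.ofReal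
    refine h2.mul_bdd (c := M) (Continuous.aestronglyMeasurable (by fun_prop))
      (ae_of_all _ fun θ => hM _)
  have hinner : Integrable (fun θ => ⟪y, F θ⟫_ℝ) μ := hFi.const_inner y
  have hinner' : Integrable (fun θ => ((⟪y, F θ⟫_ℝ : ℝ) : ℂ)) μ := hinner.ofReal
  have hif : Integrable (fun θ => ((⟪y, F θ⟫_ℝ : ℝ) : ℂ) * f (x + θ • y)) μ :=
    hinner'.mul_bdd (c := M) (Continuous.aestronglyMeasurable (by fun_prop))
      (ae_of_all _ fun θ => hM _)
  set κ : ℝ := c / ‖y‖ ^ (d + 1) with hκ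
  have hsum : (c : ℂ) * ∑ j, ((y j / ‖y‖ ^ (d + 1) : ℝ) : ℂ) *
      ∫ θ, ((F θ j : ℝ) : ℂ) * f (x + θ • y) ∂μ =
        ∫ θ, ((⟪y, F θ⟫_ℝ : ℝ) : ℂ) * (((κ : ℝ) : ℂ) * f (x + θ • y)) ∂μ := by
    have h1 : ∀ j, ((y j / ‖y‖ ^ (d + 1) : ℝ) : ℂ) * ∫ θ, ((F θ j : ℝ) : ℂ) * f (x + θ • y) ∂μ =
        ∫ θ, ((y j / ‖y‖ ^ (d + 1) : ℝ) : ℂ) * (((F θ j : ℝ) : ℂ) * f (x + θ • y)) ∂μ := by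
      intro j
      rw [integral_const_mul]
    simp only [h1]
    rw [← integral_finsetSum _ fun j _ => (hFj j).const_mul _, ← integral_const_mul]
    congr 1
    ext1 θ
    have h2 : ⟪y, F θ⟫_ℝ = ∑ j, y j * F θ j := by
      rw [PiLp.inner_apply]
      refine Finset.sum_congr rfl fun j _ => ?_
      simp [mul_comm]
    rw [h2, hκ]
    push_cast
    rw [Finset.mul_sum, Finset.sum_mul]
    refine Finset.sum_congr rfl fun j _ => ?_
    ring
  -- Three errors: of the exponential to second order, of Taylor's formula for `f`, and of replacing
  -- `f(x + y) n(y)` by `κ f(x + θy)` in the first-order phase term, where `κ` is the leading part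
  -- of the density.
  have hsplit : remainder μ A m c f x y =
      (Complex.exp (-Complex.I * (φ : ℂ)) - 1 + Complex.I * (φ : ℂ)) * f (x + y) * (n : ℂ) +
      (f (x + y) - f x - fderiv ℝ f x y) * (n : ℂ) -
      Complex.I * ∫ θ, ((⟪y, F θ⟫_ℝ : ℝ) : ℂ) *
        (f (x + y) * (n : ℂ) - ((κ : ℝ) : ℂ) * f (x + θ • y)) ∂μ := by
    have i1 : Integrable (fun θ => ((⟪y, F θ⟫_ℝ : ℝ) : ℂ) * (f (x + y) * (n : ℂ))) μ :=
      hinner'.mul_const _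
    have i2 : Integrable (fun θ => ((⟪y, F θ⟫_ℝ : ℝ) : ℂ) * (((κ : ℝ) : ℂ) * f (x + θ • y))) μ := by
      refine (hif.const_mul ((κ : ℝ) : ℂ)).congr (ae_of_all _ fun θ => ?_)
      dsimp only
      ring
    simp only [mul_sub (((⟪y, F _⟫_ℝ : ℝ) : ℂ))]
    rw [integral_sub i1 i2, integral_mul_const, integral_complex_ofReal, ← hφint, remainder,
      mul_assoc Complex.I (c : ℂ), hsum, hphase]
    ring
  have hny : n ≤ C / ‖y‖ ^ (d + 1) := hn y
  have hny' : |n - κ| ≤ C / ‖y‖ ^ d := hn' y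
  rw [hsplit]
  clear_value n κ φ a
  have b1 : ‖(Complex.exp (-Complex.I * (φ : ℂ)) - 1 + Complex.I * (φ : ℂ)) * f (x + y) * (n : ℂ)‖ ≤
      3 * M * C * ‖y‖ ^ (s - d) * (1 + a) := by
    rw [norm_mul, norm_mul, Complex.norm_real, Real.norm_of_nonneg hn0]
    have h1 : |φ| ^ (1 + s) ≤ ‖y‖ ^ (1 + s) * a := by
      calc |φ| ^ (1 + s) ≤ (‖y‖ * ‖∫ θ, F θ ∂μ‖) ^ (1 + s) :=
            Real.rpow_le_rpow (abs_nonneg _) hφle (by linarith)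
        _ = ‖y‖ ^ (1 + s) * ‖∫ θ, F θ ∂μ‖ ^ (1 + s) :=
            Real.mul_rpow (norm_nonneg _) (norm_nonneg _)
        _ ≤ _ := by gcongr
    have h2 := rpow_mul_inv_pow_le (d := d) hρ.le hs hC
    calc _ ≤ (3 * (‖y‖ ^ (1 + s) * a)) * M * (C / ‖y‖ ^ (d + 1)) := by
          refine mul_le_mul (mul_le_mul ?_ (hM _) (norm_nonneg _) (by positivity)) hny hn0
            (by positivity)
          exact (norm_exp_sub_one_add_le φ hs.le hs1).trans (by linarith)
      _ = 3 * M * a * (‖y‖ ^ (1 + s) * (C / ‖y‖ ^ (d + 1))) := by ring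
      _ ≤ 3 * M * a * (C * ‖y‖ ^ (s - d)) := by gcongr
      _ = 3 * M * C * ‖y‖ ^ (s - d) * a := by ring
      _ ≤ _ := by
          gcongr
          linarith
  have hpow : ∀ K : ℝ, 0 ≤ K → K * ‖y‖ ^ (1 - d : ℝ) ≤ K * ‖y‖ ^ (s - d) := by
    intro K hK
    exact mul_le_mul_of_nonneg_left
      (Real.rpow_le_rpow_of_exponent_ge hρ hy.le (by linarith)) hK
  have hpd : ‖y‖ ^ (1 - d : ℝ) = ‖y‖ / ‖y‖ ^ d := by
    rw [Real.rpow_sub hρ, Real.rpow_one, Real.rpow_natCast]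
  have b2 : ‖(f (x + y) - f x - fderiv ℝ f x y) * (n : ℂ)‖ ≤
      L' * C * ‖y‖ ^ (s - d) * (1 + a) := by
    rw [norm_mul, Complex.norm_real, Real.norm_of_nonneg hn0]
    calc _ ≤ (L' * ‖y‖ ^ 2) * (C / ‖y‖ ^ (d + 1)) :=
          mul_le_mul (hT x y) hny hn0 (by positivity)
      _ = L' * C * ‖y‖ ^ (1 - d : ℝ) := by
          rw [hpd]
          field_simp
          ring
      _ ≤ L' * C * ‖y‖ ^ (s - d) := hpow _ (by positivity)
      _ ≤ _ := le_mul_of_one_le_right (by positivity) (by linarith)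
  have b3 : ‖Complex.I * ∫ θ, ((⟪y, F θ⟫_ℝ : ℝ) : ℂ) *
        (f (x + y) * (n : ℂ) - ((κ : ℝ) : ℂ) * f (x + θ • y)) ∂μ‖ ≤
      (L + M) * C * ‖y‖ ^ (s - d) * (1 + a) := by
    rw [norm_mul, Complex.norm_I, one_mul]
    have h1 : ‖∫ θ, ((⟪y, F θ⟫_ℝ : ℝ) : ℂ) *
        (f (x + y) * (n : ℂ) - ((κ : ℝ) : ℂ) * f (x + θ • y)) ∂μ‖ ≤
        ∫ θ, (L + M) * C * ‖y‖ ^ (1 - d : ℝ) * ‖F θ‖ ∂μ := by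
      refine norm_integral_le_of_norm_le (hFn.const_mul _) ?_
      filter_upwards [hμ.mem_Icc] with θ hθ
      have h2 : ‖f (x + y) * (n : ℂ) - ((κ : ℝ) : ℂ) * f (x + θ • y)‖ ≤ (L + M) * (C / ‖y‖ ^ d) := by
        -- The Lipschitz bound handles moving the argument of `f`; the error `C / ‖y‖ ^ d` of the
        -- leading term handles replacing `n` by `κ`.
        have e : f (x + y) * (n : ℂ) - ((κ : ℝ) : ℂ) * f (x + θ • y) =
            (f (x + y) - f (x + θ • y)) * (n : ℂ) + f (x + θ • y) * ((n - κ : ℝ) : ℂ) := by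
          push_cast
          ring
        rw [e]
        refine (norm_add_le _ _).trans ?_
        rw [norm_mul, norm_mul, Complex.norm_real, Complex.norm_real, Real.norm_of_nonneg hn0,
          Real.norm_eq_abs]
        have h3 : ‖f (x + y) - f (x + θ • y)‖ ≤ L * ‖y‖ := by
          refine (hL _ _).trans ?_
          gcongr
          rw [show x + y - (x + θ • y) = (1 - θ) • y by module, norm_smul,
            Real.norm_of_nonneg (by linarith [hθ.2])]
          exact mul_le_of_le_one_left (norm_nonneg _) (by linarith [hθ.1])
        calc _ ≤ (L * ‖y‖) * (C / ‖y‖ ^ (d + 1)) + M * (C / ‖y‖ ^ d) :=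
              add_le_add (mul_le_mul h3 hny hn0 (by positivity))
                (mul_le_mul (hM _) hny' (abs_nonneg _) hM0)
          _ = _ := by
              rw [pow_succ]
              field_simp
      rw [norm_mul, Complex.norm_real]
      calc _ ≤ (‖y‖ * ‖F θ‖) * ((L + M) * (C / ‖y‖ ^ d)) :=
            mul_le_mul (norm_inner_le_norm _ _) h2 (norm_nonneg _) (by positivity)
        _ = _ := by rw [hpd]; ring
    refine h1.trans ?_
    rw [integral_const_mul]
    exact mul_le_mul (hpow _ (by positivity)) hFa (integral_nonneg fun θ => norm_nonneg _)
      (by positivity)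
  calc _ ≤ _ := norm_sub_le _ _
    _ ≤ _ := add_le_add ((norm_add_le _ _).trans (add_le_add b1 b2)) b3
    _ = _ := by ring

end Remainder

/-! ### Absolute convergence of the remainder in `L²`. -/

section PrincipalValue

variable {d : ℕ}

/-- A majorant for the potential along the segments of direction `y`. -/
def segmentMajorant (μ : Measure ℝ) (A : Space d → Space d) (s R : ℝ) (x y : Space d) : ENNReal :=
  (Metric.closedBall (0 : Space d) R).indicator
    (fun x => 1 + ∫⁻ θ, ‖A (x + θ • y)‖ₑ ^ (1 + s) ∂μ) x

theorem measurable_segmentMajorant {μ : Measure ℝ} [SFinite μ] {A : Space d → Space d}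
    (hA : Measurable A) (s R : ℝ) :
    Measurable (Function.uncurry (segmentMajorant μ A s R)) := by
  have h1 : Measurable fun q : (Space d × Space d) × ℝ => ‖A (q.1.1 + q.2 • q.1.2)‖ₑ ^ (1 + s) :=
    ((hA.comp (by fun_prop : Measurable fun q : (Space d × Space d) × ℝ =>
      q.1.1 + q.2 • q.1.2)).enorm).pow_const _
  have h2 : Measurable fun p : Space d × Space d =>
      1 + ∫⁻ θ, ‖A (p.1 + θ • p.2)‖ₑ ^ (1 + s) ∂μ := h1.lintegral_prod_right'.const_add 1
  have h3 := h2.indicator (measurable_fst (measurableSet_closedBall (x := (0 : Space d)) (ε := R)))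
  exact h3

/-- Cauchy–Schwarz in `θ` moves the square inside the average, which puts the exponent `2 + 2s` on
`A`; integration in `x` then only translates a ball. -/
theorem exists_lintegral_segmentMajorant_sq_le {μ : Measure ℝ} (hμ : IsSegmentWeight μ)
    {A : Space d → Space d} (hA : Measurable A) {s : ℝ} (hs : 0 < s) (hL : LocLp A (2 + 2 * s))
    (R : ℝ) : ∃ B : ENNReal, B < ⊤ ∧ ∀ y : Space d, ‖y‖ ≤ 1 →
      ∫⁻ x, segmentMajorant μ A s R x y ^ 2 ≤ B := by
  have := hμ.prob
  let g : Space d → ENNReal := fun z => (1 + ‖A z‖ₑ ^ (1 + s)) ^ 2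
  have hg : Measurable g := by fun_prop
  refine ⟨∫⁻ z in Metric.closedBall (0 : Space d) (R + 1), g z, ?_, fun y hy => ?_⟩
  · have h1 : ∀ z, g z ≤ 2 * (1 + ‖A z‖ₑ ^ (2 + 2 * s)) := by
      intro z
      have h2 := ENNReal.rpow_add_le_mul_rpow_add_rpow 1 (‖A z‖ₑ ^ (1 + s)) (p := 2) (by norm_num)
      rw [← ENNReal.rpow_mul, ENNReal.rpow_two, ENNReal.one_rpow] at h2
      rw [show (1 + s) * 2 = 2 + 2 * s by ring, show (2 : ℝ) - 1 = 1 by norm_num,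
        ENNReal.rpow_one] at h2
      exact h2
    refine (lintegral_mono h1).trans_lt ?_
    rw [lintegral_const_mul' _ _ (by simp), lintegral_add_left measurable_const, setLIntegral_one]
    exact ENNReal.mul_lt_top (by simp) (ENNReal.add_lt_top.2 ⟨measure_closedBall_lt_top,
      hL.lintegral_lt_top (by linarith) _⟩)
  · refine le_trans ?_ (lintegral_segment_le hμ hg R hy)
    rw [← lintegral_indicator measurableSet_closedBall]
    refine lintegral_mono fun x => ?_
    by_cases hx : x ∈ Metric.closedBall (0 : Space d) R
    · rw [segmentMajorant, Set.indicator_of_mem hx, Set.indicator_of_mem hx]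
      have hm : Measurable fun θ : ℝ => ‖A (x + θ • y)‖ₑ ^ (1 + s) :=
        ((hA.comp (by fun_prop : Measurable fun θ : ℝ => x + θ • y)).enorm).pow_const _
      have h1 := lintegral_mul_sq_le (ν := μ) (κ := fun _ => 1)
        (b := fun θ => 1 + ‖A (x + θ • y)‖ₑ ^ (1 + s)) aemeasurable_const
        (hm.const_add 1).aemeasurable
      simp only [one_mul, lintegral_one, measure_univ] at h1
      rw [lintegral_add_left measurable_const, lintegral_one, measure_univ] at h1
      exact h1
    · rw [segmentMajorant, Set.indicator_of_notMem hx, Set.indicator_of_notMem hx]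
      simp

/-- Outside the ball of radius `R + 1` the whole segment misses the support of `f`, and the
remainder vanishes. Inside, either `|A|^{1+s}` is integrable along the segment and the pointwise
bound applies, or the majorant is infinite. -/
theorem exists_enorm_remainder_le {μ : Measure ℝ} (hμ : IsSegmentWeight μ)
    {A : Space d → Space d} (hA : Measurable A) {m c C s : ℝ} (hC : 0 ≤ C) (hm : 0 ≤ m)
    (hs : 0 < s) (hs1 : s ≤ 1)
    (hn : ∀ y : Space d, levyDensity d m y ≤ C / ‖y‖ ^ (d + 1))
    (hn' : ∀ y : Space d, |levyDensity d m y - c / ‖y‖ ^ (d + 1)| ≤ C / ‖y‖ ^ d)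
    {f : Space d → ℂ} (hf : IsTest f) :
    ∃ K R : ℝ, 0 ≤ K ∧ ∀ x y, ‖y‖ < 1 → ‖remainder μ A m c f x y‖ₑ ≤
      ENNReal.ofReal (K * ‖y‖ ^ (s - d)) * segmentMajorant μ A s R x y := by
  have := hμ.prob
  obtain ⟨M, L, R, hM0, hL0, hR0, hM, hLip, hR⟩ := hf.exists_bounds
  obtain ⟨L', hL'0, hT⟩ := hf.exists_taylor
  have hfd : ∀ x, R < ‖x‖ → fderiv ℝ f x = 0 := by
    intro x hx
    have h1 : f =ᶠ[𝓝 x] fun _ => 0 := by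
      filter_upwards [(isOpen_lt continuous_const continuous_norm).mem_nhds hx] with z hz
        using hR z hz
    rw [h1.fderiv_eq]
    simp
  -- The summand `1` makes `K` positive, so that an infinite majorant is not multiplied by zero.
  set K : ℝ := 3 * M * C + L' * C + (L + M) * C + 1 with hK
  have hK0 : 0 < K := by positivity
  have hKle : 3 * M * C + L' * C + (L + M) * C ≤ K := by linarith
  clear_value K
  refine ⟨K, R + 1, hK0.le, fun x y hy => ?_⟩
  rcases eq_or_ne y 0 with rfl | hy0
  · have : remainder μ A m c f x 0 = 0 := by simp [remainder, phase]
    rw [this]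
    simp
  have hρ : 0 < ‖y‖ := norm_pos_iff.2 hy0
  by_cases hx : x ∈ Metric.closedBall (0 : Space d) (R + 1)
  · rw [segmentMajorant, Set.indicator_of_mem hx]
    have hm' : Measurable fun θ : ℝ => ‖A (x + θ • y)‖ ^ (1 + s) :=
      ((hA.comp (by fun_prop : Measurable fun θ : ℝ => x + θ • y)).norm).pow_const _
    have h2 : ∀ z : Space d, ‖z‖ₑ ^ (1 + s) = ENNReal.ofReal (‖z‖ ^ (1 + s)) := by
      intro z
      rw [← ofReal_norm, ENNReal.ofReal_rpow_of_nonneg (norm_nonneg _) (by linarith)]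
    simp only [h2]
    by_cases hi : Integrable (fun θ => ‖A (x + θ • y)‖ ^ (1 + s)) μ
    · have h3 := norm_remainder_le hμ hA hC hm hs hs1 hM0 hL0 hL'0 hn hn' hf.1.continuous hM hLip
        hT hy0 hy hi
      have h4 : 0 ≤ ∫ θ, ‖A (x + θ • y)‖ ^ (1 + s) ∂μ := integral_nonneg fun θ => by positivity
      rw [← ofReal_integral_eq_lintegral_ofReal hi (ae_of_all _ fun θ => by positivity),
        ← ENNReal.ofReal_one, ← ENNReal.ofReal_add zero_le_one h4,
        ← ENNReal.ofReal_mul (by positivity), ← ofReal_norm]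
      refine ENNReal.ofReal_le_ofReal (h3.trans ?_)
      exact mul_le_mul_of_nonneg_right (mul_le_mul_of_nonneg_right hKle (by positivity))
        (by linarith)
    · have h3 : ∫⁻ θ, ENNReal.ofReal (‖A (x + θ • y)‖ ^ (1 + s)) ∂μ = ⊤ := by
        by_contra h
        refine hi ((lintegral_ofReal_ne_top_iff_integrable hm'.aestronglyMeasurable
          (ae_of_all _ fun θ => ?_)).1 h)
        change 0 ≤ ‖A (x + θ • y)‖ ^ (1 + s)
        positivity
      have h4 : ENNReal.ofReal (K * ‖y‖ ^ (s - d)) ≠ 0 := by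
        rw [Ne, ENNReal.ofReal_eq_zero, not_le]
        positivity
      rw [h3, add_top, ENNReal.mul_top h4]
      exact le_top
  · rw [mem_closedBall_zero_iff, not_le] at hx
    have hz : ∀ θ ∈ Set.Icc (0 : ℝ) 1, f (x + θ • y) = 0 := by
      intro θ hθ
      apply hR
      have h1 : ‖θ • y‖ ≤ ‖y‖ := by
        rw [norm_smul, Real.norm_of_nonneg hθ.1]
        exact mul_le_of_le_one_left (norm_nonneg _) hθ.2
      have h2 : ‖x‖ ≤ ‖x + θ • y‖ + ‖θ • y‖ := by
        have := norm_sub_le (x + θ • y) (θ • y)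
        rwa [add_sub_cancel_right] at this
      linarith
    have h0 : f x = 0 := hR x (by linarith)
    have h1 : f (x + y) = 0 := by simpa using hz 1 (by simp)
    have h2 : ∀ j, ∫ θ, ((A (x + θ • y) j : ℝ) : ℂ) * f (x + θ • y) ∂μ = 0 := by
      intro j
      refine integral_eq_zero_of_ae ?_
      filter_upwards [hμ.mem_Icc] with θ hθ
      rw [hz θ hθ, mul_zero]
      rfl
    have : remainder μ A m c f x y = 0 := by
      simp only [remainder, h0, h1, h2, hfd x (by linarith)]
      simp
    rw [this]
    simp

/-- The integrals over shrinking annuli of a kernel with an integrable majorant converge in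
`L²`. -/
theorem tendsto_eLpNorm_setIntegral (hd : 1 ≤ d) {D : Space d → Space d → ℂ}
    (hDm : Measurable (Function.uncurry D)) {κ : Space d → ENNReal} (hκ : Measurable κ)
    (hκt : ∫⁻ y in annulus d 0, κ y < ⊤) {b : Space d → Space d → ENNReal}
    (hb : Measurable (Function.uncurry b)) {B : ENNReal} (hBt : B < ⊤)
    (hB : ∀ y, ‖y‖ < 1 → ∫⁻ x, b x y ^ 2 ≤ B)
    (hD : ∀ x y, ‖y‖ < 1 → ‖D x y‖ₑ ≤ κ y * b x y) :
    MemLp (fun x => ∫ y in annulus d 0, D x y) 2 volume ∧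
      Tendsto (fun r => eLpNorm (fun x => (∫ y in annulus d r, D x y) -
        ∫ y in annulus d 0, D x y) 2 volume) (𝓝[>] 0) (𝓝 0) := by
  have hS : ∀ S : Set (Space d), MeasurableSet S → S ⊆ annulus d 0 →
      eLpNorm (fun x => ∫ y in S, D x y) 2 volume ≤ B ^ (1 / 2 : ℝ) * ∫⁻ y in S, κ y := by
    intro S hSm hSs
    refine eLpNorm_integral_le hκ hb ?_ (ae_of_all _ fun x => ?_)
    · exact (ae_restrict_iff' hSm).2 (ae_of_all _ fun y hy => hB y (hSs hy).2)
    · exact (ae_restrict_iff' hSm).2 (ae_of_all _ fun y hy => hD x y (hSs hy).2)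
  have hBt' : B ^ (1 / 2 : ℝ) ≠ ⊤ := ENNReal.rpow_ne_top_of_nonneg (by norm_num) hBt.ne
  -- Integrability for almost every `x` justifies splitting the ball into an annulus and a small
  -- ball.
  have hint : ∀ᵐ x, IntegrableOn (D x) (annulus d 0) := by
    refine ae_integrable_of_le hκ hb hBt hκt ?_ hDm (ae_of_all _ fun x => ?_)
    · exact (ae_restrict_iff' (measurableSet_annulus 0)).2 (ae_of_all _ fun y hy => hB y hy.2)
    · exact (ae_restrict_iff' (measurableSet_annulus 0)).2 (ae_of_all _ fun y hy => hD x y hy.2)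
  refine ⟨⟨?_, ?_⟩, ?_⟩
  · exact (hDm.stronglyMeasurable.integral_prod_right'
      (ν := volume.restrict (annulus d 0))).aestronglyMeasurable
  · exact (hS _ (measurableSet_annulus 0) subset_rfl).trans_lt
      (ENNReal.mul_lt_top hBt'.lt_top hκt)
  · have : Nontrivial (Space d) := by
      have : Nonempty (Fin d) := ⟨⟨0, hd⟩⟩
      infer_instance
    -- What the truncation omits is a ball of radius `r`; absolute continuity of the integral of `κ`
    -- makes its contribution vanish.
    have hvol : Tendsto ((volume.restrict (annulus d 0)) ∘ fun r : ℝ => Metric.ball (0 : Space d) r)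
        (𝓝[>] 0) (𝓝 0) := by
      have h1 : Tendsto (fun r : ℝ => ENNReal.ofReal (r ^ d) *
          volume (Metric.ball (0 : Space d) 1)) (𝓝[>] 0) (𝓝 0) := by
        have h2 : Tendsto (fun r : ℝ => ENNReal.ofReal (r ^ d)) (𝓝[>] 0) (𝓝 0) := by
          have h3 : Continuous fun r : ℝ => ENNReal.ofReal (r ^ d) :=
            ENNReal.continuous_ofReal.comp (by fun_prop)
          have h4 := h3.tendsto 0
          rw [zero_pow (by lia), ENNReal.ofReal_zero] at h4
          exact h4.mono_left nhdsWithin_le_nhds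
        have h5 := ENNReal.Tendsto.mul_const (b := volume (Metric.ball (0 : Space d) 1)) h2
          (Or.inr measure_ball_lt_top.ne)
        rwa [zero_mul] at h5
      refine tendsto_of_tendsto_of_tendsto_of_le_of_le' tendsto_const_nhds h1
        (Eventually.of_forall fun _ => zero_le) ?_
      filter_upwards [self_mem_nhdsWithin] with r hr
      refine (Measure.restrict_apply_le _ _).trans (le_of_eq ?_)
      rw [Measure.addHaar_ball volume (0 : Space d) (le_of_lt hr)]
      simp
    have hlim := tendsto_setLIntegral_zero hκt.ne hvol
    have hlim' := ENNReal.Tendsto.const_mul (a := B ^ (1 / 2 : ℝ)) hlim (Or.inr hBt')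
    rw [mul_zero] at hlim'
    refine tendsto_of_tendsto_of_tendsto_of_le_of_le' tendsto_const_nhds hlim'
      (Eventually.of_forall fun _ => zero_le) ?_
    filter_upwards [Ioo_mem_nhdsGT (zero_lt_one' ℝ)] with r hr
    have hsub : Metric.ball (0 : Space d) r ⊆ annulus d 0 := fun y hy =>
      ⟨norm_nonneg y, (mem_ball_zero_iff.1 hy).trans hr.2⟩
    have hunion : annulus d 0 = annulus d r ∪ Metric.ball (0 : Space d) r := by
      ext y
      rw [Set.mem_union, mem_ball_zero_iff]
      change (0 ≤ ‖y‖ ∧ ‖y‖ < 1) ↔ (r ≤ ‖y‖ ∧ ‖y‖ < 1) ∨ ‖y‖ < r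
      have := norm_nonneg y
      have := hr.2
      constructor
      · rintro ⟨-, h⟩
        rcases lt_or_ge ‖y‖ r with h' | h'
        · exact Or.inr h'
        · exact Or.inl ⟨h', h⟩
      · rintro (⟨-, h⟩ | h)
        · exact ⟨norm_nonneg y, h⟩
        · exact ⟨norm_nonneg y, by linarith⟩
    have hdisj : Disjoint (annulus d r) (Metric.ball (0 : Space d) r) := by
      rw [Set.disjoint_left]
      intro y hy hy'
      exact absurd hy.1 (not_le.2 (mem_ball_zero_iff.1 hy'))
    have e : eLpNorm (fun x => (∫ y in annulus d r, D x y) - ∫ y in annulus d 0, D x y) 2 volume =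
        eLpNorm (fun x => ∫ y in Metric.ball (0 : Space d) r, D x y) 2 volume := by
      rw [← eLpNorm_neg]
      refine eLpNorm_congr_ae ?_
      filter_upwards [hint] with x hx
      have h1 := hx
      rw [hunion, integrableOn_union] at h1
      rw [Pi.neg_apply, hunion, setIntegral_union hdisj measurableSet_ball h1.1 h1.2]
      ring
    rw [e, Measure.restrict_restrict measurableSet_ball, Set.inter_eq_left.2 hsub]
    exact hS _ measurableSet_ball hsub

end PrincipalValue

/-! ### Existence of the principal value on test functions. -/

section Existence

variable {d : ℕ}

theorem truncatedDensity_eq_add (m : ℝ) {r : ℝ} (hr1 : r ≤ 1) (y : Space d) :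
    truncatedDensity d m r y =
      truncatedDensity d m 1 y + (annulus d r).indicator (levyDensity d m) y := by
  have e1 : y ∈ {y : Space d | r ≤ ‖y‖} ↔ r ≤ ‖y‖ := Iff.rfl
  have e2 : y ∈ {y : Space d | 1 ≤ ‖y‖} ↔ 1 ≤ ‖y‖ := Iff.rfl
  have e3 : y ∈ annulus d r ↔ r ≤ ‖y‖ ∧ ‖y‖ < 1 := Iff.rfl
  rcases lt_or_ge ‖y‖ 1 with h | h
  · have h2 : y ∉ {y : Space d | 1 ≤ ‖y‖} := by rw [e2]; exact not_le.2 h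
    by_cases h1 : r ≤ ‖y‖
    · rw [truncatedDensity, truncatedDensity, Set.indicator_of_mem (e1.2 h1),
        Set.indicator_of_notMem h2, Set.indicator_of_mem (e3.2 ⟨h1, h⟩), zero_add]
    · rw [truncatedDensity, truncatedDensity, Set.indicator_of_notMem (mt e1.1 h1),
        Set.indicator_of_notMem h2, Set.indicator_of_notMem fun h3 => h1 (e3.1 h3).1, zero_add]
  · rw [truncatedDensity, truncatedDensity, Set.indicator_of_mem (e1.2 (hr1.trans h)),
      Set.indicator_of_mem (e2.2 h), Set.indicator_of_notMem fun h3 => (not_lt.2 h) (e3.1 h3).2,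
      add_zero]

theorem integrable_annulus_levyDensity (hd : 1 ≤ d) {m : ℝ} (hm : 0 ≤ m) {r : ℝ} (hr : 0 < r) :
    Integrable ((annulus d r).indicator (levyDensity d m)) :=
  (integrable_indicator_iff (measurableSet_annulus r)).2
    ((integrableOn_levyDensity hd hm hr).mono_set fun _ hy => hy.1)

/-- The truncated integral is the sum of a part away from the diagonal, an absolutely convergent
part and singular integrals of the functions `A_j f` along segments. -/
theorem truncatedIntegral_ae_eq (hd : 1 ≤ d) {m : ℝ} (hm : 0 ≤ m) {μ : Measure ℝ}
    (hμ : IsSegmentWeight μ) {A : Space d → Space d} (hA : Measurable A) (c : ℝ)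
    {f : Space d → ℂ} (hf : IsTest f)
    (hG : ∀ j, Integrable fun x => ((A x j : ℝ) : ℂ) * f x) {r : ℝ} (hr : 0 < r) (hr1 : r ≤ 1) :
    ∀ᵐ x, truncatedIntegral (weightedPotential μ A) m r f x =
      truncatedIntegral (weightedPotential μ A) m 1 f x +
        (∫ y in annulus d r, remainder μ A m c f x y) -
        Complex.I * (c : ℂ) * ∑ j, translateAverage ((volume : Measure (Space d)).prod μ)
          (fun w => ((rieszKernel j r w.1 : ℝ) : ℂ)) (fun w => w.2 • w.1)
          (fun x => ((A x j : ℝ) : ℂ) * f x) x := by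
  have := hμ.prob
  obtain ⟨M, -, -, hM0, -, -, hM, -, -⟩ := hf.exists_bounds
  have hfm : Measurable f := hf.1.continuous.measurable
  have hk : ∀ j, Integrable (fun w : Space d × ℝ => ((rieszKernel j r w.1 : ℝ) : ℂ))
      ((volume : Measure (Space d)).prod μ) := by
    intro j
    have h : Integrable fun y : Space d => ((rieszKernel j r y : ℝ) : ℂ) :=
      (integrable_rieszKernel j hr).ofReal
    exact h.comp_fst μ
  -- For almost every `x` the double integral over displacement and parameter converges absolutely,
  -- so the `θ`-average may be taken first.
  have hsec : ∀ᵐ x, ∀ j, Integrable (fun w : Space d × ℝ => ((rieszKernel j r w.1 : ℝ) : ℂ) *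
      (((A (x + w.2 • w.1) j : ℝ) : ℂ) * f (x + w.2 • w.1)))
      ((volume : Measure (Space d)).prod μ) := by
    rw [ae_all_iff]
    intro j
    exact (integrable_translate_prod (hk j) (g := fun w : Space d × ℝ => w.2 • w.1)
      (by fun_prop) (hG j)).prod_right_ae
  filter_upwards [hsec] with x hx
  set N : Fin d → Space d → ℂ := fun j y => ∫ θ, ((A (x + θ • y) j : ℝ) : ℂ) * f (x + θ • y) ∂μ
    with hN
  have hT : ∀ j, Integrable (fun y => ((rieszKernel j r y : ℝ) : ℂ) * N j y) ∧
      translateAverage ((volume : Measure (Space d)).prod μ)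
          (fun w => ((rieszKernel j r w.1 : ℝ) : ℂ)) (fun w => w.2 • w.1)
          (fun x => ((A x j : ℝ) : ℂ) * f x) x =
        ∫ y, ((rieszKernel j r y : ℝ) : ℂ) * N j y := by
    intro j
    have h1 := (hx j).integral_prod_left
    have h2 := integral_prod _ (hx j)
    simp only [integral_const_mul] at h1 h2
    exact ⟨h1, h2⟩
  simp only [fun j => (hT j).2]
  set Φ : Space d → ℂ := fun y => phase (weightedPotential μ A) (x, y) * f (x + y) - f x with hΦ
  have hphm := measurable_phase (measurable_weightedPotential hμ hA)
  have hΦm : Measurable Φ :=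
    ((hphm.comp measurable_prodMk_left).mul (hfm.comp (by fun_prop))).sub_const _
  have hΦb : ∀ y, ‖Φ y‖ ≤ M + M := by
    intro y
    refine (norm_sub_le _ _).trans (add_le_add ?_ (hM x))
    rw [norm_mul, norm_phase, one_mul]
    exact hM _
  have hti : ∀ t, 0 < t → Integrable fun y => Φ y * ((truncatedDensity d m t y : ℝ) : ℂ) := by
    intro t ht
    have h : Integrable fun y => ((truncatedDensity d m t y : ℝ) : ℂ) :=
      (integrable_truncatedDensity hd hm ht).ofReal
    exact h.bdd_mul (c := M + M) hΦm.aestronglyMeasurable (ae_of_all _ hΦb)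
  set ν : Space d → ℝ := (annulus d r).indicator (levyDensity d m) with hν
  have hνi : Integrable ν := integrable_annulus_levyDensity hd hm hr
  have hE : Integrable fun y => fderiv ℝ f x y * ((ν y : ℝ) : ℂ) := by
    refine Integrable.mono' (hνi.norm.const_mul ‖fderiv ℝ f x‖) ?_ (ae_of_all _ fun y => ?_)
    · have h : AEStronglyMeasurable (fun y => ((ν y : ℝ) : ℂ)) volume :=
        hνi.ofReal.aestronglyMeasurable
      exact (fderiv ℝ f x).continuous.aestronglyMeasurable.mul h
    · rw [norm_mul, Complex.norm_real]
      by_cases hy : y ∈ annulus d r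
      · refine mul_le_mul_of_nonneg_right (((fderiv ℝ f x).le_opNorm y).trans ?_) (norm_nonneg _)
        exact mul_le_of_le_one_right (norm_nonneg _) hy.2.le
      · rw [hν, Set.indicator_of_notMem hy, norm_zero, mul_zero, mul_zero]
  -- The gradient term is odd in `y`, so subtracting it in the remainder does not change the
  -- integral over the annulus.
  have hE0 : ∫ y, fderiv ℝ f x y * ((ν y : ℝ) : ℂ) = 0 := by
    refine integral_eq_zero_of_odd fun y => ?_
    have h : ν (-y) = ν y := by
      by_cases hy : y ∈ annulus d r
      · have hy' : -y ∈ annulus d r := by simpa [annulus] using hy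
        rw [hν, Set.indicator_of_mem hy, Set.indicator_of_mem hy', levyDensity_neg]
      · have hy' : -y ∉ annulus d r := by simpa [annulus] using hy
        rw [hν, Set.indicator_of_notMem hy, Set.indicator_of_notMem hy']
    rw [h, map_neg, neg_mul]
  have hsum : Integrable fun y => Complex.I * (c : ℂ) *
      ∑ j, ((rieszKernel j r y : ℝ) : ℂ) * N j y :=
    (integrable_finsetSum _ fun j _ => (hT j).1).const_mul _
  have hpt : ∀ y, (annulus d r).indicator (remainder μ A m c f x) y =
      Φ y * ((truncatedDensity d m r y : ℝ) : ℂ) - Φ y * ((truncatedDensity d m 1 y : ℝ) : ℂ) -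
        fderiv ℝ f x y * ((ν y : ℝ) : ℂ) +
        Complex.I * (c : ℂ) * ∑ j, ((rieszKernel j r y : ℝ) : ℂ) * N j y := by
    intro y
    rw [truncatedDensity_eq_add m hr1 y]
    by_cases hy : y ∈ annulus d r
    · simp only [rieszKernel, hν]
      rw [Set.indicator_of_mem hy, Set.indicator_of_mem hy]
      simp only [Set.indicator_of_mem hy]
      rw [remainder]
      push_cast
      ring
    · simp only [rieszKernel, hν]
      rw [Set.indicator_of_notMem hy, Set.indicator_of_notMem hy]
      simp only [Set.indicator_of_notMem hy]
      simp
  have i1 : Integrable fun y => Φ y * ((truncatedDensity d m r y : ℝ) : ℂ) -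
      Φ y * ((truncatedDensity d m 1 y : ℝ) : ℂ) := (hti r hr).sub (hti 1 one_pos)
  have i2 : Integrable fun y => Φ y * ((truncatedDensity d m r y : ℝ) : ℂ) -
      Φ y * ((truncatedDensity d m 1 y : ℝ) : ℂ) - fderiv ℝ f x y * ((ν y : ℝ) : ℂ) := i1.sub hE
  have hfinal : ∫ y in annulus d r, remainder μ A m c f x y =
      truncatedIntegral (weightedPotential μ A) m r f x -
        truncatedIntegral (weightedPotential μ A) m 1 f x +
        Complex.I * (c : ℂ) * ∑ j, ∫ y, ((rieszKernel j r y : ℝ) : ℂ) * N j y := by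
    rw [← integral_indicator (measurableSet_annulus r), integral_congr_ae (ae_of_all _ hpt),
      integral_add i2 hsum, integral_sub i1 hE,
      integral_sub (hti r hr) (hti 1 one_pos), hE0, sub_zero, integral_const_mul,
      integral_finsetSum _ fun j _ => (hT j).1, ← truncatedIntegral_eq, ← truncatedIntegral_eq]
  rw [hfinal]
  ring

/-- The truncated density is integrable and `|f(x)| + |f(x + y)|` is bounded in `L²` uniformly in
`y`, so Minkowski's inequality applies. -/
theorem memLp_truncatedIntegral (hd : 1 ≤ d) {m : ℝ} (hm : 0 ≤ m)
    {P : Space d → Space d → Space d} (hP : Measurable fun p : Space d × Space d => P p.1 p.2)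
    {f : Space d → ℂ} (hf : IsTest f) {r : ℝ} (hr : 0 < r) :
    MemLp (truncatedIntegral P m r f) 2 volume := by
  have hfm : Measurable f := hf.1.continuous.measurable
  refine ⟨aestronglyMeasurable_truncatedIntegral hP m r hfm, ?_⟩
  have hf2 : ∫⁻ x, ‖f x‖ₑ ^ 2 < ⊤ := by
    have := lintegral_rpow_enorm_lt_top_of_eLpNorm_lt_top (by simp) (by simp)
      (hf.memLp 2).eLpNorm_lt_top
    simpa using this
  set B : ENNReal := 2 * ((∫⁻ x, ‖f x‖ₑ ^ 2) + ∫⁻ x, ‖f x‖ₑ ^ 2) with hB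
  have hBt : B < ⊤ := ENNReal.mul_lt_top (by simp) (ENNReal.add_lt_top.2 ⟨hf2, hf2⟩)
  have hti := integrable_truncatedDensity (d := d) hd hm hr
  have h := eLpNorm_integral_le (ρ := (volume : Measure (Space d)))
    (ν := (volume : Measure (Space d)))
    (κ := fun y => ‖truncatedDensity d m r y‖ₑ) (b := fun x y => ‖f x‖ₑ + ‖f (x + y)‖ₑ) (B := B)
    (D := fun x y => (phase P (x, y) * f (x + y) - f x) * ((truncatedDensity d m r y : ℝ) : ℂ))
    (measurable_truncatedDensity m r).enorm
    (by
      have : Measurable fun p : Space d × Space d => ‖f p.1‖ₑ + ‖f (p.1 + p.2)‖ₑ := by fun_prop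
      exact this)
    (ae_of_all _ fun y => ?_) (ae_of_all _ fun x => ae_of_all _ fun y => ?_)
  · simp only [← truncatedIntegral_eq] at h
    refine h.trans_lt (ENNReal.mul_lt_top ?_ hti.2)
    exact ENNReal.rpow_lt_top_of_nonneg (by norm_num) hBt.ne
  · calc ∫⁻ x, (‖f x‖ₑ + ‖f (x + y)‖ₑ) ^ 2
        ≤ ∫⁻ x, 2 * (‖f x‖ₑ ^ 2 + ‖f (x + y)‖ₑ ^ 2) := by
          refine lintegral_mono fun x => ?_
          have h2 := ENNReal.rpow_add_le_mul_rpow_add_rpow ‖f x‖ₑ ‖f (x + y)‖ₑ (p := 2)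
            (by norm_num)
          simp only [ENNReal.rpow_two] at h2
          rwa [show (2 : ℝ) - 1 = 1 by norm_num, ENNReal.rpow_one] at h2
      _ ≤ B := by
          rw [lintegral_const_mul' _ _ (by simp), lintegral_add_left (by fun_prop),
            lintegral_add_right_eq_self (fun x => ‖f x‖ₑ ^ 2) y]
  · rw [enorm_mul, mul_comm]
    refine mul_le_mul' (le_of_eq ?_) ?_
    · rw [← ofReal_norm, ← ofReal_norm, Complex.norm_real]
    · refine (enorm_sub_le).trans ?_
      rw [enorm_mul, ← ofReal_norm (phase P (x, y)), norm_phase, ENNReal.ofReal_one, one_mul,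
        add_comm]

/-- The principal values of test functions exist in `L²`. -/
theorem definedOnTests_weighted (hd : 1 ≤ d) {m : ℝ} (hm : 0 ≤ m) {μ : Measure ℝ}
    (hμ : IsSegmentWeight μ) {A : Space d → Space d} (hA : Measurable A) {s : ℝ} (hs : 0 < s)
    (hs1 : s ≤ 1) (hL : LocLp A (2 + 2 * s)) :
    DefinedOnTests (integralOperator (weightedPotential μ A) m) := by
  intro f hf
  have := hμ.prob
  have hP := measurable_weightedPotential hμ hA
  have hfm : Measurable f := hf.1.continuous.measurable
  obtain ⟨c, C, hC, hn, hn'⟩ := exists_levyDensity_bounds hd hm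
  have hGm : ∀ j, Measurable fun x => ((A x j : ℝ) : ℂ) * f x := by
    intro j
    have : Measurable fun x => A x j := by fun_prop
    fun_prop
  have hG1 : ∀ j, Integrable fun x => ((A x j : ℝ) : ℂ) * f x := by
    intro j
    have h := (hL.mono (q := 1) (by linarith)).memLp_mul_test j hf
    rw [ENNReal.ofReal_one] at h
    exact memLp_one_iff_integrable.1 h
  have hG2 : ∀ j, MemLp (fun x => ((A x j : ℝ) : ℂ) * f x) 2 volume := by
    intro j
    have h := (hL.mono (q := 2) (by linarith)).memLp_mul_test j hf
    rwa [← two_eq_ofReal] at h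
  choose S hS using fun j => exists_tendsto_riesz hd j hμ (hGm j) (hG1 j) (hG2 j)
  obtain ⟨K, R, hK, hrem⟩ := exists_enorm_remainder_le hμ hA hC hm hs hs1 hn hn' hf
  obtain ⟨B, hBt, hB⟩ := exists_lintegral_segmentMajorant_sq_le hμ hA hs hL R
  have hκi : IntegrableOn (fun y : Space d => K * ‖y‖ ^ (s - d)) (annulus d 0) :=
    IntegrableOn.mono_set (t := Metric.ball 0 1)
      ((integrableOn_norm_rpow_ball hd hs).const_mul K) fun y hy => mem_ball_zero_iff.2 hy.2
  obtain ⟨hV, hVlim⟩ := tendsto_eLpNorm_setIntegral hd (measurable_remainder hμ hA m c hf)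
    (κ := fun y => ENNReal.ofReal (K * ‖y‖ ^ (s - d))) (by fun_prop)
    (hκi.lintegral_lt_top)
    (measurable_segmentMajorant hA s R) hBt (fun y hy => hB y hy.le) hrem
  have hU := memLp_truncatedIntegral hd hm hP hf one_pos
  set u : L2 d := (hf.memLp 2).toLp f with hu
  -- The limit of the truncated integrals, assembled from the far part, the full remainder and the
  -- singular integrals; the operator takes `u` to `m u - z`.
  set z : L2 d := hU.toLp _ + hV.toLp _ - (Complex.I * (c : ℂ)) • ∑ j, S j with hz
  have hza : z =ᵐ[volume] fun x => truncatedIntegral (weightedPotential μ A) m 1 f x +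
      (∫ y in annulus d 0, remainder μ A m c f x y) - Complex.I * (c : ℂ) * ∑ j, S j x := by
    have hSs : ((∑ j, S j : L2 d) : Space d → ℂ) =ᵐ[volume] fun x => ∑ j, S j x := by
      have := Lp.coeFn_finsetSum Finset.univ S
      filter_upwards [this] with x hx
      simpa using hx
    filter_upwards [Lp.coeFn_sub (hU.toLp _ + hV.toLp _) ((Complex.I * (c : ℂ)) • ∑ j, S j),
      Lp.coeFn_add (hU.toLp _) (hV.toLp _), Lp.coeFn_smul (Complex.I * (c : ℂ)) (∑ j, S j), hSs,
      hU.coeFn_toLp, hV.coeFn_toLp] with x h1 h2 h3 h4 h5 h6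
    rw [h1, Pi.sub_apply, h2, Pi.add_apply, h3, Pi.smul_apply, h4, h5, h6, smul_eq_mul]
  have hwa : ((m : ℂ) • u - z : L2 d) =ᵐ[volume] fun x => (m : ℂ) * f x - z x := by
    filter_upwards [Lp.coeFn_sub ((m : ℂ) • u) z, Lp.coeFn_smul (m : ℂ) u,
      (hf.memLp 2).coeFn_toLp] with x h1 h2 h3
    rw [h1, Pi.sub_apply, h2, Pi.smul_apply, h3, smul_eq_mul]
  refine ⟨u, (m : ℂ) • u - z, (hf.memLp 2).coeFn_toLp, f, hf, (hf.memLp 2).coeFn_toLp, ?_⟩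
  dsimp only
  set T : Fin d → ℝ → Space d → ℂ := fun j r =>
    translateAverage ((volume : Measure (Space d)).prod μ)
      (fun w => ((rieszKernel j r w.1 : ℝ) : ℂ)) (fun w => w.2 • w.1)
      (fun x => ((A x j : ℝ) : ℂ) * f x) with hT
  have hTm : ∀ j r, 0 < r → AEStronglyMeasurable (T j r) volume := by
    intro j r hr
    have h : Integrable fun y : Space d => ((rieszKernel j r y : ℝ) : ℂ) :=
      (integrable_rieszKernel j hr).ofReal
    exact (integrable_translateAverage (h.comp_fst μ) (by fun_prop) (hG1 j)).aestronglyMeasurable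
  have hVm : ∀ r, AEStronglyMeasurable (fun x => ∫ y in annulus d r, remainder μ A m c f x y)
      volume := fun r => ((measurable_remainder hμ hA m c hf).stronglyMeasurable.integral_prod_right'
        (ν := volume.restrict (annulus d r))).aestronglyMeasurable
  have hlim : Tendsto (fun r => eLpNorm (fun x => (∫ y in annulus d r, remainder μ A m c f x y) -
        ∫ y in annulus d 0, remainder μ A m c f x y) 2 volume +
      ‖Complex.I * (c : ℂ)‖ₑ * ∑ j, eLpNorm (fun x => T j r x - S j x) 2 volume)
      (𝓝[>] 0) (𝓝 0) := by
    have h1 : Tendsto (fun r => ∑ j, eLpNorm (fun x => T j r x - S j x) 2 volume)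
        (𝓝[>] 0) (𝓝 (∑ _j : Fin d, 0)) := tendsto_finsetSum _ fun j _ => hS j
    have h2 := hVlim.add (ENNReal.Tendsto.const_mul (a := ‖Complex.I * (c : ℂ)‖ₑ) h1
      (Or.inr enorm_ne_top))
    simpa using h2
  refine tendsto_of_tendsto_of_tendsto_of_le_of_le' tendsto_const_nhds hlim
    (Eventually.of_forall fun _ => zero_le) ?_
  filter_upwards [Ioo_mem_nhdsGT (zero_lt_one' ℝ)] with r hr
  have e : eLpNorm (fun x => -truncatedIntegral (weightedPotential μ A) m r f x -
      (((m : ℂ) • u - z : L2 d) x - (m : ℂ) * f x)) 2 volume =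
      eLpNorm ((fun x => (∫ y in annulus d r, remainder μ A m c f x y) -
        ∫ y in annulus d 0, remainder μ A m c f x y) -
        (Complex.I * (c : ℂ)) • ∑ j, fun x => T j r x - S j x) 2 volume := by
    rw [← eLpNorm_neg]
    refine eLpNorm_congr_ae ?_
    filter_upwards [hza, hwa, truncatedIntegral_ae_eq hd hm hμ hA c hf hG1 hr.1 hr.2.le]
      with x h1 h2 h3
    rw [Pi.neg_apply, h2, h1, h3]
    simp only [Pi.sub_apply, Pi.smul_apply, Finset.sum_apply, smul_eq_mul, Finset.sum_sub_distrib,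
      hT]
    ring
  have hTS : ∀ j, AEStronglyMeasurable (fun x => T j r x - S j x) volume := fun j =>
    (hTm j r hr.1).sub (Lp.aestronglyMeasurable _)
  rw [e]
  refine (eLpNorm_sub_le ((hVm r).sub (hVm 0))
    ((Finset.aestronglyMeasurable_sum _ fun j _ => hTS j).const_smul _) (by norm_num)).trans ?_
  refine add_le_add le_rfl ?_
  rw [eLpNorm_const_smul]
  gcongr
  exact eLpNorm_sum_le (fun j _ => hTS j) (by norm_num)

/-- The integral operators are defined on test functions and their closures are bounded below by
the mass. -/
theorem integralOperator_weighted (hd : 1 ≤ d) {m : ℝ} (hm : 0 ≤ m) {μ : Measure ℝ}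
    (hμ : IsSegmentWeight μ) {A : Space d → Space d} {δ : ℝ} (hδ : 0 < δ)
    (hL : LocLp A (2 + δ)) :
    DefinedOnTests (integralOperator (weightedPotential μ A) m) ∧
      BoundedBelow (closure (integralOperator (weightedPotential μ A) m)) m := by
  obtain ⟨A', hA', hAA', hL'⟩ := hL.exists_measurable
  rw [integralOperator_congr m (weightedPotential_congr hμ hAA')]
  -- The choice `s = min (δ/2) 1` ensures `2 + 2s ≤ 2 + δ` and `s ≤ 1`.
  have hmin : 0 < min (δ / 2) 1 := lt_min (by linarith) one_pos
  refine ⟨definedOnTests_weighted hd hm hμ hA' hmin (min_le_right _ _) (hL'.mono ?_),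
    (integralOperator_lower_bound hd hm (measurable_weightedPotential hμ hA')
      (weightedPotential_symm hμ A')).closure⟩
  linarith [min_le_left (δ / 2) 1]

end Existence

end

end MagneticRelativistic

/-! ### The three operators, with both prescriptions treated as segment weights. -/

theorem theorem3p5 (d : ℕ) (hd : 1 ≤ d) (m : ℝ) (hm : 0 ≤ m)
    (A : MagneticRelativistic.Space d → MagneticRelativistic.Space d) :
    -- `H_A^{(1)}`, `H_A^{(2)}` as closures of the integral operators on test functions
    ((∃ δ : ℝ, 0 < δ ∧ MagneticRelativistic.LocLp A (2 + δ)) →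
      (MagneticRelativistic.DefinedOnTests
          (MagneticRelativistic.integralOperator (MagneticRelativistic.midPotential A) m) ∧
        MagneticRelativistic.BoundedBelow
          (closure (MagneticRelativistic.integralOperator
            (MagneticRelativistic.midPotential A) m)) m) ∧
      (MagneticRelativistic.DefinedOnTests
          (MagneticRelativistic.integralOperator (MagneticRelativistic.avgPotential A) m) ∧
        MagneticRelativistic.BoundedBelow
          (closure (MagneticRelativistic.integralOperator
            (MagneticRelativistic.avgPotential A) m)) m)) ∧
    -- `H_A^{(1)}`, `H_A^{(2)}` as selfadjoint operators associated with quadratic forms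
    ((∃ δ : ℝ, 0 < δ ∧ MagneticRelativistic.LocLp A (1 + δ)) →
      (∃ H : MagneticRelativistic.L2 d →ₗ.[ℂ] MagneticRelativistic.L2 d,
        MagneticRelativistic.IsFormOperator (MagneticRelativistic.midPotential A) m H ∧
        MagneticRelativistic.BoundedBelow
          (H.graph : Set (MagneticRelativistic.L2 d × MagneticRelativistic.L2 d)) m) ∧
      (∃ H : MagneticRelativistic.L2 d →ₗ.[ℂ] MagneticRelativistic.L2 d,
        MagneticRelativistic.IsFormOperator (MagneticRelativistic.avgPotential A) m H ∧
        MagneticRelativistic.BoundedBelow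
          (H.graph : Set (MagneticRelativistic.L2 d × MagneticRelativistic.L2 d)) m)) ∧
    -- `H_A^{(3)}`: its existence for locally square integrable `A`, and its lower bound
    (MagneticRelativistic.LocLp A 2 →
      ∃ H : MagneticRelativistic.L2 d →ₗ.[ℂ] MagneticRelativistic.L2 d,
        MagneticRelativistic.IsMagneticSqrt A m H) ∧
    ((∃ δ : ℝ, 0 < δ ∧ MagneticRelativistic.LocLp A (1 + δ)) →
      ∀ H : MagneticRelativistic.L2 d →ₗ.[ℂ] MagneticRelativistic.L2 d,
        MagneticRelativistic.IsMagneticSqrt A m H →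
          MagneticRelativistic.BoundedBelow
            (H.graph : Set (MagneticRelativistic.L2 d × MagneticRelativistic.L2 d)) m) := by
  rw [MagneticRelativistic.midPotential_eq, MagneticRelativistic.avgPotential_eq]
  have hdir := MagneticRelativistic.isSegmentWeight_dirac
  have hvol := MagneticRelativistic.isSegmentWeight_volume
  refine ⟨?_, ?_, fun hA => MagneticRelativistic.exists_isMagneticSqrt hA m,
    fun _ H hH => hH.boundedBelow hm⟩
  · rintro ⟨δ, hδ, hL⟩
    exact ⟨MagneticRelativistic.integralOperator_weighted hd hm hdir hδ hL,
      MagneticRelativistic.integralOperator_weighted hd hm hvol hδ hL⟩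
  · rintro ⟨δ, hδ, hL⟩
    exact ⟨MagneticRelativistic.exists_formOperator_weighted hd hm hdir hδ hL,
      MagneticRelativistic.exists_formOperator_weighted hd hm hvol hδ hL⟩
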